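/- **Setting.** Let $M$ be a smooth manifold (Hausdorff, second countable), $\mathcal R=C^\infty(M)$ its algebra of real smooth functions, and $\Omega^1$ its space of smooth one-forms. Let $E\to M$ be a Courant algebroid: a smooth real vector bundle of finite rank with a smooth fibrewise nondegenerate symmetric bilinear form $\langle\cdot,\cdot\rangle$, a smooth bundle map $\rho:E\to TM$ and an $\mathbb R$-bilinear bracket $[\cdot,\cdot]$ on $\mathcal E=\Gamma(E)$ such that, for all $e_1,e_2,e_3\in\mathcal E$, $$[e_1,[e_2,e_3]]=[[e_1,e_2],e_3]+[e_2,[e_1,e_3]],$$ $$\rho(e_1)\langle e_2,e_3\rangle=\langle [e_1,e_2],e_3\rangle+\langle e_2,[e_1,e_3]\rangle,\qquad [e_1,e_2]+[e_2,e_1]=d_E\langle e_1,e_2\rangle .$$ Here $\rho^*:\Omega^1\to\mathcal E$ and $d_E:\mathcal R\to\mathcal E$ are defined by $\langle\rho^*(\alpha),e\rangle=\alpha(\rho(e))$ and $d_Ef=\rho^*(df)$. **The algebra $\mathcal A$.** An element of $\mathcal A^p$, $p\ge 0$, is a tuple $\omega=(\omega_0,\ldots,\omega_{[p/2]})$ of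 maps $\omega_k:\mathcal E^{p-2k}\times(\Omega^1)^k\to\mathcal R$ that are $\mathbb R$-linear in each argument, symmetric in the one-forms, and satisfy for all $i<p-2k$ $$\omega_k(\ldots,e_i,e_{i+1},\ldots;\alpha_1,\ldots,\alpha_k)+\omega_k(\ldots,e_{i+1},e_i,\ldots;\alpha_1,\ldots,\alpha_k)=-\,\omega_{k+1}(\ldots,\hat e_i,\hat e_{i+1},\ldots;d\langle e_i,e_{i+1}\rangle,\alpha_1,\ldots,\alpha_k).$$ The product of $\omega\in\mathcal A^p$ and $\eta\in\mathcal A^q$ is $$(\omega\cdot\eta)_k(e_1,\ldots,e_{p+q-2k};\alpha_1,\ldots,\alpha_k)=\sum_{r+t=k}\ \sum_{\sigma\in sh(p-2r,q-2t)}\ \sum_{\tau\in sh(r,t)}(-1)^{|\sigma|}\,\omega_r(e_{\sigma(1)},\ldots,e_{\sigma(p-2r)};\alpha_{\tau(1)},\ldots,\alpha_{\tau(r)})\;\eta_t(e_{\sigma(p-2r+1)},\ldots;\alpha_{\tau(r+1)},\ldots,\alpha_{\tau(k)}),$$ where $0\le r\le[p/2]$, $0\le t\le[q/2]$, and $sh$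 denotes the shuffle permutations. **The algebra $\mathfrak D$.** An $\mathbb R$-linear map $D$ from a space of sections to $\mathcal R$ is a differential operator of order at most $0$ if it is $\mathcal R$-linear, and of order at most $s\ge1$ if for every $f\in\mathcal R$ its symbol $e\mapsto D(fe)-fD(e)$ is a differential operator of order at most $s-1$. For $p\ge 1$ and $m\ge1$, $\mathfrak D^p_{m,m-1}\subset\mathcal A^p$ is the space of those $\omega$ all of whose components $\omega_k$ are differential operators of order at most $m$ in each one-form, of order at most $m$ in each of the first $p-2k-1$ sections, and of order at most $m-1$ in the last section; for $p=1$ the unique section counts as a first argument, so that the order in it is at most $m$. For $p=0$, $\mathfrak D^0_{m,m-1}=\mathcal R$. Put $\mathfrak D^p=\bigcup_{m\ge1}\mathfrak D^p_{m,m-1}$ and $\mathfrak D=\mathfrak D(\mathcal E,\mathcal R)=(\mathfrak D^p)_{p\ge0}$. **The differential.** For $\omega\in\mathfrak D^p$ define $d\omega=((d\omega)_0,\ldots,(d\omega)_{[(p+1)/2]})$ by $$\begin{aligned}(d\omega)_k(e_1,\ldots,e_{p+1-2k};\alpha_1,\ldots,\alpha_k)=&\sum_{\mu=1}^k\omega_{k-1}(\rho^*(\alpha_\mu),e_1,\ldots,e_{p+1-2k};\alpha_1,\ldots,\hat\alpha_\mu,\ldots,\alpha_k)\\&+\sum_{i}(-1)^{i-1}\rho(e_i)\big(\omega_k(e_1,\ldots,\hat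 e_i,\ldots,e_{p+1-2k};\alpha_1,\ldots,\alpha_k)\big)\\&+\sum_{i}\sum_{\mu=1}^k(-1)^{i}\omega_k(e_1,\ldots,\hat e_i,\ldots,e_{p+1-2k};\alpha_1,\ldots,i_{\rho(e_i)}d\alpha_\mu,\ldots,\alpha_k)\\&+\sum_{i<j}(-1)^i\omega_k(e_1,\ldots,\hat e_i,\ldots,\hat e_j,[e_i,e_j],e_{j+1},\ldots,e_{p+1-2k};\alpha_1,\ldots,\alpha_k),\end{aligned}$$ where components of $\omega$ with an index outside $0,\ldots,[p/2]$ are zero. **Proposition.** 1. For all $p\ge0$ and $m\ge1$, $d$ maps $\mathfrak D^p_{m,m-1}$ into $\mathfrak D^{p+1}_{m+1,m}$. 2. On exact one-forms $d$ is given by the formula of the standard differential: writing $\omega_k(\ldots;f_1,\ldots,f_k)$ for $\omega_k(\ldots;df_1,\ldots,df_k)$, one has for all $\omega\in\mathfrak D^p$ $$\begin{aligned}(d\omega)_k(e_1,\ldots,e_{p+1-2k};f_1,\ldots,f_k)=&\sum_{\mu=1}^k\omega_{k-1}(d_Ef_\mu,e_1,\ldots,e_{p+1-2k};f_1,\ldots,\hat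 f_\mu,\ldots,f_k)\\&+\sum_{i}(-1)^{i-1}\langle e_i,d_E(\omega_k(e_1,\ldots,\hat e_i,\ldots,e_{p+1-2k};f_1,\ldots,f_k))\rangle\\&+\sum_{i<j}(-1)^i\omega_k(e_1,\ldots,\hat e_i,\ldots,\hat e_j,[e_i,e_j],e_{j+1},\ldots,e_{p+1-2k};f_1,\ldots,f_k).\end{aligned}$$ 3. $d$ is a derivation of degree $+1$ of the algebra $\mathfrak D$: for $\omega\in\mathfrak D^p$ and $\eta\in\mathfrak D^q$, the product $\omega\cdot\eta$ lies in $\mathfrak D^{p+q}$ and $d(\omega\cdot\eta)=d\omega\cdot\eta+(-1)^p\,\omega\cdot d\eta$. 4. $d(d\omega)=0$ for all $\omega\in\mathfrak D^p$, $p\ge0$. 5. Hence $(\mathfrak D,d)$ is a cochain complex of real vector spaces, and its cohomology in degree $p$ is $\mathfrak H^p(\mathcal E,\mathcal R)=\ker(d:\mathfrak D^p\to\mathfrak D^{p+1})\,/\,d(\mathfrak D^{p-1})$, with $\mathfrak D^{-1}=0$. -/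

import Mathlib

open Bundle Manifold VectorField
open scoped Manifold ContDiff Bundle

set_option linter.unusedSectionVars false


namespace CourantDorfman

noncomputable section

section Geometry

variable {EM : Type*} [NormedAddCommGroup EM] [NormedSpace ℝ EM] [FiniteDimensional ℝ EM]
  {H : Type*} [TopologicalSpace H] {I : ModelWithCorners ℝ EM H}
  {M : Type*} [TopologicalSpace M] [ChartedSpace H M] [IsManifold I ∞ M]
  {F : Type*} [NormedAddCommGroup F] [NormedSpace ℝ F] [FiniteDimensional ℝ F]
  {V : M → Type*} [TopologicalSpace (TotalSpace F V)]
  [∀ x, AddCommGroup (V x)] [∀ x, Module ℝ (V x)] [∀ x, TopologicalSpace (V x)]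
  [FiberBundle F V] [VectorBundle ℝ F V]

/-- A map into a space of linear maps is smooth once it is smooth at each fixed vector. -/
theorem contMDiffAt_clm_of_apply {W : Type*} [NormedAddCommGroup W] [NormedSpace ℝ W]
    {A : M → F →L[ℝ] W} {x₀ : M}
    (h : ∀ v, ContMDiffAt I 𝓘(ℝ, W) ∞ (fun x => A x v) x₀) :
    ContMDiffAt I 𝓘(ℝ, F →L[ℝ] W) ∞ A x₀ := by
  let b := Module.finBasis ℝ F
  have key : A = fun x => ∑ i, ContinuousLinearMap.smulRightL ℝ F W
      (LinearMap.toContinuousLinearMap (b.coord i)) (A x (b i)) := by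
    funext x
    ext v
    have hv := congrArg (A x) (b.sum_repr v)
    simp only [map_sum, map_smul] at hv
    simpa using hv.symm
  rw [key]
  refine ContMDiffAt.sum fun i _ => ?_
  exact (ContinuousLinearMap.contMDiff _).contMDiffAt.comp x₀ (h (b i))

/-- A section of the dual bundle is smooth at a point if its pairings with all sections that are
smooth near that point are smooth there. -/
theorem contMDiffAt_dual [ContMDiffVectorBundle ∞ F V I] {φ : ∀ x, V x →L[ℝ] ℝ} {x₀ : M}
    (h : ∀ (σ : ∀ x, V x) (u : Set M), IsOpen u → x₀ ∈ u →
      ContMDiffOn I (I.prod 𝓘(ℝ, F)) ∞ (fun x => TotalSpace.mk' F x (σ x)) u →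
      ContMDiffAt I 𝓘(ℝ, ℝ) ∞ (fun x => φ x (σ x)) x₀) :
    ContMDiffAt I (I.prod 𝓘(ℝ, F →L[ℝ] ℝ)) ∞
      (fun x => TotalSpace.mk' (F →L[ℝ] ℝ) (E := fun x => V x →L[ℝ] ℝ) x (φ x)) x₀ := by
  rw [contMDiffAt_totalSpace]
  refine ⟨contMDiffAt_id, ?_⟩
  apply contMDiffAt_clm_of_apply
  intro v
  set t := trivializationAt F V x₀
  have hx₀ : x₀ ∈ t.baseSet := FiberBundle.mem_baseSet_trivializationAt F V x₀
  have hσ : ContMDiffOn I (I.prod 𝓘(ℝ, F)) ∞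
      (fun x => TotalSpace.mk' F x (t.symmL ℝ x v)) t.baseSet := by
    rw [t.contMDiffOn_section_baseSet_iff]
    apply (contMDiffOn_const (c := v)).congr
    intro y hy
    rw [t.symmL_apply hy, t.apply_mk_symm hy]
  apply (h _ _ t.open_baseSet hx₀ hσ).congr_of_eventuallyEq
  filter_upwards [t.open_baseSet.mem_nhds hx₀] with y hy
  simp [hom_trivializationAt_apply, ContinuousLinearMap.inCoordinates, t]


theorem contMDiffAt_mvfderiv {f : M → ℝ} {x₀ : M} (hf : ContMDiffAt I 𝓘(ℝ, ℝ) ∞ f x₀) :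
    ContMDiffAt I (I.prod 𝓘(ℝ, EM →L[ℝ] ℝ)) ∞
      (fun x => TotalSpace.mk' (EM →L[ℝ] ℝ) (E := fun x => TangentSpace I x →L[ℝ] ℝ) x
        (mvfderiv I f x)) x₀ := by
  rw [contMDiffAt_totalSpace]
  refine ⟨contMDiffAt_id, ?_⟩
  have h := hf.mfderiv_const (m := ∞) (by simp)
  apply h.congr_of_eventuallyEq
  filter_upwards with y
  simp [hom_trivializationAt_apply, inTangentCoordinates, ContinuousLinearMap.inCoordinates,
    mvfderiv]
  rfl

variable (I M) in
/-- The algebra `C^∞(M)` of smooth real functions. -/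
abbrev Fn : Type _ := C^∞⟮I, M; ℝ⟯

variable (I F V) in
/-- The space `Γ(V)` of smooth sections of a vector bundle. -/
abbrev Sec : Type _ := Cₛ^∞⟮I; F, V⟯

variable (I M) in
/-- The space of smooth vector fields. -/
abbrev VField : Type _ := Cₛ^∞⟮I; EM, (fun x : M => TangentSpace I x)⟯

variable (I M) in
/-- The space `Ω¹` of smooth sections of the cotangent bundle. -/
abbrev Form : Type _ := Cₛ^∞⟮I; EM →L[ℝ] ℝ, (fun x : M => TangentSpace I x →L[ℝ] ℝ)⟯

/-- The action of functions on sections. -/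
def fsmul (f : Fn I M) (s : Sec I F V) : Sec I F V :=
  ⟨fun x => f x • s x, f.contMDiff.smul_section s.contMDiff⟩

/-- The differential `df` of a function. -/
def dFn (f : Fn I M) : Form I M :=
  ⟨fun x => mvfderiv I f x, fun x => contMDiffAt_mvfderiv (f.contMDiff x)⟩


theorem contMDiffAt_dual_apply [ContMDiffVectorBundle ∞ F V I]
    {φ : ∀ x, V x →L[ℝ] ℝ} {σ : ∀ x, V x} {x₀ : M}
    (hφ : ContMDiffAt I (I.prod 𝓘(ℝ, F →L[ℝ] ℝ)) ∞
      (fun x => TotalSpace.mk' (F →L[ℝ] ℝ) (E := fun x => V x →L[ℝ] ℝ) x (φ x)) x₀)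
    (hσ : ContMDiffAt I (I.prod 𝓘(ℝ, F)) ∞ (fun x => TotalSpace.mk' F x (σ x)) x₀) :
    ContMDiffAt I 𝓘(ℝ, ℝ) ∞ (fun x => φ x (σ x)) x₀ := by
  have h : ContMDiffAt I (I.prod 𝓘(ℝ, ℝ)) ∞
      (fun x => TotalSpace.mk' ℝ (E := Bundle.Trivial M ℝ) x (φ x (σ x))) x₀ :=
    ContMDiffAt.clm_bundle_apply (F₁ := F) (E₁ := V) (E₂ := Bundle.Trivial M ℝ) hφ hσ
  rw [contMDiffAt_totalSpace] at h
  exact h.2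

/-- The pairing `α(X)` of a one-form and a vector field. -/
def pairing (α : Form I M) (X : VField I M) : Fn I M :=
  ⟨fun x => α x (X x), fun x => contMDiffAt_dual_apply (α.contMDiff x) (X.contMDiff x)⟩

/-- The derivative `X(f)` of a function along a vector field. -/
def lie (X : VField I M) (f : Fn I M) : Fn I M := pairing (dFn f) X

/-- Cartan's expression `X(α(Y)) - Y(α(X)) - α([X, Y])` at a point. -/
def extDAt (α : Form I M) (X : VField I M) (x : M) (Y : ∀ y : M, TangentSpace I y) : ℝ :=
  mvfderiv I (fun y => α y (Y y)) x (X x) - mvfderiv I (fun y => α y (X y)) x (Y x) -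
    α x (mlieBracket I X Y x)

theorem mdifferentiableAt_form_apply (α : Form I M) {Y : ∀ y : M, TangentSpace I y} {x : M}
    (hY : MDifferentiableAt I (I.prod 𝓘(ℝ, EM)) (fun y => TotalSpace.mk' EM y (Y y)) x) :
    MDifferentiableAt I 𝓘(ℝ, ℝ) (fun y => α y (Y y)) x := by
  have h : MDifferentiableAt I (I.prod 𝓘(ℝ, ℝ))
      (fun x => TotalSpace.mk' ℝ (E := Bundle.Trivial M ℝ) x (α x (Y x))) x :=
    MDifferentiableAt.clm_bundle_apply (F₁ := EM) (E₁ := fun x : M => TangentSpace I x)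
      (E₂ := Bundle.Trivial M ℝ) α.mdifferentiableAt hY
  rw [mdifferentiableAt_totalSpace] at h
  exact h.2

theorem tensorialAt_extDAt (α : Form I M) (X : VField I M) (x : M) :
    TensorialAt I EM (extDAt α X x) x where
  smul := by
    intro f Y hf hY
    have : CompleteSpace EM := FiniteDimensional.complete ℝ EM
    have : IsManifold I 2 M := inferInstance
    have h := mvfderiv_mul hf (mdifferentiableAt_form_apply α hY)
    have e : (fun y => α y ((f • Y) y)) = f * fun y => α y (Y y) := by
      funext y; simp
    simp only [extDAt]
    rw [e, h, mlieBracket_smul_right hf hY]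
    simp
    ring
  add := by
    intro Y Z hY hZ
    have : CompleteSpace EM := FiniteDimensional.complete ℝ EM
    have : IsManifold I 2 M := inferInstance
    have h := mvfderiv_add (mdifferentiableAt_form_apply α hY) (mdifferentiableAt_form_apply α hZ)
    have e : (fun y => α y ((Y + Z) y)) = (fun y => α y (Y y)) + fun y => α y (Z y) := by
      funext y; simp
    simp only [extDAt]
    rw [e, h, mlieBracket_add_right hY hZ]
    simp
    ring


/-- The contraction `i_X dα` of the exterior derivative of a one-form with a vector field: the
one-form with `(i_X dα)(Y) = X(α(Y)) - Y(α(X)) - α([X, Y])`. -/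
def iD (X : VField I M) (α : Form I M) : Form I M :=
  ⟨fun x => TensorialAt.mkHom (extDAt α X x) x (tensorialAt_extDAt α X x), fun x₀ => by
    apply contMDiffAt_dual
    intro Y u hu hx hY
    have hY' : ∀ y ∈ u, ContMDiffAt I (I.prod 𝓘(ℝ, EM)) ∞
      (fun x => TotalSpace.mk' EM (E := fun x : M => TangentSpace I x) x (Y x)) y :=
      fun y hy => (hY y hy).contMDiffAt (hu.mem_nhds hy)
    have hYx := hY' x₀ hx
    have : CompleteSpace EM := FiniteDimensional.complete ℝ EM
    have : IsManifold I (((⊤ : ℕ∞) : WithTop ℕ∞) + 1) M := ‹IsManifold I ∞ M›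
    have : IsManifold I (minSmoothness ℝ 2) M := by
      simp only [minSmoothness_of_isRCLikeNormedField]; infer_instance
    have hB := ContMDiffAt.mlieBracket_vectorField (m := ⊤) (n := ⊤) (X.contMDiff x₀) hYx
      (by simp)
    have h : ContMDiffAt I 𝓘(ℝ, ℝ) ∞ (fun x => extDAt α X x Y) x₀ :=
      ((contMDiffAt_dual_apply (contMDiffAt_mvfderiv
          (contMDiffAt_dual_apply (α.contMDiff x₀) hYx)) (X.contMDiff x₀)).sub
        (contMDiffAt_dual_apply (contMDiffAt_mvfderiv
          (contMDiffAt_dual_apply (α.contMDiff x₀) (X.contMDiff x₀))) hYx)).sub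
        (contMDiffAt_dual_apply (α.contMDiff x₀) hB)
    apply h.congr_of_eventuallyEq
    filter_upwards [hu.mem_nhds hx] with y hy
    exact TensorialAt.mkHom_apply _ ((hY' y hy).mdifferentiableAt (by simp))⟩

theorem iD_apply (X Y : VField I M) (α : Form I M) (x : M) :
    iD X α x (Y x) = extDAt α X x Y :=
  TensorialAt.mkHom_apply (tensorialAt_extDAt α X x) Y.mdifferentiableAt


variable [∀ x, IsTopologicalAddGroup (V x)] [∀ x, ContinuousSMul ℝ (V x)]

variable (I F V) in
/-- A smooth vector bundle with a fibrewise nondegenerate symmetric bilinear form and a smooth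
bundle map `ρ` to the tangent bundle. -/
structure AnchoredMetricBundle where
  metric : ∀ x, V x →L[ℝ] V x →L[ℝ] ℝ
  metric_smooth : ContMDiff I (I.prod 𝓘(ℝ, F →L[ℝ] F →L[ℝ] ℝ)) ∞
    (fun x => TotalSpace.mk' (F →L[ℝ] F →L[ℝ] ℝ) (E := fun x => V x →L[ℝ] V x →L[ℝ] ℝ) x (metric x))
  metric_symm : ∀ x (v w : V x), metric x v w = metric x w v
  metric_nondegenerate : ∀ x (v : V x), (∀ w, metric x v w = 0) → v = 0
  anchor : ∀ x, V x →L[ℝ] TangentSpace I x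
  anchor_smooth : ContMDiff I (I.prod 𝓘(ℝ, F →L[ℝ] EM)) ∞
    (fun x => TotalSpace.mk' (F →L[ℝ] EM) (E := fun x => V x →L[ℝ] TangentSpace I x) x (anchor x))

namespace AnchoredMetricBundle

variable [ContMDiffVectorBundle ∞ F V I] (A : AnchoredMetricBundle I F V)

/-- The function `⟨s, t⟩`. -/
def ip (s t : Sec I F V) : Fn I M :=
  ⟨fun x => A.metric x (s x) (t x), fun x =>
    contMDiffAt_dual_apply ((A.metric_smooth x).clm_bundle_apply (s.contMDiff x)) (t.contMDiff x)⟩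

/-- The vector field `ρ(s)`. -/
def rho (s : Sec I F V) : VField I M :=
  ⟨fun x => A.anchor x (s x), fun x => (A.anchor_smooth x).clm_bundle_apply (s.contMDiff x)⟩

/-- A linear functional on a fibre is represented by a unique vector through the metric. -/
def flat (x : M) : V x ≃ₗ[ℝ] Module.Dual ℝ (V x) :=
  have : FiniteDimensional ℝ (V x) := VectorBundle.finiteDimensional ℝ F V x
  LinearMap.linearEquivOfInjective
    ((ContinuousLinearMap.coeLM ℝ).comp (A.metric x).toLinearMap : V x →ₗ[ℝ] Module.Dual ℝ (V x))
    ((injective_iff_map_eq_zero _).2 fun v hv => A.metric_nondegenerate x v fun w =>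
      LinearMap.congr_fun hv w)
    (Subspace.dual_finrank_eq).symm

theorem metric_flat_symm (x : M) (l : Module.Dual ℝ (V x)) (w : V x) :
    A.metric x ((A.flat x).symm l) w = l w := by
  have : FiniteDimensional ℝ (V x) := VectorBundle.finiteDimensional ℝ F V x
  exact LinearMap.congr_fun ((A.flat x).apply_symm_apply l) w


/-- The coordinate expression of the metric near `x₀`. -/
def coordMetric (x₀ x : M) : F →L[ℝ] F →L[ℝ] ℝ :=
  (trivializationAt (F →L[ℝ] F →L[ℝ] ℝ) (fun x => V x →L[ℝ] V x →L[ℝ] ℝ) x₀ ⟨x, A.metric x⟩).2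

theorem coordMetric_apply {x₀ x : M} (hx : x ∈ (trivializationAt F V x₀).baseSet) (v w : F) :
    A.coordMetric x₀ x v w = A.metric x ((trivializationAt F V x₀).symm x v)
      ((trivializationAt F V x₀).symm x w) := by
  simp only [coordMetric, hom_trivializationAt_apply, ContinuousLinearMap.inCoordinates]
  simp [hx, Trivialization.symmL_apply]
  rw [hom_trivializationAt_apply]
  simp [ContinuousLinearMap.inCoordinates, hx, Trivialization.symmL_apply]

theorem contMDiffAt_coordMetric (x₀ : M) :
    ContMDiffAt I 𝓘(ℝ, F →L[ℝ] F →L[ℝ] ℝ) ∞ (A.coordMetric x₀) x₀ :=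
  (contMDiffAt_totalSpace.1 (A.metric_smooth x₀)).2


theorem coordMetric_isInvertible {x₀ x : M} (hx : x ∈ (trivializationAt F V x₀).baseSet) :
    ∃ e : F ≃L[ℝ] (F →L[ℝ] ℝ), (e : F →L[ℝ] F →L[ℝ] ℝ) = A.coordMetric x₀ x := by
  set t := trivializationAt F V x₀
  have hinj : Function.Injective (A.coordMetric x₀ x).toLinearMap := by
    refine (injective_iff_map_eq_zero _).2 fun v hv => ?_
    have h0 : t.symm x v = 0 := by
      apply A.metric_nondegenerate x
      intro w
      have h := LinearMap.congr_fun (congrArg ContinuousLinearMap.toLinearMap hv) (t ⟨x, w⟩).2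
      have h' : A.coordMetric x₀ x v (t ⟨x, w⟩).2 = 0 := h
      rw [A.coordMetric_apply hx] at h'
      have hw : t.symm x (t ⟨x, w⟩).2 = w := t.symm_proj_apply ⟨x, w⟩ hx
      rwa [hw] at h'
    have h1 := t.apply_mk_symm hx v
    rw [h0] at h1
    have h2 := t.zeroSection ℝ hx
    simp only [zeroSection] at h2
    rw [h2] at h1
    exact (congrArg Prod.snd h1).symm
  have hdim : Module.finrank ℝ F = Module.finrank ℝ (F →L[ℝ] ℝ) := by
    rw [← Subspace.dual_finrank_eq (K := ℝ) (V := F)]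
    exact (LinearMap.toContinuousLinearMap (𝕜 := ℝ) (E := F) (F' := ℝ)).finrank_eq
  refine ⟨(LinearMap.linearEquivOfInjective _ hinj hdim).toContinuousLinearEquiv, ?_⟩
  ext v w
  rfl

/-- The section `ρ^*(α)` of `V` determined by `⟨ρ^*(α), s⟩ = α(ρ(s))`. -/
def rhoStar (α : Form I M) : Sec I F V :=
  ⟨fun x => (A.flat x).symm ((α x).comp (A.anchor x)).toLinearMap, fun x₀ => by
    rw [contMDiffAt_section]
    set t := trivializationAt F V x₀ with ht
    have hx₀ : x₀ ∈ t.baseSet := FiberBundle.mem_baseSet_trivializationAt F V x₀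
    let φ : ∀ x, V x →L[ℝ] ℝ := fun x => (α x).comp (A.anchor x)
    have hφ : ContMDiffAt I (I.prod 𝓘(ℝ, F →L[ℝ] ℝ)) ∞
        (fun x => TotalSpace.mk' (F →L[ℝ] ℝ) (E := fun x => V x →L[ℝ] ℝ) x (φ x)) x₀ := by
      apply contMDiffAt_dual
      intro σ u hu hx hσ
      exact contMDiffAt_dual_apply (σ := fun x => A.anchor x (σ x)) (α.contMDiff x₀)
        ((A.anchor_smooth x₀).clm_bundle_apply ((hσ x₀ hx).contMDiffAt (hu.mem_nhds hx)))
    have hφ' := (contMDiffAt_totalSpace.1 hφ).2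
    obtain ⟨e, he⟩ := A.coordMetric_isInvertible hx₀
    have hinv : ContMDiffAt I 𝓘(ℝ, (F →L[ℝ] ℝ) →L[ℝ] F) ∞
        (fun x => ContinuousLinearMap.inverse (A.coordMetric x₀ x)) x₀ := by
      have : CompleteSpace F := FiniteDimensional.complete ℝ F
      have h := contDiffAt_map_inverse (n := ∞) e
      rw [he] at h
      exact h.contMDiffAt.comp x₀ (A.contMDiffAt_coordMetric x₀)
    apply (hinv.clm_apply hφ').congr_of_eventuallyEq
    filter_upwards [t.open_baseSet.mem_nhds hx₀] with x hx
    obtain ⟨e', he'⟩ := A.coordMetric_isInvertible hx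
    rw [← he', ContinuousLinearMap.inverse_equiv]
    change _ = e'.symm _
    rw [ContinuousLinearEquiv.eq_symm_apply]
    ext w
    have h1 : e' = A.coordMetric x₀ x := he'
    change (e' : F →L[ℝ] F →L[ℝ] ℝ) _ w = _
    rw [he', A.coordMetric_apply hx]
    have h2 := t.symm_proj_apply
      ⟨x, (A.flat x).symm ((α x).comp (A.anchor x)).toLinearMap⟩ hx
    simp only [← ht]
    simp only at h2
    rw [h2, A.metric_flat_symm]
    simp [hom_trivializationAt_apply, ContinuousLinearMap.inCoordinates, φ, ← ht,
      Trivialization.symmL_apply, hx]⟩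

theorem ip_rhoStar (α : Form I M) (s : Sec I F V) :
    A.ip (A.rhoStar α) s = pairing α (A.rho s) := by
  ext x
  exact A.metric_flat_symm x _ _

/-- The map `d_E` with `⟨d_E f, s⟩ = ρ(s)(f)`. -/
def dE (f : Fn I M) : Sec I F V := A.rhoStar (dFn f)

theorem ip_dE (f : Fn I M) (s : Sec I F V) : A.ip (A.dE f) s = lie (A.rho s) f :=
  A.ip_rhoStar _ _

end AnchoredMetricBundle

variable (I F V) in
/-- A Courant algebroid: an anchored metric bundle with an `ℝ`-bilinear bracket on its smooth
sections that satisfies the Jacobi identity in Leibniz form, is compatible with the metric, and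
whose symmetric part is `d_E` of the metric. -/
structure CourantAlgebroid [ContMDiffVectorBundle ∞ F V I] extends AnchoredMetricBundle I F V where
  bracket : Sec I F V →ₗ[ℝ] Sec I F V →ₗ[ℝ] Sec I F V
  jacobi : ∀ e₁ e₂ e₃, bracket e₁ (bracket e₂ e₃) =
    bracket (bracket e₁ e₂) e₃ + bracket e₂ (bracket e₁ e₃)
  lie_ip : ∀ e₁ e₂ e₃, lie (toAnchoredMetricBundle.rho e₁) (toAnchoredMetricBundle.ip e₂ e₃) =
    toAnchoredMetricBundle.ip (bracket e₁ e₂) e₃ + toAnchoredMetricBundle.ip e₂ (bracket e₁ e₃)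
  bracket_add_swap : ∀ e₁ e₂, bracket e₁ e₂ + bracket e₂ e₁ =
    toAnchoredMetricBundle.dE (toAnchoredMetricBundle.ip e₁ e₂)

/-- A map from sections to functions is a differential operator of order at most `k`: its symbols
`s ↦ D (f s) - f D s` have order at most `k - 1`, and order `0` means `C^∞(M)`-linear. -/
def IsDiffOp : ℕ → (Sec I F V → Fn I M) → Prop
  | 0, D => ∀ f s, D (fsmul f s) = f * D s
  | k + 1, D => ∀ f, IsDiffOp k (fun s => D (fsmul f s) - f * D s)

theorem IsDiffOp.zero : ∀ k, IsDiffOp k (0 : Sec I F V → Fn I M)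
  | 0 => fun f s => by simp
  | k + 1 => fun f => by
    convert! IsDiffOp.zero k using 2
    simp

theorem IsDiffOp.add : ∀ {k} {D D' : Sec I F V → Fn I M}, IsDiffOp k D → IsDiffOp k D' →
    IsDiffOp k (fun s => D s + D' s)
  | 0, _, _, h, h' => fun f s => by simp only [h f s, h' f s]; ring
  | k + 1, _, _, h, h' => fun f => by
    convert! (h f).add (h' f) using 2
    ring

theorem IsDiffOp.smul (c : ℝ) : ∀ {k} {D : Sec I F V → Fn I M}, IsDiffOp k D →
    IsDiffOp k (fun s => c • D s)
  | 0, _, h => fun f s => by simp only [h f s, mul_smul_comm]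
  | k + 1, _, h => fun f => by
    convert! (h f).smul c using 2
    rw [smul_sub, mul_smul_comm]

theorem IsDiffOp.succ : ∀ {k} {D : Sec I F V → Fn I M}, IsDiffOp k D → IsDiffOp (k + 1) D
  | 0, D, h => fun f g s => by
    simp only [h f, h g]
    ring
  | k + 1, _, h => fun f => (h f).succ

theorem IsDiffOp.mono {k l : ℕ} (hkl : k ≤ l) {D : Sec I F V → Fn I M} (h : IsDiffOp k D) :
    IsDiffOp l D := by
  induction hkl with
  | refl => exact h
  | step _ ih => exact ih.succ

variable (I F V) in
/-- Families of maps `w(e₁, …, e_a ; α₁, …, α_b)` of sections and one-forms with values in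
`C^∞(M)`. A tuple `(w_0, w_1, …)` of degree `p` is the family whose component with
`a = p - 2 k` and `b = k` is `w_k`, and whose components with `a + 2 b ≠ p` are zero. -/
abbrev Cochain : Type _ := ∀ a b : ℕ, (Fin a → Sec I F V) → (Fin b → Form I M) → Fn I M

/-- `Shuffles p q` is the set of `(p, q)`-shuffle permutations. -/
def Shuffles (p q : ℕ) : Finset (Equiv.Perm (Fin (p + q))) :=
  {σ | StrictMono (fun i : Fin p => σ (Fin.castAdd q i)) ∧
    StrictMono (fun j : Fin q => σ (Fin.natAdd p j))}

/-- The convolution product of cochains. -/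
def convMul (w η : Cochain I F V) : Cochain I F V := fun a b e α =>
  ∑ i : Fin (a + 1), ∑ j : Fin (b + 1), ∑ σ ∈ Shuffles i (a - i), ∑ τ ∈ Shuffles j (b - j),
    ((Equiv.Perm.sign σ : ℤ) : Fn I M) *
    (w i j
        (fun r => e (Fin.cast (Nat.add_sub_of_le i.is_le) (σ (Fin.castAdd _ r))))
        (fun r => α (Fin.cast (Nat.add_sub_of_le j.is_le) (τ (Fin.castAdd _ r)))) *
      η (a - i) (b - j)
        (fun r => e (Fin.cast (Nat.add_sub_of_le i.is_le) (σ (Fin.natAdd _ r))))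
        (fun r => α (Fin.cast (Nat.add_sub_of_le j.is_le) (τ (Fin.natAdd _ r)))))

namespace CourantAlgebroid

variable [ContMDiffVectorBundle ∞ F V I] (C : CourantAlgebroid I F V)

/-- Elements of degree `p` of the convolution algebra `𝒜`: `ℝ`-multilinear families that are
concentrated in degree `p`, symmetric in the one-forms, and satisfy the exchange relation for
neighbouring sections. -/
structure IsConvolution (p : ℕ) (w : Cochain I F V) : Prop where
  degree : ∀ a b, a + 2 * b ≠ p → w a b = 0
  sec_add : ∀ a b (e : Fin a → Sec I F V) (α : Fin b → Form I M) (i : Fin a) (s t : Sec I F V),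
    w a b (Function.update e i (s + t)) α =
      w a b (Function.update e i s) α + w a b (Function.update e i t) α
  sec_smul : ∀ a b (e : Fin a → Sec I F V) (α : Fin b → Form I M) (i : Fin a) (c : ℝ)
    (s : Sec I F V),
    w a b (Function.update e i (c • s)) α = c • w a b (Function.update e i s) α
  form_add : ∀ a b (e : Fin a → Sec I F V) (α : Fin b → Form I M) (μ : Fin b) (β γ : Form I M),
    w a b e (Function.update α μ (β + γ)) =
      w a b e (Function.update α μ β) + w a b e (Function.update α μ γ)
  form_smul : ∀ a b (e : Fin a → Sec I F V) (α : Fin b → Form I M) (μ : Fin b) (c : ℝ)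
    (β : Form I M),
    w a b e (Function.update α μ (c • β)) = c • w a b e (Function.update α μ β)
  form_symm : ∀ a b (e : Fin a → Sec I F V) (α : Fin b → Form I M) (τ : Equiv.Perm (Fin b)),
    w a b e (α ∘ τ) = w a b e α
  exchange : ∀ a b (e : Fin (a + 2) → Sec I F V) (α : Fin b → Form I M) (i : Fin (a + 1)),
    w (a + 2) b e α + w (a + 2) b (e ∘ Equiv.swap i.castSucc i.succ) α =
      -w a (b + 1) (i.removeNth (i.castSucc.removeNth e))
        (Fin.cons (dFn (C.ip (e i.castSucc) (e i.succ))) α)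

/-- Membership in `𝔇^p_{m, m-1}`: order at most `m` in every one-form, at most `m` in every section
except the last one, and at most `m - 1` in the last section; for `p = 1` the only section counts
as a first argument, so that its order is at most `m`. -/
structure IsDiffCochain (p m : ℕ) (w : Cochain I F V) : Prop extends C.IsConvolution p w where
  form_order : ∀ a b (e : Fin a → Sec I F V) (α : Fin b → Form I M) (μ : Fin b),
    IsDiffOp m (fun β : Form I M => w a b e (Function.update α μ β))
  sec_order : ∀ a b (e : Fin a → Sec I F V) (α : Fin b → Form I M) (i : Fin a),
    IsDiffOp (if (i : ℕ) + 1 = a ∧ p ≠ 1 then m - 1 else m)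
      (fun s : Sec I F V => w a b (Function.update e i s) α)

variable {C} in
theorem IsDiffCochain.mono {p m m' : ℕ} (h : m ≤ m') {w : Cochain I F V}
    (hw : C.IsDiffCochain p m w) : C.IsDiffCochain p m' w where
  toIsConvolution := hw.toIsConvolution
  form_order a b e α μ := (hw.form_order a b e α μ).mono h
  sec_order a b e α i := (hw.sec_order a b e α i).mono (by split_ifs <;> omega)

/-- The space `𝔇^p_{m, m-1}`. -/
def diffCochains (p m : ℕ) : Submodule ℝ (Cochain I F V) where
  carrier := {w | C.IsDiffCochain p m w}
  zero_mem' :=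
    { degree := fun _ _ _ => rfl
      sec_add := fun _ _ _ _ _ _ _ => by simp
      sec_smul := fun _ _ _ _ _ _ _ => by simp
      form_add := fun _ _ _ _ _ _ _ => by simp
      form_smul := fun _ _ _ _ _ _ _ => by simp
      form_symm := fun _ _ _ _ _ => by simp
      exchange := fun _ _ _ _ _ => by simp
      form_order := fun _ _ _ _ _ => IsDiffOp.zero _
      sec_order := fun _ _ _ _ _ => IsDiffOp.zero _ }
  add_mem' := fun {w η} hw hη =>
    { degree := fun a b h => by simp [hw.degree a b h, hη.degree a b h]
      sec_add := fun a b e α i s t => by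
        simp only [Pi.add_apply, hw.sec_add, hη.sec_add]; abel
      sec_smul := fun a b e α i c s => by
        simp only [Pi.add_apply, hw.sec_smul, hη.sec_smul, smul_add]
      form_add := fun a b e α i s t => by
        simp only [Pi.add_apply, hw.form_add, hη.form_add]; abel
      form_smul := fun a b e α i c s => by
        simp only [Pi.add_apply, hw.form_smul, hη.form_smul, smul_add]
      form_symm := fun a b e α τ => by
        simp only [Pi.add_apply, hw.form_symm, hη.form_symm]
      exchange := fun a b e α i => by
        simp only [Pi.add_apply, neg_add, ← hw.exchange, ← hη.exchange]; abel
      form_order := fun a b e α μ => (hw.form_order a b e α μ).add (hη.form_order a b e α μ)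
      sec_order := fun a b e α i => (hw.sec_order a b e α i).add (hη.sec_order a b e α i) }
  smul_mem' := fun c w hw =>
    { degree := fun a b h => by simp [hw.degree a b h]
      sec_add := fun a b e α i s t => by
        simp only [Pi.smul_apply, hw.sec_add, smul_add]
      sec_smul := fun a b e α i c' s => by
        simp only [Pi.smul_apply, hw.sec_smul, smul_comm c c']
      form_add := fun a b e α i s t => by
        simp only [Pi.smul_apply, hw.form_add, smul_add]
      form_smul := fun a b e α i c' s => by
        simp only [Pi.smul_apply, hw.form_smul, smul_comm c c']
      form_symm := fun a b e α τ => by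
        simp only [Pi.smul_apply, hw.form_symm]
      exchange := fun a b e α i => by
        simp only [Pi.smul_apply, ← smul_add, hw.exchange, smul_neg]
      form_order := fun a b e α μ => (hw.form_order a b e α μ).smul c
      sec_order := fun a b e α i => (hw.sec_order a b e α i).smul c }

/-- The degree `p` part `𝔇^p = ⋃_{m ≥ 1} 𝔇^p_{m, m-1}` of the algebra `𝔇`. -/
def diffAlgebra (p : ℕ) : Submodule ℝ (Cochain I F V) where
  carrier := {w | ∃ m, 1 ≤ m ∧ w ∈ C.diffCochains p m}
  zero_mem' := ⟨1, le_rfl, zero_mem _⟩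
  add_mem' := by
    rintro w η ⟨m, hm, hw⟩ ⟨n, hn, hη⟩
    exact ⟨max m n, hm.trans (le_max_left _ _), (C.diffCochains p (max m n)).add_mem
      (IsDiffCochain.mono (le_max_left _ _) hw) (IsDiffCochain.mono (le_max_right _ _) hη)⟩
  smul_mem' := by
    rintro c w ⟨m, hm, hw⟩
    exact ⟨m, hm, Submodule.smul_mem _ c hw⟩

/-- The terms `∑_μ w(ρ^*(α_μ), e₁, …, e_a ; …, \hat α_μ, …)` of the differential. -/
def dCoanchor (w : Cochain I F V) : Cochain I F V
  | _, 0, _, _ => 0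
  | a, b + 1, e, α =>
    ∑ μ : Fin (b + 1), w (a + 1) b (Fin.cons (C.rhoStar (α μ)) e) (μ.removeNth α)

/-- The terms of the differential that differentiate along `ρ(e_i)`: with `i` counted from `0`,
`∑_i (-1)^i (ρ(e_i)(w(…, \hat e_i, … ; α)) - ∑_μ w(…, \hat e_i, … ; …, i_{ρ(e_i)} dα_μ, …))`. -/
def dAnchor (w : Cochain I F V) : Cochain I F V
  | 0, _, _, _ => 0
  | a + 1, b, e, α =>
    ∑ i : Fin (a + 1), (-1) ^ (i : ℕ) * (lie (C.rho (e i)) (w a b (i.removeNth e) α) -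
      ∑ μ : Fin b, w a b (i.removeNth e) (Function.update α μ (iD (C.rho (e i)) (α μ))))

/-- The terms `∑_{i < j} (-1)^{i+1} w(…, \hat e_i, …, [e_i, e_j], … ; α)` of the differential, with
`i` and `j` counted from `0` and `[e_i, e_j]` in the place of `e_j`. -/
def dBracket (w : Cochain I F V) : Cochain I F V
  | 0, _, _, _ => 0
  | a + 1, b, e, α =>
    ∑ i : Fin (a + 1), ∑ j ∈ Finset.Ioi i, (-1) ^ ((i : ℕ) + 1) *
      w a b (i.removeNth (Function.update e j (C.bracket (e i) (e j)))) α

theorem lie_add (X : VField I M) (f g : Fn I M) : lie X (f + g) = lie X f + lie X g := by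
  ext x
  have h := mvfderiv_add (I := I) (f.contMDiff.mdifferentiable (by simp) x)
    (g.contMDiff.mdifferentiable (by simp) x)
  exact congrArg (fun l : TangentSpace I x →L[ℝ] ℝ => l (X x)) h

theorem lie_smul (X : VField I M) (c : ℝ) (f : Fn I M) : lie X (c • f) = c • lie X f := by
  ext x
  have h := mvfderiv_smul (I := I) (x := x) (a := fun _ => c) mdifferentiableAt_const
    (f.contMDiff.mdifferentiable (by simp) x)
  have h' := congrArg (fun l : TangentSpace I x →L[ℝ] ℝ => l (X x)) h
  simp only [mvfderiv_const] at h'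
  refine Eq.trans ?_ (h'.trans ?_)
  · rfl
  · simp only [_root_.add_apply, ContinuousLinearMap.smulRight_apply,
      _root_.zero_apply, zero_smul, add_zero]
    rfl

/-- The differential of cochains. -/
def d : Cochain I F V →ₗ[ℝ] Cochain I F V where
  toFun w := C.dCoanchor w + C.dAnchor w + C.dBracket w
  map_add' w η := by
    funext a b e α
    rcases a with _ | a <;> rcases b with _ | b <;>
      simp only [Pi.add_apply, dCoanchor, dAnchor, dBracket, lie_add, Finset.sum_add_distrib,
        mul_add, mul_sub, Finset.sum_sub_distrib] <;> abel
  map_smul' c w := by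
    funext a b e α
    rcases a with _ | a <;> rcases b with _ | b <;>
      simp only [Pi.add_apply, Pi.smul_apply, dCoanchor, dAnchor, dBracket, lie_smul, smul_add,
        mul_smul_comm, ← smul_sub, RingHom.id_apply, smul_zero, ← Finset.smul_sum]

/-- The formula of the standard differential, evaluated on functions `f₁, …, f_b` in place of
one-forms, where `w(e ; f₁, …, f_b)` stands for `w(e ; df₁, …, df_b)`. -/
def standardD (w : Cochain I F V) :
    ∀ a b : ℕ, (Fin a → Sec I F V) → (Fin b → Fn I M) → Fn I M := fun a b e f =>
  (match b, f with
    | 0, _ => 0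
    | b + 1, f => ∑ μ : Fin (b + 1),
        w (a + 1) b (Fin.cons (C.dE (f μ)) e) (fun ν => dFn (μ.removeNth f ν))) +
  (match a, e with
    | 0, _ => 0
    | a + 1, e =>
      (∑ i : Fin (a + 1), (-1) ^ (i : ℕ) *
        C.ip (e i) (C.dE (w a b (i.removeNth e) (fun ν => dFn (f ν))))) +
      ∑ i : Fin (a + 1), ∑ j ∈ Finset.Ioi i, (-1) ^ ((i : ℕ) + 1) *
        w a b (i.removeNth (Function.update e j (C.bracket (e i) (e j)))) (fun ν => dFn (f ν)))

/-- The cocycles of degree `p`. -/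
def cocycles (p : ℕ) : Submodule ℝ (Cochain I F V) := C.diffAlgebra p ⊓ LinearMap.ker C.d

/-- The coboundaries of degree `p`. -/
def coboundaries : ℕ → Submodule ℝ (Cochain I F V)
  | 0 => ⊥
  | p + 1 => (C.diffAlgebra p).map C.d

/-- The cohomology `ℌ^p`: cocycles modulo coboundaries. -/
abbrev Cohomology (p : ℕ) : Type _ :=
  C.cocycles p ⧸ (C.coboundaries p).submoduleOf (C.cocycles p)

end CourantAlgebroid

end Geometry

/-- The cochain complex of vector spaces given by linear maps with vanishing composites. -/
def cochainComplexOf (X : ℕ → Type*) [∀ p, AddCommGroup (X p)] [∀ p, Module ℝ (X p)]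
    (δ : ∀ p, X p →ₗ[ℝ] X (p + 1)) (hδ : ∀ p, δ (p + 1) ∘ₗ δ p = 0) :
    CochainComplex (ModuleCat ℝ) ℕ :=
  CochainComplex.of (fun p => ModuleCat.of ℝ (X p)) (fun p => ModuleCat.ofHom (δ p))
    (fun p => ModuleCat.hom_ext (hδ p))

end

end CourantDorfman

open CourantDorfman

set_option linter.unusedSectionVars false

namespace CourantDorfman

noncomputable section

/-! ### Families of maps, insertions and the relations of the convolution algebra -/

section Algebra

variable {R E Ω : Type*} [CommRing R] [Algebra ℝ R] [AddCommGroup E] [Module ℝ E]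
  [AddCommGroup Ω] [Module ℝ Ω]

/-! Algebra is separated from geometry. Write i_e and i_α (`ins`, `insF`) for the insertion of a
section or a one-form into the first slot, L_e (`lieD`) for the Lie derivative along e, and κ_α
(`kap`) for the signed sum over the sections e_i that replaces e_i by the one-form i_{ρ(e_i)}dα.
Every insertion uses up an argument, so a family vanishes once it lies in a set that is closed under
insertions and whose members vanish without arguments (`eq_zero_of_ins_mem`). An operator identity
thus reduces to its value in bidegree (0,0) and to commuting insertions through both sides.

On families that satisfy the exchange relation, the differential obeys i_e d = L_e - d i_e and i_α d
= i_{ρ^*α} + d i_α + κ_α (`IsDifferential`). The first is Cartan's formula. The anchor term produces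
only i_{ρ(e)}dα on the one-forms; the missing exact part d(α(ρ(e))) of the Lie derivative comes from
exchanging e with ρ^*(α) in the coanchor term. These two rules give [L_e, d] = 0 (`lieD_comm`) and
L_{ρ^*α} + dκ_α + κ_α d = 0 (`kap_comm`), whence d² commutes with all insertions and is zero
(`comp_self`). For the product, i_α is a derivation and i_e a derivation up to parity (`IsProduct`),
because the first argument of a shuffle begins one of the two blocks. Then L_e, κ_α and finally d
inherit the Leibniz rule (`d_mul`).

The relations used are collected in `CourantOps`. For a Courant algebroid they follow from the three
axioms: both Leibniz rules of the bracket, ρ[s,t] = [ρ(s),ρ(t)], ρρ^* = 0 and [s,ρ^*α] =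
ρ^*(L_{ρ(s)}α). Bump functions make smooth sections rich enough for pointwise arguments.

For the orders, brackets, i_X d and derivatives along vector fields are first-order operations with
function-linear symbols, so each raises the order by at most one; ρ and ρ^* are function-linear.
Degree one is special, as the order of w in its only section may be m instead of m - 1. There the
two dangerous terms form the commutator of w with two derivations of equal symbol, which does not
raise the order (`IsDiffOp.lie_sub_comp`). -/

variable (R E Ω) in
/-- Families of maps of `a` arguments in `E` and `b` arguments in `Ω`, with values in `R`. -/
abbrev MultiFamily : Type _ := ∀ a b : ℕ, (Fin a → E) → (Fin b → Ω) → R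

/-- Insertion of a first argument in `E`. -/
def ins (e : E) : MultiFamily R E Ω →ₗ[ℝ] MultiFamily R E Ω where
  toFun w := fun a b u α => w (a + 1) b (Fin.cons e u) α
  map_add' _ _ := rfl
  map_smul' _ _ := rfl

/-- Insertion of a first argument in `Ω`. -/
def insF (α : Ω) : MultiFamily R E Ω →ₗ[ℝ] MultiFamily R E Ω where
  toFun w := fun a b u β => w a (b + 1) u (Fin.cons α β)
  map_add' _ _ := rfl
  map_smul' _ _ := rfl

/-- The parity operator, which multiplies by `(-1)^a`. -/
def par : MultiFamily R E Ω →ₗ[ℝ] MultiFamily R E Ω where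
  toFun w := fun a b u β => (-1) ^ a * w a b u β
  map_add' _ _ := by funext a b u β; simp [mul_add]
  map_smul' _ _ := by funext a b u β; simp

theorem ins_apply (e : E) (w : MultiFamily R E Ω) (a b : ℕ) (u : Fin a → E) (α : Fin b → Ω) :
    ins e w a b u α = w (a + 1) b (Fin.cons e u) α := rfl

theorem insF_apply (α : Ω) (w : MultiFamily R E Ω) (a b : ℕ) (u : Fin a → E) (β : Fin b → Ω) :
    insF α w a b u β = w a (b + 1) u (Fin.cons α β) := rfl

theorem par_apply (w : MultiFamily R E Ω) (a b : ℕ) (u : Fin a → E) (β : Fin b → Ω) :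
    par w a b u β = (-1) ^ a * w a b u β := rfl

theorem ins_insF (e : E) (α : Ω) (w : MultiFamily R E Ω) :
    ins e (insF α w) = insF α (ins e w) := rfl

theorem ins_par (e : E) (w : MultiFamily R E Ω) : ins e (par w) = -par (ins e w) := by
  funext a b u α
  simp only [ins_apply, par_apply, Pi.neg_apply, pow_succ]
  ring

theorem insF_par (α : Ω) (w : MultiFamily R E Ω) : insF α (par w) = par (insF α w) := rfl

theorem par_par (w : MultiFamily R E Ω) : par (par w) = w := by
  funext a b u α
  simp only [par_apply, ← mul_assoc, ← mul_pow]
  simp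

theorem apply_succ_left (w : MultiFamily R E Ω) (a b : ℕ) (u : Fin (a + 1) → E)
    (α : Fin b → Ω) : w (a + 1) b u α = ins (u 0) w a b (Fin.tail u) α := by
  rw [ins_apply, Fin.cons_self_tail]

theorem apply_succ_right (w : MultiFamily R E Ω) (a b : ℕ) (u : Fin a → E)
    (α : Fin (b + 1) → Ω) : w a (b + 1) u α = insF (α 0) w a b u (Fin.tail α) := by
  rw [insF_apply, Fin.cons_self_tail]

/-- A set of families that vanish in bidegree `(0, 0)` and is closed under insertions consists of
the zero family only. -/
theorem eq_zero_of_ins_mem (S : Set (MultiFamily R E Ω)) (h0 : ∀ z ∈ S, z 0 0 = 0)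
    (hE : ∀ z ∈ S, ∀ e, ins e z ∈ S) (hF : ∀ z ∈ S, ∀ α, insF α z ∈ S) :
    ∀ z ∈ S, z = 0 := by
  intro z hz
  funext a b
  induction a generalizing z with
  | zero =>
    induction b generalizing z with
    | zero => exact h0 z hz
    | succ b ih =>
      funext u α
      rw [apply_succ_right z, ih _ (hF z hz _)]
      rfl
  | succ a ih =>
    funext u α
    rw [apply_succ_left z, ih _ (hE z hz _)]
    rfl

variable (R E Ω) in
/-- The algebraic structure that the sections of a Courant algebroid, the functions and the
one-forms carry. -/
structure CourantOps where
  ip : E → E → R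
  lieF : E →ₗ[ℝ] R →ₗ[ℝ] R
  dF : R →ₗ[ℝ] Ω
  con : E → Ω → R
  iD : E →ₗ[ℝ] Ω →ₗ[ℝ] Ω
  lieO : E →ₗ[ℝ] Ω →ₗ[ℝ] Ω
  coan : Ω →ₗ[ℝ] E
  br : E →ₗ[ℝ] E →ₗ[ℝ] E
  ip_comm : ∀ e e', ip e e' = ip e' e
  ip_coan : ∀ α e, ip (coan α) e = con e α
  lieF_mul : ∀ e f g, lieF e (f * g) = lieF e f * g + f * lieF e g
  lieF_ip : ∀ e e₁ e₂, lieF e (ip e₁ e₂) = ip (br e e₁) e₂ + ip e₁ (br e e₂)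
  lieF_br : ∀ e e' f, lieF (br e e') f = lieF e (lieF e' f) - lieF e' (lieF e f)
  lieF_coan : ∀ α f, lieF (coan α) f = 0
  jacobi : ∀ e₁ e₂ e₃, br e₁ (br e₂ e₃) = br (br e₁ e₂) e₃ + br e₂ (br e₁ e₃)
  br_add_swap : ∀ e e', br e e' + br e' e = coan (dF (ip e e'))
  br_coan : ∀ e α, br e (coan α) = coan (lieO e α)
  lieO_eq : ∀ e α, lieO e α = iD e α + dF (con e α)
  lieO_br : ∀ e e' α, lieO (br e e') α = lieO e (lieO e' α) - lieO e' (lieO e α)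
  iD_br : ∀ e e' α, iD (br e e') α = lieO e (iD e' α) - iD e' (lieO e α)
  lieO_dF : ∀ e f, lieO e (dF f) = dF (lieF e f)
  iD_dF : ∀ e f, iD e (dF f) = 0
  iD_coan : ∀ α β, iD (coan α) β = 0
  con_coan : ∀ α β, con (coan α) β = 0

namespace CourantOps

variable (C : CourantOps R E Ω)

/-- The symmetric part of the bracket is ρ^*d(α(ρ(e))), and this is exactly the exact part of
ρ^*(L_e α) = [e, ρ^*α]. Only i_e dα survives. -/
theorem coan_br (α : Ω) (e : E) : C.br (C.coan α) e = -C.coan (C.iD e α) := by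
  have h := C.br_add_swap (C.coan α) e
  rw [C.br_coan, C.ip_coan, C.lieO_eq, map_add] at h
  rw [eq_neg_iff_add_eq_zero]
  have := sub_eq_zero.2 h
  rw [← this]
  abel

theorem lieO_coan (α β : Ω) : C.lieO (C.coan α) β = 0 := by
  rw [C.lieO_eq, C.iD_coan, C.con_coan, map_zero, add_zero]

/-- The Lie derivative of families along a section. -/
def lieD (e : E) : MultiFamily R E Ω →ₗ[ℝ] MultiFamily R E Ω where
  toFun w := fun a b u α => C.lieF e (w a b u α) -
    ∑ i, w a b (Function.update u i (C.br e (u i))) α -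
    ∑ μ, w a b u (Function.update α μ (C.lieO e (α μ)))
  map_add' w η := by
    funext a b u α
    simp only [Pi.add_apply, map_add, Finset.sum_add_distrib]
    abel
  map_smul' c w := by
    funext a b u α
    simp only [Pi.smul_apply, map_smul, ← Finset.smul_sum, smul_sub, RingHom.id_apply]

theorem lieD_apply (e : E) (w : MultiFamily R E Ω) (a b : ℕ) (u : Fin a → E) (α : Fin b → Ω) :
    C.lieD e w a b u α = C.lieF e (w a b u α) -
    ∑ i, w a b (Function.update u i (C.br e (u i))) α -
    ∑ μ, w a b u (Function.update α μ (C.lieO e (α μ))) := rfl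

theorem lieD_zero_zero (e : E) (w : MultiFamily R E Ω) (u : Fin 0 → E) (α : Fin 0 → Ω) :
    C.lieD e w 0 0 u α = C.lieF e (w 0 0 u α) := by
  simp [lieD_apply]

/-- Splitting slot 0 off the sum in `lieD` leaves the bracket term as the only correction. No
relation on `w` is involved, so this may be used for arbitrary families. -/
theorem ins_lieD (e e' : E) (w : MultiFamily R E Ω) :
    ins e' (C.lieD e w) = C.lieD e (ins e' w) - ins (C.br e e') w := by
  funext a b u α
  simp only [ins_apply, lieD_apply, Pi.sub_apply, Fin.sum_univ_succ, Fin.cons_zero, Fin.cons_succ,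
    Fin.update_cons_zero, Fin.cons_update]
  abel

theorem insF_lieD (e : E) (β : Ω) (w : MultiFamily R E Ω) :
    insF β (C.lieD e w) = C.lieD e (insF β w) - insF (C.lieO e β) w := by
  funext a b u α
  simp only [insF_apply, lieD_apply, Pi.sub_apply, Fin.sum_univ_succ, Fin.cons_zero, Fin.cons_succ,
    Fin.update_cons_zero, Fin.cons_update]
  abel

/-- The operator `w ↦ -∑_i (-1)^i w(…, \hat e_i, … ; i_{ρ(e_i)} dα, …)`. -/
def kap (α : Ω) : MultiFamily R E Ω →ₗ[ℝ] MultiFamily R E Ω where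
  toFun w := fun a b u β => match a, u with
    | 0, _ => 0
    | a + 1, u => -∑ i : Fin (a + 1), (-1) ^ (i : ℕ) *
        w a (b + 1) (i.removeNth u) (Fin.cons (C.iD (u i) α) β)
  map_add' w η := by
    funext a b u β
    rcases a with _ | a
    · simp
    · simp only [Pi.add_apply, mul_add, Finset.sum_add_distrib, neg_add]
  map_smul' c w := by
    funext a b u β
    rcases a with _ | a
    · simp
    · simp only [Pi.smul_apply, mul_smul_comm, ← Finset.smul_sum, smul_neg, RingHom.id_apply]

theorem kap_zero (α : Ω) (w : MultiFamily R E Ω) (b : ℕ) : C.kap α w 0 b = 0 := rfl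

theorem kap_succ (α : Ω) (w : MultiFamily R E Ω) (a b : ℕ) (u : Fin (a + 1) → E)
    (β : Fin b → Ω) : C.kap α w (a + 1) b u β = -∑ i : Fin (a + 1), (-1) ^ (i : ℕ) *
        w a (b + 1) (i.removeNth u) (Fin.cons (C.iD (u i) α) β) := rfl

theorem removeNth_succ_cons {X : Type*} {a : ℕ} (i : Fin (a + 1)) (x : X) (u : Fin (a + 1) → X) :
    i.succ.removeNth (Fin.cons x u : Fin (a + 2) → X) =
      (Fin.cons x (i.removeNth u) : Fin (a + 1) → X) := by
  funext j
  refine Fin.cases ?_ (fun j => ?_) j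
  · simp [Fin.removeNth]
  · simp [Fin.removeNth]

/-- The summand `i = 0` of `kap` becomes the first term; in the remaining ones the alternating sign
shifts by one, so `kap` anticommutes with `ins` up to this term. -/
theorem ins_kap (e : E) (α : Ω) (w : MultiFamily R E Ω) :
    ins e (C.kap α w) = -insF (C.iD e α) w - C.kap α (ins e w) := by
  funext a b u β
  rcases a with _ | a
  · simp [ins_apply, kap_succ, kap_zero, insF_apply]
  · simp only [ins_apply, kap_succ, Fin.sum_univ_succ (n := a + 1), insF_apply, Pi.sub_apply,
      Pi.neg_apply, Fin.cons_zero, Fin.cons_succ, removeNth_succ_cons, Fin.val_zero, pow_zero,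
      one_mul, Fin.val_succ, pow_succ, mul_neg, mul_one, neg_mul, Finset.sum_neg_distrib,
      Fin.removeNth_zero, Fin.tail_cons]
    abel

theorem kap_iD_congr {α β : Ω} (h : ∀ e, C.iD e α = C.iD e β) (w : MultiFamily R E Ω) :
    C.kap α w = C.kap β w := by
  funext a b u γ
  rcases a with _ | a
  · rfl
  · simp only [kap_succ, h]

/-- Linearity in the first arguments and the exchange relations for them. -/
structure Head (w : MultiFamily R E Ω) : Prop where
  add : ∀ s t, ins (s + t) w = ins s w + ins t w
  smul : ∀ (c : ℝ) s, ins (c • s) w = c • ins s w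
  addF : ∀ s t, insF (s + t) w = insF s w + insF t w
  smulF : ∀ (c : ℝ) s, insF (c • s) w = c • insF s w
  symm : ∀ α β, insF α (insF β w) = insF β (insF α w)
  exch : ∀ e e', ins e' (ins e w) + ins e (ins e' w) = -insF (C.dF (C.ip e e')) w

/-- The relations of the convolution algebra, restricted to the first `n` arguments. -/
def Conv : ℕ → MultiFamily R E Ω → Prop
  | 0, _ => True
  | n + 1, w => C.Head w ∧ (∀ e, Conv n (ins e w)) ∧ ∀ α, Conv n (insF α w)

/-- The relations of the convolution algebra. -/
def IsConv (w : MultiFamily R E Ω) : Prop := ∀ n, C.Conv n w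

variable {C}

theorem Head.insF_neg {w : MultiFamily R E Ω} (h : C.Head w) (α : Ω) :
    insF (-α) w = -insF α w := by
  have := h.smulF (-1) α
  simpa using this

theorem Head.insF_zero {w : MultiFamily R E Ω} (h : C.Head w) : insF (0 : Ω) w = 0 := by
  have := h.smulF 0 0
  rwa [zero_smul, zero_smul] at this

theorem Head.insF_sub {w : MultiFamily R E Ω} (h : C.Head w) (α β : Ω) :
    insF (α - β) w = insF α w - insF β w := by
  rw [sub_eq_add_neg, h.addF, h.insF_neg, sub_eq_add_neg]

theorem Head.ins_neg {w : MultiFamily R E Ω} (h : C.Head w) (e : E) :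
    ins (-e) w = -ins e w := by
  have := h.smul (-1) e
  simpa using this

theorem Head.exch' {w : MultiFamily R E Ω} (h : C.Head w) (e e' : E) :
    ins e' (ins e w) = -ins e (ins e' w) - insF (C.dF (C.ip e e')) w := by
  rw [sub_eq_add_neg, ← h.exch e e']
  abel

theorem Head.add' {w η : MultiFamily R E Ω} (h : C.Head w) (h' : C.Head η) :
    C.Head (w + η) where
  add s t := by simp only [map_add, h.add, h'.add]; abel
  smul c s := by simp only [map_add, h.smul, h'.smul, smul_add]
  addF s t := by simp only [map_add, h.addF, h'.addF]; abel
  smulF c s := by simp only [map_add, h.smulF, h'.smulF, smul_add]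
  symm α β := by simp only [map_add, h.symm α, h'.symm α]
  exch e e' := by simp only [map_add, h.exch' e, h'.exch' e]; abel

theorem Head.smul' {w : MultiFamily R E Ω} (h : C.Head w) (c : ℝ) : C.Head (c • w) where
  add s t := by simp only [map_smul, h.add, smul_add]
  smul c' s := by simp only [map_smul, h.smul, smul_comm c]
  addF s t := by simp only [map_smul, h.addF, smul_add]
  smulF c' s := by simp only [map_smul, h.smulF, smul_comm c]
  symm α β := by simp only [map_smul, h.symm α]
  exch e e' := by simp only [map_smul, ← smul_add, h.exch, smul_neg]

theorem Conv.add : ∀ {n : ℕ} {w η : MultiFamily R E Ω}, C.Conv n w → C.Conv n η →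
    C.Conv n (w + η)
  | 0, _, _, _, _ => trivial
  | _ + 1, _, _, h, h' => ⟨h.1.add' h'.1, fun e => (h.2.1 e).add (h'.2.1 e),
      fun α => (h.2.2 α).add (h'.2.2 α)⟩

theorem Conv.smul (c : ℝ) : ∀ {n : ℕ} {w : MultiFamily R E Ω}, C.Conv n w → C.Conv n (c • w)
  | 0, _, _ => trivial
  | _ + 1, _, h => ⟨h.1.smul' c, fun e => (h.2.1 e).smul c, fun α => (h.2.2 α).smul c⟩

theorem Conv.neg {n : ℕ} {w : MultiFamily R E Ω} (h : C.Conv n w) : C.Conv n (-w) := by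
  have := h.smul (-1)
  simpa using this

theorem Conv.sub {n : ℕ} {w η : MultiFamily R E Ω} (h : C.Conv n w) (h' : C.Conv n η) :
    C.Conv n (w - η) := by
  rw [sub_eq_add_neg]
  exact h.add h'.neg

variable {w η : MultiFamily R E Ω}

theorem IsConv.head (h : C.IsConv w) : C.Head w := (h 1).1

theorem IsConv.ins (h : C.IsConv w) (e : E) : C.IsConv (ins e w) := fun n => (h (n + 1)).2.1 e

theorem IsConv.insF (h : C.IsConv w) (α : Ω) : C.IsConv (insF α w) := fun n => (h (n + 1)).2.2 α

theorem IsConv.neg (h : C.IsConv w) : C.IsConv (-w) := fun n => (h n).neg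

theorem IsConv.par (h : C.IsConv w) : C.IsConv (par w) := by
  intro n
  induction n generalizing w with
  | zero => trivial
  | succ n ih =>
    refine ⟨?_, fun e => ?_, fun α => ?_⟩
    · have hh := h.head
      constructor
      · intro s t; simp only [ins_par, hh.add, map_add, neg_add]
      · intro c s; simp only [ins_par, hh.smul, map_smul, smul_neg]
      · intro s t; simp only [insF_par, hh.addF, map_add]
      · intro c s; simp only [insF_par, hh.smulF, map_smul]
      · intro α β; simp only [insF_par, hh.symm α]
      · intro e e'
        simp only [ins_par, map_neg, insF_par, neg_neg, ← map_add, hh.exch]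
    · rw [ins_par]
      exact (ih (h.ins e)).neg
    · rw [insF_par]
      exact ih (h.insF α)

/-- The exchange relation survives because e acts as a derivation on the metric (`lieF_ip`) and its
Lie derivative commutes with `dF` (`lieO_dF`). -/
theorem IsConv.lieD (e : E) (h : C.IsConv w) : C.IsConv (C.lieD e w) := by
  intro n
  induction n generalizing w with
  | zero => trivial
  | succ n ih =>
    refine ⟨?_, fun e' => ?_, fun α => ?_⟩
    · have hh := h.head
      constructor
      · intro s t; simp only [ins_lieD, hh.add, map_add]; abel
      · intro c s; simp only [ins_lieD, hh.smul, map_smul, smul_sub]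
      · intro s t; simp only [insF_lieD, hh.addF, map_add]; abel
      · intro c s; simp only [insF_lieD, hh.smulF, map_smul, smul_sub]
      · intro α β
        simp only [insF_lieD, map_sub, hh.symm α β, hh.symm (C.lieO e α), hh.symm α (C.lieO e β)]
        abel
      · intro e₁ e₂
        simp only [ins_lieD, insF_lieD, map_sub, hh.exch' e₁ e₂, hh.exch' (C.br e e₁) e₂,
          hh.exch' e₁ (C.br e e₂), C.lieO_dF, C.lieF_ip, map_add, hh.addF, map_neg]
        abel
    · rw [ins_lieD]
      exact (ih (h.ins e')).sub (h.ins _ n)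
    · rw [insF_lieD]
      exact (ih (h.insF α)).sub (h.insF _ n)

end CourantOps

end Algebra

/-! ### Cartan calculus on families: commutation relations, d² = 0 and the Leibniz rule -/

section Algebra

variable {R E Ω : Type*} [CommRing R] [Algebra ℝ R] [AddCommGroup E] [Module ℝ E]
  [AddCommGroup Ω] [Module ℝ Ω]

namespace CourantOps

variable {C : CourantOps R E Ω} {w η : MultiFamily R E Ω}

/-- `kap` puts its new one-form in front of β, whereas insertion into `w` first would put it behind;
symmetry in the one-forms reconciles the two. -/
theorem insF_kap (α β : Ω) (hw : C.IsConv w) :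
    insF β (C.kap α w) = C.kap α (insF β w) := by
  funext a b u γ
  rcases a with _ | a
  · rfl
  · rw [insF_apply, kap_succ, kap_succ]
    congr 1
    refine Finset.sum_congr rfl fun i _ => ?_
    congr 1
    have hsymm : ∀ (a : ℕ) (w : MultiFamily R E Ω) (hw : C.IsConv w) (x y : Ω) (u : Fin a → E),
        w a (b + 1 + 1) u (Fin.cons x (Fin.cons y γ)) =
          w a (b + 1 + 1) u (Fin.cons y (Fin.cons x γ)) := by
      intro a w hw x y u
      exact congrFun (congrFun (congrFun (congrFun (hw.head.symm y x) a) b) u) γ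
    exact hsymm a w hw _ _ _

theorem IsConv.kap (α : Ω) (h : C.IsConv w) : C.IsConv (C.kap α w) := by
  intro n
  induction n generalizing w with
  | zero => trivial
  | succ n ih =>
    refine ⟨?_, fun e' => ?_, fun β => ?_⟩
    · have hh := h.head
      constructor
      · intro s t
        simp only [ins_kap, hh.add, map_add, LinearMap.add_apply, hh.addF]
        abel
      · intro c s
        simp only [ins_kap, hh.smul, map_smul, LinearMap.smul_apply, hh.smulF, smul_sub, smul_neg]
      · intro s t
        simp only [insF_kap _ _ h, hh.addF, map_add]
      · intro c s
        simp only [insF_kap _ _ h, hh.smulF, map_smul]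
      · intro β γ
        simp only [insF_kap _ _ h, insF_kap _ _ (h.insF _), hh.symm β γ]
      · intro e₁ e₂
        simp only [ins_kap, insF_kap _ _ h, map_sub, map_neg, ins_insF, hh.exch' e₁ e₂]
        abel
    · rw [ins_kap]
      exact (h.insF _ n).neg.sub (ih (h.ins e'))
    · rw [insF_kap _ _ h]
      exact ih (h.insF β)

/-- Model for the proofs below: the defects of the identity, over all admissible `w`, form a set to
which `eq_zero_of_ins_mem` applies. Bidegree (0,0) is the action on functions, inserting a section
uses the Jacobi identity, and inserting a one-form uses `lieO_br`. -/
theorem lieD_lieD (e e' : E) (hw : C.IsConv w) :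
    C.lieD e (C.lieD e' w) - C.lieD e' (C.lieD e w) = C.lieD (C.br e e') w := by
  rw [← sub_eq_zero]
  refine eq_zero_of_ins_mem {z | ∃ w, C.IsConv w ∧ z = C.lieD e (C.lieD e' w) -
    C.lieD e' (C.lieD e w) - C.lieD (C.br e e') w} ?_ ?_ ?_ _ ⟨w, hw, rfl⟩
  · rintro _ ⟨w, hw, rfl⟩
    funext u α
    simp only [Pi.sub_apply, lieD_zero_zero, C.lieF_br]
    simp
  · rintro _ ⟨w, hw, rfl⟩ e''
    refine ⟨ins e'' w, hw.ins _, ?_⟩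
    simp only [ins_lieD, map_sub, C.jacobi e e' e'', hw.head.add]
    abel
  · rintro _ ⟨w, hw, rfl⟩ α
    refine ⟨insF α w, hw.insF _, ?_⟩
    simp only [insF_lieD, map_sub, C.lieO_br e e' α, hw.head.insF_sub]
    abel

theorem lieD_kap (e : E) (α : Ω) (hw : C.IsConv w) :
    C.lieD e (C.kap α w) - C.kap α (C.lieD e w) = C.kap (C.lieO e α) w := by
  rw [← sub_eq_zero]
  refine eq_zero_of_ins_mem {z | ∃ w, C.IsConv w ∧ z = C.lieD e (C.kap α w) -
    C.kap α (C.lieD e w) - C.kap (C.lieO e α) w} ?_ ?_ ?_ _ ⟨w, hw, rfl⟩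
  · rintro _ ⟨w, hw, rfl⟩
    funext u β
    simp [lieD_zero_zero, kap_zero]
  · rintro _ ⟨w, hw, rfl⟩ e'
    -- The sign in the witness records that `kap` anticommutes with `ins`.
    refine ⟨-ins e' w, (hw.ins _).neg, ?_⟩
    have h := C.iD_br e e' α
    have h' : C.lieO e (C.iD e' α) = C.iD (C.br e e') α + C.iD e' (C.lieO e α) := by
      rw [h]; abel
    simp only [ins_lieD, ins_kap, insF_lieD, map_sub, map_neg, h', hw.head.addF]
    abel
  · rintro _ ⟨w, hw, rfl⟩ β
    refine ⟨insF β w, hw.insF _, ?_⟩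
    simp only [insF_lieD, insF_kap _ _ hw, insF_kap _ _ (hw.lieD e), map_sub]
    abel

theorem kap_kap (α β : Ω) (hw : C.IsConv w) :
    C.kap α (C.kap β w) + C.kap β (C.kap α w) = 0 := by
  refine eq_zero_of_ins_mem {z | ∃ w, C.IsConv w ∧ z = C.kap α (C.kap β w) +
    C.kap β (C.kap α w)} ?_ ?_ ?_ _ ⟨w, hw, rfl⟩
  · rintro _ ⟨w, hw, rfl⟩
    funext u β
    simp [kap_zero]
  · rintro _ ⟨w, hw, rfl⟩ e'
    refine ⟨ins e' w, hw.ins _, ?_⟩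
    simp only [ins_kap, insF_kap _ _ hw, map_add, map_sub, map_neg]
    abel
  · rintro _ ⟨w, hw, rfl⟩ γ
    refine ⟨insF γ w, hw.insF _, ?_⟩
    simp only [insF_kap _ _ hw, insF_kap _ _ (hw.kap _), map_add]

theorem lieD_add (s t : E) (hw : C.IsConv w) :
    C.lieD (s + t) w = C.lieD s w + C.lieD t w := by
  rw [← sub_eq_zero]
  refine eq_zero_of_ins_mem {z | ∃ w, C.IsConv w ∧ z = C.lieD (s + t) w -
    (C.lieD s w + C.lieD t w)} ?_ ?_ ?_ _ ⟨w, hw, rfl⟩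
  · rintro _ ⟨w, hw, rfl⟩
    funext u β
    simp [lieD_zero_zero]
  · rintro _ ⟨w, hw, rfl⟩ e'
    refine ⟨ins e' w, hw.ins _, ?_⟩
    simp only [ins_lieD, map_add, map_sub, LinearMap.add_apply, hw.head.add]
    abel
  · rintro _ ⟨w, hw, rfl⟩ γ
    refine ⟨insF γ w, hw.insF _, ?_⟩
    simp only [insF_lieD, map_add, map_sub, LinearMap.add_apply, hw.head.addF]
    abel

theorem lieD_smul (c : ℝ) (s : E) (hw : C.IsConv w) :
    C.lieD (c • s) w = c • C.lieD s w := by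
  rw [← sub_eq_zero]
  refine eq_zero_of_ins_mem {z | ∃ w, C.IsConv w ∧ z = C.lieD (c • s) w - c • C.lieD s w}
    ?_ ?_ ?_ _ ⟨w, hw, rfl⟩
  · rintro _ ⟨w, hw, rfl⟩
    funext u β
    simp [lieD_zero_zero]
  · rintro _ ⟨w, hw, rfl⟩ e'
    refine ⟨ins e' w, hw.ins _, ?_⟩
    simp only [ins_lieD, map_smul, map_sub, LinearMap.smul_apply, hw.head.smul, smul_sub]
    abel
  · rintro _ ⟨w, hw, rfl⟩ γ
    refine ⟨insF γ w, hw.insF _, ?_⟩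
    simp only [insF_lieD, map_smul, map_sub, LinearMap.smul_apply, hw.head.smulF, smul_sub]
    abel

theorem kap_add (α β : Ω) (hw : C.IsConv w) :
    C.kap (α + β) w = C.kap α w + C.kap β w := by
  rw [← sub_eq_zero]
  refine eq_zero_of_ins_mem {z | ∃ w, C.IsConv w ∧ z = C.kap (α + β) w -
    (C.kap α w + C.kap β w)} ?_ ?_ ?_ _ ⟨w, hw, rfl⟩
  · rintro _ ⟨w, hw, rfl⟩
    simp [kap_zero]
  · rintro _ ⟨w, hw, rfl⟩ e'
    refine ⟨-ins e' w, (hw.ins _).neg, ?_⟩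
    simp only [ins_kap, map_add, map_sub, map_neg, hw.head.addF]
    abel
  · rintro _ ⟨w, hw, rfl⟩ γ
    refine ⟨insF γ w, hw.insF _, ?_⟩
    simp only [insF_kap _ _ hw, map_add, map_sub]

theorem kap_smul (c : ℝ) (α : Ω) (hw : C.IsConv w) :
    C.kap (c • α) w = c • C.kap α w := by
  rw [← sub_eq_zero]
  refine eq_zero_of_ins_mem {z | ∃ w, C.IsConv w ∧ z = C.kap (c • α) w - c • C.kap α w}
    ?_ ?_ ?_ _ ⟨w, hw, rfl⟩
  · rintro _ ⟨w, hw, rfl⟩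
    simp [kap_zero]
  · rintro _ ⟨w, hw, rfl⟩ e'
    refine ⟨-ins e' w, (hw.ins _).neg, ?_⟩
    simp only [ins_kap, map_smul, map_sub, map_neg, hw.head.smulF, smul_sub, smul_neg]
    abel
  · rintro _ ⟨w, hw, rfl⟩ γ
    refine ⟨insF γ w, hw.insF _, ?_⟩
    simp only [insF_kap _ _ hw, map_smul, map_sub]

theorem kap_eq_zero {α : Ω} (h : ∀ e, C.iD e α = 0) (hw : C.IsConv w) : C.kap α w = 0 := by
  -- Only `iD · α` enters `kap`, so α may be replaced by 0 • α, and homogeneity finishes.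
  rw [C.kap_iD_congr (β := (0 : ℝ) • α) (by simp [h]) w, kap_smul _ _ hw, zero_smul]

theorem lieD_par (e : E) (w : MultiFamily R E Ω) : C.lieD e (par w) = par (C.lieD e w) := by
  rw [← sub_eq_zero]
  refine eq_zero_of_ins_mem {z | ∃ w, z = C.lieD e (par w) - par (C.lieD e w)}
    ?_ ?_ ?_ _ ⟨w, rfl⟩
  · rintro _ ⟨w, rfl⟩
    funext u β
    simp [lieD_zero_zero, par_apply]
  · rintro _ ⟨w, rfl⟩ e'
    refine ⟨-ins e' w, ?_⟩
    simp only [ins_par, ins_lieD, map_sub, map_neg]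
    abel
  · rintro _ ⟨w, rfl⟩ β
    refine ⟨insF β w, ?_⟩
    simp only [insF_par, insF_lieD, map_sub]
    abel

theorem kap_par (α : Ω) (hw : C.IsConv w) : C.kap α (par w) = -par (C.kap α w) := by
  rw [eq_neg_iff_add_eq_zero]
  refine eq_zero_of_ins_mem {z | ∃ w, C.IsConv w ∧ z = C.kap α (par w) + par (C.kap α w)}
    ?_ ?_ ?_ _ ⟨w, hw, rfl⟩
  · rintro _ ⟨w, hw, rfl⟩
    funext u β
    simp [par_apply, kap_zero]
  · rintro _ ⟨w, hw, rfl⟩ e'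
    refine ⟨ins e' w, hw.ins _, ?_⟩
    simp only [ins_par, ins_kap, insF_par, map_add, map_sub, map_neg]
    abel
  · rintro _ ⟨w, hw, rfl⟩ β
    refine ⟨insF β w, hw.insF _, ?_⟩
    simp only [insF_par, insF_kap _ _ hw, insF_kap _ _ hw.par, map_add]

variable (C) in
/-- The recursive characterization of the differential. -/
structure IsDifferential (d : MultiFamily R E Ω →ₗ[ℝ] MultiFamily R E Ω) : Prop where
  zero : ∀ w, d w 0 0 = 0
  insE : ∀ e w, C.IsConv w → ins e (d w) = C.lieD e w - d (ins e w)
  insO : ∀ α w, C.IsConv w → insF α (d w) = ins (C.coan α) w + d (insF α w) + C.kap α w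

namespace IsDifferential

variable {d : MultiFamily R E Ω →ₗ[ℝ] MultiFamily R E Ω}

/-- For the exchange relation, symmetrising i_{e₂} i_{e₁} d w cancels the Lie derivatives and leaves
the insertion of -([e₁,e₂] + [e₂,e₁]) = -ρ^*d⟨e₁,e₂⟩ and d of the relation for `w`. By the one-form
rule this is -i_{d⟨e₁,e₂⟩} d w, since κ of an exact form vanishes. -/
theorem isConv (hd : C.IsDifferential d) (h : C.IsConv w) : C.IsConv (d w) := by
  intro n
  induction n generalizing w with
  | zero => trivial
  | succ n ih =>
    refine ⟨?_, fun e' => ?_, fun β => ?_⟩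
    · have hh := h.head
      have hE := fun e => hd.insE e w h
      have hO := fun α => hd.insO α w h
      constructor
      · intro s t
        simp only [hE, hh.add, map_add, lieD_add _ _ h]
        abel
      · intro c s
        simp only [hE, hh.smul, map_smul, lieD_smul _ _ h, smul_sub]
      · intro s t
        simp only [hO, hh.addF, map_add, hh.add, kap_add _ _ h]
        abel
      · intro c s
        simp only [hO, hh.smulF, map_smul, hh.smul, kap_smul _ _ h, smul_add]
      · intro β γ
        simp only [hO, map_add, hd.insO _ _ (h.insF _), insF_kap _ _ h, ← ins_insF,
          hh.symm β γ]
        abel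
      · intro e₁ e₂
        have h₁ := C.br_add_swap e₁ e₂
        have h₂ := hh.add (C.br e₁ e₂) (C.br e₂ e₁)
        simp only [hE, hO, map_sub, ins_lieD, hd.insE _ _ (h.ins _), hh.exch' e₁ e₂, map_neg,
          ← h₁, h₂, kap_eq_zero (fun e => C.iD_dF e _) h]
        abel
    · rw [hd.insE _ _ h]
      exact (h.lieD _ n).sub (ih (h.ins e'))
    · rw [hd.insO _ _ h]
      exact ((h.ins _ n).add (ih (h.insF β))).add (h.kap _ n)

/-- Inserting a section reduces to `lieD_lieD`; inserting a one-form reduces to `lieD_kap` and [e,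
ρ^*α] = ρ^*(L_e α). -/
theorem lieD_comm (hd : C.IsDifferential d) (e : E) (hw : C.IsConv w) :
    C.lieD e (d w) = d (C.lieD e w) := by
  rw [← sub_eq_zero]
  refine eq_zero_of_ins_mem {z | ∃ w, C.IsConv w ∧ z = C.lieD e (d w) - d (C.lieD e w)}
    ?_ ?_ ?_ _ ⟨w, hw, rfl⟩
  · rintro _ ⟨w, hw, rfl⟩
    funext u β
    simp [lieD_zero_zero, hd.zero]
  · rintro _ ⟨w, hw, rfl⟩ e'
    refine ⟨-ins e' w, (hw.ins _).neg, ?_⟩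
    simp only [ins_lieD, hd.insE _ _ hw, hd.insE _ _ (hw.lieD e), map_sub, map_neg,
      ← lieD_lieD e e' hw]
    abel
  · rintro _ ⟨w, hw, rfl⟩ α
    refine ⟨insF α w, hw.insF _, ?_⟩
    simp only [insF_lieD, ins_lieD, hd.insO _ _ hw, hd.insO _ _ (hw.lieD e), map_sub, map_add,
      ← lieD_kap e α hw, ← C.br_coan]
    abel

/-- This is precisely the obstruction to d² commuting with the insertion of α. -/
theorem kap_comm (hd : C.IsDifferential d) (α : Ω) (hw : C.IsConv w) :
    C.lieD (C.coan α) w + d (C.kap α w) + C.kap α (d w) = 0 := by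
  refine eq_zero_of_ins_mem {z | ∃ w, C.IsConv w ∧ z = C.lieD (C.coan α) w + d (C.kap α w) +
    C.kap α (d w)} ?_ ?_ ?_ _ ⟨w, hw, rfl⟩
  · rintro _ ⟨w, hw, rfl⟩
    funext u β
    simp [lieD_zero_zero, hd.zero, kap_zero, C.lieF_coan]
  · rintro _ ⟨w, hw, rfl⟩ e
    refine ⟨ins e w, hw.ins _, ?_⟩
    -- L_e α and i_e dα differ by an exact form, which κ does not see.
    have h₂ : C.kap (C.lieO e α) w = C.kap (C.iD e α) w := by
      rw [C.lieO_eq, kap_add _ _ hw, kap_eq_zero (fun e => C.iD_dF e _) hw, add_zero]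
    have h₁ := lieD_kap e α hw
    rw [h₂, sub_eq_iff_eq_add] at h₁
    simp only [ins_lieD, ins_kap, hd.insE _ _ hw, hd.insE _ _ (hw.kap α), hd.insO _ _ hw, map_sub,
      map_add, map_neg, C.coan_br, hw.head.ins_neg, h₁]
    abel
  · rintro _ ⟨w, hw, rfl⟩ β
    refine ⟨insF β w, hw.insF _, ?_⟩
    have h₁ : ins (C.coan β) (C.kap α w) = -C.kap α (ins (C.coan β) w) := by
      rw [ins_kap, C.iD_coan, hw.head.insF_zero]
      abel
    have h₂ := eq_neg_of_add_eq_zero_left (kap_kap α β hw)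
    simp only [map_add, insF_lieD, C.lieO_coan, hw.head.insF_zero, hd.insO _ _ (hw.kap α), h₁,
      insF_kap _ _ (hd.isConv hw), hd.insO _ _ hw, insF_kap _ _ hw, h₂]
    abel

/-- The two rules give i_e d² = [L_e, d] + d² i_e and i_α d² = d² i_α + (L_{ρ^*α} + dκ_α + κ_α d),
and both error terms are zero. -/
theorem comp_self (hd : C.IsDifferential d) (hw : C.IsConv w) : d (d w) = 0 := by
  refine eq_zero_of_ins_mem {z | ∃ w, C.IsConv w ∧ z = d (d w)} ?_ ?_ ?_ _ ⟨w, hw, rfl⟩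
  · rintro _ ⟨w, hw, rfl⟩
    exact hd.zero _
  · rintro _ ⟨w, hw, rfl⟩ e
    refine ⟨ins e w, hw.ins _, ?_⟩
    simp only [hd.insE _ _ hw, hd.insE _ _ (hd.isConv hw), map_sub, hd.lieD_comm e hw]
    abel
  · rintro _ ⟨w, hw, rfl⟩ α
    refine ⟨insF α w, hw.insF _, ?_⟩
    have h := hd.kap_comm α hw
    rw [add_assoc, add_eq_zero_iff_eq_neg] at h
    simp only [hd.insO _ _ hw, hd.insO _ _ (hd.isConv hw), map_add, hd.insE _ _ hw, h]
    abel

/-- Every term of d changes the number of sections by one, up or down. -/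
theorem par_comm (hd : C.IsDifferential d) (hw : C.IsConv w) : d (par w) = -par (d w) := by
  rw [eq_neg_iff_add_eq_zero]
  refine eq_zero_of_ins_mem {z | ∃ w, C.IsConv w ∧ z = d (par w) + par (d w)}
    ?_ ?_ ?_ _ ⟨w, hw, rfl⟩
  · rintro _ ⟨w, hw, rfl⟩
    funext u β
    simp [par_apply, hd.zero]
  · rintro _ ⟨w, hw, rfl⟩ e
    refine ⟨ins e w, hw.ins _, ?_⟩
    simp only [map_add, ins_par, hd.insE _ _ hw, hd.insE _ _ hw.par, lieD_par, map_sub, map_neg]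
    abel
  · rintro _ ⟨w, hw, rfl⟩ α
    refine ⟨insF α w, hw.insF _, ?_⟩
    simp only [map_add, insF_par, ins_par, hd.insO _ _ hw, hd.insO _ _ hw.par, kap_par _ hw]
    abel

end IsDifferential

/-- The recursive characterization of the convolution product. -/
structure IsProduct (m : MultiFamily R E Ω →ₗ[ℝ] MultiFamily R E Ω →ₗ[ℝ] MultiFamily R E Ω) :
    Prop where
  zero : ∀ w η u α, m w η 0 0 u α = w 0 0 u α * η 0 0 u α
  insE : ∀ e w η, ins e (m w η) = m (ins e w) η + m (par w) (ins e η)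
  insO : ∀ α w η, insF α (m w η) = m (insF α w) η + m w (insF α η)

/-- A set of families that vanish in bidegree `(0, 0)` and whose insertions are sums of two of its
elements consists of the zero family only. -/
theorem eq_zero_of_ins_mem_add (S : Set (MultiFamily R E Ω)) (h0 : ∀ z ∈ S, z 0 0 = 0)
    (hE : ∀ z ∈ S, ∀ e, ∃ x ∈ S, ∃ y ∈ S, ins e z = x + y)
    (hF : ∀ z ∈ S, ∀ α, ∃ x ∈ S, ∃ y ∈ S, insF α z = x + y) :
    ∀ z ∈ S, z = 0 := by
  intro z hz
  funext a b
  induction a generalizing z with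
  | zero =>
    induction b generalizing z with
    | zero => exact h0 z hz
    | succ b ih =>
      funext u α
      obtain ⟨x, hx, y, hy, h⟩ := hF z hz (α 0)
      rw [apply_succ_right z, h, Pi.add_apply, Pi.add_apply, ih x hx, ih y hy]
      simp
  | succ a ih =>
    funext u α
    obtain ⟨x, hx, y, hy, h⟩ := hE z hz (u 0)
    rw [apply_succ_left z, h, Pi.add_apply, Pi.add_apply, ih x hx, ih y hy]
    simp

namespace IsProduct

variable {m : MultiFamily R E Ω →ₗ[ℝ] MultiFamily R E Ω →ₗ[ℝ] MultiFamily R E Ω}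

/-- In i_{e₂} i_{e₁} of a product the terms with one insertion in each factor are antisymmetric in
e₁, e₂, because `par` anticommutes with `ins`. They cancel in the exchange relation, which is left
to the factors. -/
theorem isConv (hm : IsProduct m) (hw : C.IsConv w) (hη : C.IsConv η) : C.IsConv (m w η) := by
  intro n
  induction n generalizing w η with
  | zero => trivial
  | succ n ih =>
    refine ⟨?_, fun e' => ?_, fun β => ?_⟩
    · have hh := hw.head
      have hh' := hη.head
      constructor
      · intro s t
        simp only [hm.insE, hh.add, hh'.add, map_add, LinearMap.add_apply]
        abel
      · intro c s
        simp only [hm.insE, hh.smul, hh'.smul, map_smul, LinearMap.smul_apply, smul_add]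
      · intro s t
        simp only [hm.insO, hh.addF, hh'.addF, map_add, LinearMap.add_apply]
        abel
      · intro c s
        simp only [hm.insO, hh.smulF, hh'.smulF, map_smul, LinearMap.smul_apply, smul_add]
      · intro β γ
        simp only [hm.insO, map_add, hh.symm β γ, hh'.symm β γ]
        abel
      · intro e₁ e₂
        simp only [hm.insE, hm.insO, map_add, ins_par, map_neg, hh.exch' e₁ e₂, hh'.exch' e₁ e₂,
          map_sub, LinearMap.neg_apply, LinearMap.sub_apply, par_par]
        abel
    · rw [hm.insE]
      exact (ih (hw.ins e') hη).add (ih hw.par (hη.ins e'))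
    · rw [hm.insO]
      exact (ih (hw.insF β) hη).add (ih hw (hη.insF β))

theorem lieD_mul (hm : IsProduct m) (e : E) (w η : MultiFamily R E Ω) :
    C.lieD e (m w η) = m (C.lieD e w) η + m w (C.lieD e η) := by
  rw [← sub_eq_zero]
  refine eq_zero_of_ins_mem_add {z | ∃ w η, z = C.lieD e (m w η) -
    (m (C.lieD e w) η + m w (C.lieD e η))} ?_ ?_ ?_ _ ⟨w, η, rfl⟩
  · rintro _ ⟨w, η, rfl⟩
    funext u α
    simp [lieD_zero_zero, hm.zero, C.lieF_mul]
  · rintro _ ⟨w, η, rfl⟩ e'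
    refine ⟨_, ⟨ins e' w, η, rfl⟩, _, ⟨par w, ins e' η, rfl⟩, ?_⟩
    simp only [ins_lieD, hm.insE, map_sub, map_add, LinearMap.sub_apply, lieD_par]
    abel
  · rintro _ ⟨w, η, rfl⟩ α
    refine ⟨_, ⟨insF α w, η, rfl⟩, _, ⟨w, insF α η, rfl⟩, ?_⟩
    simp only [insF_lieD, hm.insO, map_sub, map_add, LinearMap.sub_apply]
    abel

theorem kap_mul (hm : IsProduct m) (α : Ω) (hw : C.IsConv w) (hη : C.IsConv η) :
    C.kap α (m w η) = m (C.kap α w) η + m (par w) (C.kap α η) := by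
  rw [← sub_eq_zero]
  refine eq_zero_of_ins_mem_add {z | ∃ w η, C.IsConv w ∧ C.IsConv η ∧ z = C.kap α (m w η) -
    (m (C.kap α w) η + m (par w) (C.kap α η))} ?_ ?_ ?_ _ ⟨w, η, hw, hη, rfl⟩
  · rintro _ ⟨w, η, hw, hη, rfl⟩
    funext u α
    simp [kap_zero, hm.zero]
  · rintro _ ⟨w, η, hw, hη, rfl⟩ e
    refine ⟨_, ⟨-ins e w, η, (hw.ins e).neg, hη, rfl⟩,
      _, ⟨-par w, ins e η, hw.par.neg, hη.ins e, rfl⟩, ?_⟩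
    simp only [ins_kap, hm.insE, hm.insO, map_sub, map_add, map_neg, LinearMap.sub_apply,
      LinearMap.neg_apply, ins_par, kap_par _ hw, par_par]
    abel
  · rintro _ ⟨w, η, hw, hη, rfl⟩ β
    refine ⟨_, ⟨insF β w, η, hw.insF β, hη, rfl⟩, _, ⟨w, insF β η, hw, hη.insF β, rfl⟩, ?_⟩
    simp only [insF_kap _ _ (hm.isConv hw hη), insF_kap _ _ hw, insF_kap _ _ hη, hm.insO, map_sub,
      map_add, insF_par]
    abel

/-- Each operator in the two rules for d already obeys a Leibniz rule: `lieD_mul` for L_e, `kap_mul`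
for κ_α, and `IsProduct` for the insertions. The defect therefore splits into defects of pairs with
one factor inserted. -/
theorem d_mul (hm : IsProduct m) {d : MultiFamily R E Ω →ₗ[ℝ] MultiFamily R E Ω}
    (hd : C.IsDifferential d) (hw : C.IsConv w) (hη : C.IsConv η) :
    d (m w η) = m (d w) η + m (par w) (d η) := by
  rw [← sub_eq_zero]
  refine eq_zero_of_ins_mem_add {z | ∃ w η, C.IsConv w ∧ C.IsConv η ∧ z = d (m w η) -
    (m (d w) η + m (par w) (d η))} ?_ ?_ ?_ _ ⟨w, η, hw, hη, rfl⟩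
  · rintro _ ⟨w, η, hw, hη, rfl⟩
    funext u α
    simp [hd.zero, hm.zero]
  · rintro _ ⟨w, η, hw, hη, rfl⟩ e
    -- The sign in both witnesses comes from -d i_e in Cartan's formula.
    refine ⟨_, ⟨-ins e w, η, (hw.ins e).neg, hη, rfl⟩,
      _, ⟨-par w, ins e η, hw.par.neg, hη.ins e, rfl⟩, ?_⟩
    simp only [hd.insE _ _ (hm.isConv hw hη), hd.insE _ _ hw, hd.insE _ _ hη, hm.insE, map_sub,
      map_add, map_neg, LinearMap.sub_apply, LinearMap.neg_apply, ins_par, hd.par_comm hw,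
      hm.lieD_mul, par_par]
    abel
  · rintro _ ⟨w, η, hw, hη, rfl⟩ α
    refine ⟨_, ⟨insF α w, η, hw.insF α, hη, rfl⟩, _, ⟨w, insF α η, hw, hη.insF α, rfl⟩, ?_⟩
    simp only [hd.insO _ _ (hm.isConv hw hη), hd.insO _ _ hw, hd.insO _ _ hη, hm.insE, hm.insO,
      hm.kap_mul α hw hη, insF_par, map_sub, map_add, LinearMap.add_apply]
    abel

end IsProduct

end CourantOps
end Algebra

/-! ### Shuffles and the recursion for the convolution product -/

section ShuffleSums

/-- Permutations of `Fin n` that are increasing on the first `p` and on the last `n - p`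
elements. -/
def IsShuffle {n : ℕ} (p : ℕ) (σ : Equiv.Perm (Fin n)) : Prop :=
  (∀ r s : Fin n, r < s → (s : ℕ) < p → σ r < σ s) ∧
    ∀ r s : Fin n, p ≤ (r : ℕ) → r < s → σ r < σ s

open Classical in
/-- The finite set of shuffles. -/
def shuffleSet (n p : ℕ) : Finset (Equiv.Perm (Fin n)) := {σ | IsShuffle p σ}

theorem mem_shuffleSet {n p : ℕ} {σ : Equiv.Perm (Fin n)} :
    σ ∈ shuffleSet n p ↔ IsShuffle p σ := by
  classical
  simp [shuffleSet]

/-- The extension of a permutation of `Fin n` to `Fin (n + 1)` that fixes `0`. -/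
def permCons {n : ℕ} (σ : Equiv.Perm (Fin n)) : Equiv.Perm (Fin (n + 1)) :=
  Equiv.Perm.decomposeFin.symm (0, σ)

theorem permCons_zero {n : ℕ} (σ : Equiv.Perm (Fin n)) : permCons σ 0 = 0 := by
  simp [permCons]

theorem permCons_succ {n : ℕ} (σ : Equiv.Perm (Fin n)) (i : Fin n) :
    permCons σ i.succ = (σ i).succ := by
  simp [permCons]

theorem sign_permCons {n : ℕ} (σ : Equiv.Perm (Fin n)) :
    Equiv.Perm.sign (permCons σ) = Equiv.Perm.sign σ := by
  simp [permCons, Equiv.Perm.decomposeFin.symm_sign]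

theorem permCons_injective {n : ℕ} :
    Function.Injective (permCons : Equiv.Perm (Fin n) → Equiv.Perm (Fin (n + 1))) := by
  intro σ τ h
  simpa [permCons] using h

theorem exists_permCons {n : ℕ} {σ : Equiv.Perm (Fin (n + 1))} (h : σ 0 = 0) :
    ∃ τ, permCons τ = σ := by
  obtain ⟨⟨x, τ⟩, rfl⟩ := Equiv.Perm.decomposeFin.symm.surjective σ
  rw [Equiv.Perm.decomposeFin_symm_apply_zero] at h
  subst h
  exact ⟨τ, rfl⟩

theorem isShuffle_permCons {n p : ℕ} {σ : Equiv.Perm (Fin n)} :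
    IsShuffle (p + 1) (permCons σ) ↔ IsShuffle p σ := by
  constructor
  · rintro ⟨h₁, h₂⟩
    refine ⟨fun r s hrs hs => ?_, fun r s hr hrs => ?_⟩
    · have := h₁ r.succ s.succ (by simpa using hrs) (by simpa using hs)
      simpa [permCons_succ] using this
    · have := h₂ r.succ s.succ (by simpa using hr) (by simpa using hrs)
      simpa [permCons_succ] using this
  · rintro ⟨h₁, h₂⟩
    refine ⟨fun r s hrs hs => ?_, fun r s hr hrs => ?_⟩
    · obtain ⟨s, rfl⟩ := Fin.exists_succ_eq.2 (Fin.ne_zero_of_lt hrs)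
      rcases Fin.eq_zero_or_eq_succ r with rfl | ⟨r, rfl⟩
      · simp [permCons_zero, permCons_succ]
      · simpa [permCons_succ] using h₁ r s (by simpa using hrs) (by simpa using hs)
    · obtain ⟨s, rfl⟩ := Fin.exists_succ_eq.2 (Fin.ne_zero_of_lt hrs)
      rcases Fin.eq_zero_or_eq_succ r with rfl | ⟨r, rfl⟩
      · simp at hr
      · simpa [permCons_succ] using h₂ r s (by simpa using hr) (by simpa using hrs)

/-- The permutation that maps `p` to `0` and the other elements as `σ`. -/
def permInsert {n : ℕ} (p : Fin (n + 1)) (σ : Equiv.Perm (Fin n)) : Equiv.Perm (Fin (n + 1)) :=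
  permCons σ * p.cycleRange

theorem permInsert_self {n : ℕ} (p : Fin (n + 1)) (σ : Equiv.Perm (Fin n)) :
    permInsert p σ p = 0 := by
  simp [permInsert, permCons_zero]

theorem permInsert_castSucc {n : ℕ} {p : Fin (n + 1)} (σ : Equiv.Perm (Fin n)) {r : Fin n}
    (h : r.castSucc < p) : permInsert p σ r.castSucc = (σ r).succ := by
  rw [permInsert, Equiv.Perm.mul_apply, Fin.cycleRange_of_lt h, ← permCons_succ]
  simp

theorem permInsert_succ {n : ℕ} {p : Fin (n + 1)} (σ : Equiv.Perm (Fin n)) {r : Fin n}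
    (h : p < r.succ) : permInsert p σ r.succ = (σ r).succ := by
  rw [permInsert, Equiv.Perm.mul_apply, Fin.cycleRange_of_gt h, ← permCons_succ]

/-- This sign is the source of `par` in the recursion: the new argument passes the p arguments of
the first block. -/
theorem sign_permInsert {n : ℕ} (p : Fin (n + 1)) (σ : Equiv.Perm (Fin n)) :
    Equiv.Perm.sign (permInsert p σ) = (-1) ^ (p : ℕ) * Equiv.Perm.sign σ := by
  rw [permInsert, Equiv.Perm.sign_mul, Fin.sign_cycleRange, sign_permCons, mul_comm]

theorem permInsert_injective {n : ℕ} (p : Fin (n + 1)) : Function.Injective (permInsert p) :=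
  fun _ _ h => permCons_injective (mul_right_cancel h)

theorem exists_permInsert {n : ℕ} {p : Fin (n + 1)} {σ : Equiv.Perm (Fin (n + 1))}
    (h : σ p = 0) : ∃ τ, permInsert p τ = σ := by
  obtain ⟨τ, hτ⟩ := exists_permCons (σ := σ * p.cycleRange⁻¹) (by
    rw [Equiv.Perm.mul_apply, Equiv.Perm.inv_def, Fin.cycleRange_symm_zero, h])
  exact ⟨τ, by rw [permInsert, hτ, inv_mul_cancel_right]⟩

theorem isShuffle_permInsert {n : ℕ} {p : Fin (n + 1)} {σ : Equiv.Perm (Fin n)} :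
    IsShuffle p (permInsert p σ) ↔ IsShuffle p σ := by
  constructor
  · rintro ⟨h₁, h₂⟩
    refine ⟨fun r s hrs hs => ?_, fun r s hr hrs => ?_⟩
    · have := h₁ r.castSucc s.castSucc (by simpa using hrs) (by simpa using hs)
      rwa [permInsert_castSucc σ (Fin.lt_def.2 hs),
        permInsert_castSucc σ (Fin.lt_def.2 (show (r : ℕ) < p from lt_trans (Fin.lt_def.1 hrs) hs)),
        Fin.succ_lt_succ_iff] at this
    · have := h₂ r.succ s.succ (by simpa using hr.trans (Nat.le_succ _)) (by simpa using hrs)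
      rwa [permInsert_succ σ (Fin.lt_def.2 (by simpa using Nat.lt_succ_of_le hr)),
        permInsert_succ σ (Fin.lt_def.2 (by
          have := Fin.lt_def.1 hrs; simp only [Fin.val_succ]; omega)),
        Fin.succ_lt_succ_iff] at this
  · rintro ⟨h₁, h₂⟩
    refine ⟨fun r s hrs hs => ?_, fun r s hr hrs => ?_⟩
    · have hp := p.is_lt
      have hrs' := Fin.lt_def.1 hrs
      obtain ⟨s, rfl⟩ := Fin.exists_castSucc_eq.2 (show s ≠ Fin.last n from
        fun h => by rw [h, Fin.val_last] at hs; omega)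
      obtain ⟨r, rfl⟩ := Fin.exists_castSucc_eq.2 (show r ≠ Fin.last n from
        fun h => by rw [h, Fin.val_last] at hrs'; omega)
      rw [permInsert_castSucc σ (Fin.lt_def.2 hs),
        permInsert_castSucc σ (Fin.lt_def.2 (lt_trans hrs' hs)), Fin.succ_lt_succ_iff]
      exact h₁ r s hrs hs
    · have hrs' := Fin.lt_def.1 hrs
      obtain ⟨s, rfl⟩ := Fin.exists_succ_eq.2 (Fin.ne_zero_of_lt hrs)
      rw [permInsert_succ σ (Fin.lt_def.2 (lt_of_le_of_lt hr hrs'))]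
      rcases hr.eq_or_lt with h | h
      · rw [← Fin.ext h, permInsert_self]
        exact Fin.succ_pos _
      · obtain ⟨r, rfl⟩ := Fin.exists_succ_eq.2 (Fin.ne_zero_of_lt (Fin.lt_def.2 h))
        rw [permInsert_succ σ (Fin.lt_def.2 h), Fin.succ_lt_succ_iff]
        exact h₂ r s (Nat.lt_succ_iff.1 (by simpa using h)) (by simpa using hrs)

variable {R : Type*} [CommRing R]

theorem sum_shuffleSet_filter_first {n p : ℕ} (G : Equiv.Perm (Fin (n + 1)) → R) :
    ∑ σ ∈ shuffleSet (n + 1) (p + 1) with σ 0 = 0, G σ =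
      ∑ σ ∈ shuffleSet n p, G (permCons σ) := by
  symm
  refine Finset.sum_bij (fun σ _ => permCons σ) ?_ ?_ ?_ ?_
  · intro σ hσ
    rw [Finset.mem_filter, mem_shuffleSet]
    exact ⟨isShuffle_permCons.2 (mem_shuffleSet.1 hσ), permCons_zero σ⟩
  · intro σ _ τ _ h
    exact permCons_injective h
  · intro σ hσ
    rw [Finset.mem_filter, mem_shuffleSet] at hσ
    obtain ⟨τ, rfl⟩ := exists_permCons hσ.2
    exact ⟨τ, mem_shuffleSet.2 (isShuffle_permCons.1 hσ.1), rfl⟩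
  · intro σ _
    rfl

theorem sum_shuffleSet_filter_second {n : ℕ} (p : Fin (n + 1))
    (G : Equiv.Perm (Fin (n + 1)) → R) :
    ∑ σ ∈ shuffleSet (n + 1) p with σ p = 0, G σ =
      ∑ σ ∈ shuffleSet n p, G (permInsert p σ) := by
  symm
  refine Finset.sum_bij (fun σ _ => permInsert p σ) ?_ ?_ ?_ ?_
  · intro σ hσ
    rw [Finset.mem_filter, mem_shuffleSet]
    exact ⟨isShuffle_permInsert.2 (mem_shuffleSet.1 hσ), permInsert_self p σ⟩
  · intro σ _ τ _ h
    exact permInsert_injective p h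
  · intro σ hσ
    rw [Finset.mem_filter, mem_shuffleSet] at hσ
    obtain ⟨τ, rfl⟩ := exists_permInsert hσ.2
    exact ⟨τ, mem_shuffleSet.2 (isShuffle_permInsert.1 hσ.1), rfl⟩
  · intro σ _
    rfl

/-- A shuffle is increasing on each block, so the least value 0 can be taken only at the start of a
block. -/
theorem IsShuffle.first_or_second {n p : ℕ} {σ : Equiv.Perm (Fin (n + 1))} (h : IsShuffle p σ) :
    (0 < p ∧ σ 0 = 0) ∨ ∃ hp : p < n + 1, σ ⟨p, hp⟩ = 0 := by
  obtain ⟨s, hs⟩ := σ.surjective 0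
  rcases lt_or_ge (s : ℕ) p with h' | h'
  · left
    refine ⟨by omega, ?_⟩
    rcases eq_or_ne s 0 with rfl | h0
    · exact hs
    · exact absurd (hs ▸ h.1 0 s (Fin.pos_iff_ne_zero.2 h0) h') (Fin.not_lt_zero _)
  · right
    have hp : p < n + 1 := lt_of_le_of_lt h' s.is_lt
    refine ⟨hp, ?_⟩
    rcases h'.eq_or_lt with h0 | h0
    · rw [← hs]
      congr 1
      exact Fin.ext h0
    · exact absurd (hs ▸ h.2 ⟨p, hp⟩ s le_rfl h0) (Fin.not_lt_zero _)

/-- Pascal's rule for shuffles: sort them by the block that contains the value 0 and remove that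
value. The first index of `G` is a natural number, so that the shifted index i + 1 needs no
transport. -/
theorem sum_shuffleSet_succ {n : ℕ} (G : ℕ → Equiv.Perm (Fin (n + 1)) → R) :
    ∑ i : Fin (n + 2), ∑ σ ∈ shuffleSet (n + 1) i, G i σ =
      ∑ i : Fin (n + 1), ∑ σ ∈ shuffleSet n i, G (i + 1) (permCons σ) +
        ∑ i : Fin (n + 1), ∑ σ ∈ shuffleSet n i, G i (permInsert i σ) := by
  classical
  have h : ∀ i : Fin (n + 2), ∑ σ ∈ shuffleSet (n + 1) i, G i σ =
      ∑ σ ∈ shuffleSet (n + 1) i with 0 < (i : ℕ) ∧ σ 0 = 0, G i σ +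
        ∑ σ ∈ shuffleSet (n + 1) i with ¬ (0 < (i : ℕ) ∧ σ 0 = 0), G i σ :=
    fun i => (Finset.sum_filter_add_sum_filter_not _ _ _).symm
  simp only [h, Finset.sum_add_distrib]
  congr 1
  · rw [Fin.sum_univ_succ]
    simp only [Fin.val_zero, lt_irrefl, false_and, Finset.filter_false, Finset.sum_empty, zero_add,
      Fin.val_succ, Nat.succ_pos, true_and]
    exact Finset.sum_congr rfl fun i _ => sum_shuffleSet_filter_first _
  · rw [Fin.sum_univ_castSucc]
    -- For the largest index the second block is empty, so it cannot contain 0.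
    have h0 : ∑ σ ∈ shuffleSet (n + 1) (Fin.last (n + 1)) with
        ¬ (0 < ((Fin.last (n + 1) : Fin (n + 2)) : ℕ) ∧ σ 0 = 0),
        G (Fin.last (n + 1) : Fin (n + 2)) σ = 0 := by
      rw [Finset.filter_eq_empty_iff.2, Finset.sum_empty]
      intro σ hσ
      rcases (mem_shuffleSet.1 hσ).first_or_second with h' | ⟨h', _⟩
      · exact fun h => h h'
      · simp at h'
    rw [h0, add_zero]
    refine Finset.sum_congr rfl fun i _ => ?_
    rw [← sum_shuffleSet_filter_second]
    simp only [Fin.val_castSucc]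
    refine Finset.sum_congr (Finset.filter_congr fun σ hσ => ?_) fun _ _ => rfl
    constructor
    · intro h'
      rcases (mem_shuffleSet.1 hσ).first_or_second with h'' | ⟨_, h''⟩
      · exact absurd h'' h'
      · exact h''
    · rintro h' ⟨h₁, h₂⟩
      have := σ.injective (h'.trans h₂.symm)
      simp [this] at h₁

/-- The sum over all shuffles of `u` of a function of the two parts of `u`, weighted by a
character of the sign. -/
def shuffleSum {X : Type*} (χ : ℤˣ →* ℤˣ) (n : ℕ) (φ : ∀ p q : ℕ, (Fin p → X) → (Fin q → X) → R)
    (u : Fin n → X) : R :=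
  ∑ i : Fin (n + 1), ∑ σ ∈ shuffleSet n i, ((χ (Equiv.Perm.sign σ) : ℤ) : R) *
    φ i (n - i) (fun r => u (σ (Fin.cast (Nat.add_sub_of_le i.is_le) (Fin.castAdd _ r))))
      (fun r => u (σ (Fin.cast (Nat.add_sub_of_le i.is_le) (Fin.natAdd _ r))))

theorem shuffleSum_zero {X : Type*} (χ : ℤˣ →* ℤˣ)
    (φ : ∀ p q : ℕ, (Fin p → X) → (Fin q → X) → R) (u : Fin 0 → X) :
    shuffleSum χ 0 φ u = φ 0 0 u u := by
  have h : shuffleSet 0 0 = {1} := by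
    ext σ
    rw [mem_shuffleSet, Finset.mem_singleton, Subsingleton.elim σ 1]
    simp only [iff_true]
    exact ⟨fun r => r.elim0, fun r => r.elim0⟩
  change ∑ i : Fin 1, _ = _
  rw [Fin.sum_univ_one]
  change ∑ σ ∈ shuffleSet 0 0, _ = _
  rw [h, Finset.sum_singleton, map_one, map_one, Units.val_one, Int.cast_one, one_mul]
  congr 1 <;> funext r <;> exact r.elim0

theorem shuffleSum_add {X : Type*} (χ : ℤˣ →* ℤˣ) (n : ℕ)
    (φ ψ : ∀ p q : ℕ, (Fin p → X) → (Fin q → X) → R) (u : Fin n → X) :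
    shuffleSum χ n (fun p q v v' => φ p q v v' + ψ p q v v') u =
      shuffleSum χ n φ u + shuffleSum χ n ψ u := by
  simp only [shuffleSum, mul_add, Finset.sum_add_distrib]

theorem shuffleSum_mul_left {X : Type*} (χ : ℤˣ →* ℤˣ) (n : ℕ) (c : R)
    (φ : ∀ p q : ℕ, (Fin p → X) → (Fin q → X) → R) (u : Fin n → X) :
    shuffleSum χ n (fun p q v v' => c * φ p q v v') u = c * shuffleSum χ n φ u := by
  simp only [shuffleSum, Finset.mul_sum]
  exact Finset.sum_congr rfl fun _ _ => Finset.sum_congr rfl fun _ _ => by ring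

/-- The part of a permuted tuple that starts at the position `p`. -/
theorem apply_parts_congr {X : Type*} (φ : ∀ p q : ℕ, (Fin p → X) → (Fin q → X) → R) {n p q q' : ℕ}
    (h : q = q') (hn : p + q = n) (u : Fin n → X) (v : Fin p → X) :
    φ p q v (fun r => u (Fin.cast hn (Fin.natAdd p r))) =
      φ p q' v (fun r => u (Fin.cast (h ▸ hn) (Fin.natAdd p r))) := by
  subst h
  rfl

/-- The recursion serves sections and one-forms at once: χ is the identity for the former and
trivial for the latter. -/
theorem shuffleSum_cons {X : Type*} (χ : ℤˣ →* ℤˣ) (n : ℕ)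
    (φ : ∀ p q : ℕ, (Fin p → X) → (Fin q → X) → R) (x : X) (u : Fin n → X) :
    shuffleSum χ (n + 1) φ (Fin.cons x u) =
      shuffleSum χ n (fun p q v v' => φ (p + 1) q (Fin.cons x v) v') u +
        shuffleSum χ n (fun p q v v' => ((χ ((-1) ^ p) : ℤ) : R) *
          φ p (q + 1) v (Fin.cons x v')) u := by
  -- Extension by zero to all natural i; the casts make sense only for i ≤ n + 1.
  let G : ℕ → Equiv.Perm (Fin (n + 1)) → R := fun i σ =>
    if h : i ≤ n + 1 then ((χ (Equiv.Perm.sign σ) : ℤ) : R) *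
      φ i (n + 1 - i)
        (fun r => (Fin.cons x u : Fin (n + 1) → X)
          (σ (Fin.cast (Nat.add_sub_of_le h) (Fin.castAdd _ r))))
        (fun r => (Fin.cons x u : Fin (n + 1) → X)
          (σ (Fin.cast (Nat.add_sub_of_le h) (Fin.natAdd _ r)))) else 0
  have hG : shuffleSum χ (n + 1) φ (Fin.cons x u) =
      ∑ i : Fin (n + 2), ∑ σ ∈ shuffleSet (n + 1) i, G i σ := by
    refine Finset.sum_congr rfl fun i _ => Finset.sum_congr rfl fun σ _ => ?_
    simp only [G]
    rw [dif_pos i.is_le]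
  rw [hG, sum_shuffleSet_succ]
  congr 1
  · refine Finset.sum_congr rfl fun i _ => Finset.sum_congr rfl fun σ _ => ?_
    simp only [G]
    rw [dif_pos (Nat.succ_le_succ i.is_le), sign_permCons]
    congr 1
    -- The length of the second block is rewritten before the tuples are compared, since its type
    -- depends on it.
    rw [apply_parts_congr φ (show n + 1 - (i + 1) = n - i by omega) _
      (fun s => (Fin.cons x u : Fin (n + 1) → X) (permCons σ s))]
    congr 1
    · funext r
      refine Fin.cases ?_ (fun r => ?_) r
      · exact congrArg (Fin.cons x u : Fin (n + 1) → X) (permCons_zero σ)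
      · refine (congrArg (Fin.cons x u : Fin (n + 1) → X) (permCons_succ σ
          (Fin.cast (Nat.add_sub_of_le i.is_le) (Fin.castAdd _ r)))).trans ?_
        rw [Fin.cons_succ, Fin.cons_succ]
    · funext r
      have hr : (Fin.cast (by omega) (Fin.natAdd (i + 1) r) : Fin (n + 1)) =
          (Fin.cast (Nat.add_sub_of_le i.is_le) (Fin.natAdd (i : ℕ) r) : Fin n).succ := by
        ext
        simp
        omega
      rw [hr, permCons_succ, Fin.cons_succ]
  · refine Finset.sum_congr rfl fun i _ => Finset.sum_congr rfl fun σ _ => ?_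
    simp only [G]
    rw [dif_pos (i.is_le.trans (Nat.le_succ n)), sign_permInsert, map_mul, Units.val_mul,
      Int.cast_mul, mul_comm ((χ ((-1) ^ (i : ℕ)) : ℤ) : R), mul_assoc]
    congr 2
    rw [apply_parts_congr φ (show n + 1 - i = n - i + 1 by omega) _
      (fun s => (Fin.cons x u : Fin (n + 1) → X) (permInsert i σ s))]
    congr 1
    · funext r
      have hr : (Fin.cast (by omega) (Fin.castAdd (n + 1 - i) r) : Fin (n + 1)) =
          (Fin.cast (Nat.add_sub_of_le i.is_le) (Fin.castAdd (n - i) r) : Fin n).castSucc := by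
        ext
        simp
      rw [hr, permInsert_castSucc σ (by simp [Fin.lt_def]), Fin.cons_succ]
    · funext r
      refine Fin.cases ?_ (fun r => ?_) r
      · have hr : (Fin.cast (by omega) (Fin.natAdd (i : ℕ) (0 : Fin (n - i + 1))) :
            Fin (n + 1)) = i := by
          ext
          simp
        rw [hr, permInsert_self, Fin.cons_zero, Fin.cons_zero]
      · have hr : (Fin.cast (by omega) (Fin.natAdd (i : ℕ) r.succ) : Fin (n + 1)) =
          (Fin.cast (Nat.add_sub_of_le i.is_le) (Fin.natAdd (i : ℕ) r) : Fin n).succ := by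
          ext
          simp
          omega
        rw [hr, permInsert_succ σ (by simp [Fin.lt_def]), Fin.cons_succ, Fin.cons_succ]

variable {E Ω : Type*}

/-- The convolution product of families, in terms of sums over shuffles. -/
def shuffleMul (w η : MultiFamily R E Ω) : MultiFamily R E Ω := fun a b e α =>
  shuffleSum (MonoidHom.id _) a (fun i i' v v' => shuffleSum 1 b
    (fun j j' x x' => w i j v x * η i' j' v' x') α) e

/-- `Shuffles` lives on `Fin (p + q)` and `shuffleSet` on `Fin n`. Letting the summand depend on the
underlying map and on the sign separately makes the transport disappear after `subst`. -/
theorem sum_shuffles {n p q : ℕ} (h : p + q = n) (Φ : (Fin n → Fin n) → ℤˣ → R) :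
    ∑ σ ∈ Shuffles p q, Φ (fun r => Fin.cast h (σ (Fin.cast h.symm r))) (Equiv.Perm.sign σ) =
      ∑ σ ∈ shuffleSet n p, Φ σ (Equiv.Perm.sign σ) := by
  subst h
  refine Finset.sum_congr ?_ fun _ _ => rfl
  ext σ
  rw [mem_shuffleSet, Shuffles, Finset.mem_filter]
  simp only [Finset.mem_univ, true_and]
  constructor
  · rintro ⟨h₁, h₂⟩
    refine ⟨fun r s hrs hs => ?_, fun r s hr hrs => ?_⟩
    · exact h₁ (a := ⟨r, lt_trans hrs hs⟩) (b := ⟨s, hs⟩) hrs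
    · have hrs' := Fin.lt_def.1 hrs
      have e : ∀ t : Fin (p + q), (h : p ≤ (t : ℕ)) →
          t = Fin.natAdd p ⟨t - p, by omega⟩ := fun t h => Fin.ext (by simp; omega)
      rw [e r hr, e s (by omega)]
      exact h₂ (Fin.lt_def.2 (by simp only; omega))
  · rintro ⟨h₁, h₂⟩
    exact ⟨fun r s hrs => h₁ _ _ hrs s.is_lt, fun r s hrs => h₂ _ _ (by simp) (by simpa using hrs)⟩

theorem shuffleMul_apply (w η : MultiFamily R E Ω) (a b : ℕ) (e : Fin a → E) (α : Fin b → Ω) :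
    shuffleMul w η a b e α = ∑ i : Fin (a + 1), ∑ j : Fin (b + 1),
      ∑ σ ∈ Shuffles i (a - i), ∑ τ ∈ Shuffles j (b - j), ((Equiv.Perm.sign σ : ℤ) : R) *
      (w i j
          (fun r => e (Fin.cast (Nat.add_sub_of_le i.is_le) (σ (Fin.castAdd _ r))))
          (fun r => α (Fin.cast (Nat.add_sub_of_le j.is_le) (τ (Fin.castAdd _ r)))) *
        η (a - i) (b - j)
          (fun r => e (Fin.cast (Nat.add_sub_of_le i.is_le) (σ (Fin.natAdd _ r))))
          (fun r => α (Fin.cast (Nat.add_sub_of_le j.is_le) (τ (Fin.natAdd _ r))))) := by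
  simp only [shuffleMul, shuffleSum]
  refine Finset.sum_congr rfl fun i _ => ?_
  rw [Finset.sum_comm]
  refine (sum_shuffles (Nat.add_sub_of_le i.is_le) (fun s ε =>
    (((MonoidHom.id _ ε : ℤˣ) : ℤ) : R) *
    ∑ j : Fin (b + 1), ∑ τ ∈ shuffleSet b j, (((1 : ℤˣ →* ℤˣ) (Equiv.Perm.sign τ) : ℤ) : R) *
      (w i j (fun r => e (s (Fin.cast (Nat.add_sub_of_le i.is_le) (Fin.castAdd (a - i) r))))
        (fun r => α (τ (Fin.cast (Nat.add_sub_of_le j.is_le) (Fin.castAdd (b - j) r)))) *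
        η (a - i) (b - j)
          (fun r => e (s (Fin.cast (Nat.add_sub_of_le i.is_le) (Fin.natAdd i r))))
          (fun r => α (τ (Fin.cast (Nat.add_sub_of_le j.is_le) (Fin.natAdd j r))))))).symm.trans ?_
  refine Finset.sum_congr rfl fun σ _ => ?_
  rw [Finset.mul_sum]
  refine Finset.sum_congr rfl fun j _ => ?_
  rw [← Finset.mul_sum]
  congr 1
  refine (sum_shuffles (Nat.add_sub_of_le j.is_le) (fun s ε =>
    (((1 : ℤˣ →* ℤˣ) ε : ℤ) : R) *
      (w i j (fun r => e (Fin.cast (Nat.add_sub_of_le i.is_le) (σ (Fin.castAdd _ r))))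
        (fun r => α (s (Fin.cast (Nat.add_sub_of_le j.is_le) (Fin.castAdd (b - j) r)))) *
        η (a - i) (b - j) (fun r => e (Fin.cast (Nat.add_sub_of_le i.is_le) (σ (Fin.natAdd _ r))))
          (fun r => α (s (Fin.cast (Nat.add_sub_of_le j.is_le) (Fin.natAdd j r))))))).symm.trans ?_
  refine Finset.sum_congr rfl fun τ _ => ?_
  rw [MonoidHom.one_apply, Units.val_one, Int.cast_one, one_mul]
  rfl

theorem insF_shuffleMul (α : Ω) (w η : MultiFamily R E Ω) :
    (fun a b e β => shuffleMul w η a (b + 1) e (Fin.cons α β) : MultiFamily R E Ω) =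
      shuffleMul (fun a b e β => w a (b + 1) e (Fin.cons α β)) η +
        shuffleMul w (fun a b e β => η a (b + 1) e (Fin.cons α β)) := by
  funext a b e β
  simp only [shuffleMul, Pi.add_apply, shuffleSum_cons, shuffleSum_add, MonoidHom.one_apply,
    Units.val_one, Int.cast_one, one_mul]

/-- The sign depends only on the number of sections given to `w`, hence it can be absorbed into `w`
as `par w`. -/
theorem ins_shuffleMul (x : E) (w η : MultiFamily R E Ω) :
    (fun a b e β => shuffleMul w η (a + 1) b (Fin.cons x e) β : MultiFamily R E Ω) =
      shuffleMul (fun a b e β => w (a + 1) b (Fin.cons x e) β) η +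
        shuffleMul (fun a b e β => (-1) ^ a * w a b e β)
          (fun a b e β => η (a + 1) b (Fin.cons x e) β) := by
  funext a b e β
  simp only [shuffleMul, Pi.add_apply, shuffleSum_cons, MonoidHom.id_apply,
    Units.val_pow_eq_pow_val, Units.val_neg, Units.val_one, Int.cast_pow, Int.cast_neg,
    Int.cast_one, mul_assoc, shuffleSum_mul_left]

variable [Algebra ℝ R]

/-- The convolution product as a bilinear map. -/
def shuffleMulₗ : MultiFamily R E Ω →ₗ[ℝ] MultiFamily R E Ω →ₗ[ℝ] MultiFamily R E Ω :=
  LinearMap.mk₂ ℝ shuffleMul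
    (fun w w' η => by
      funext a b e β
      simp only [shuffleMul, Pi.add_apply, add_mul, shuffleSum_add])
    (fun c w η => by
      funext a b e β
      simp only [shuffleMul, Pi.smul_apply, Algebra.smul_def, mul_assoc, shuffleSum_mul_left])
    (fun w η η' => by
      funext a b e β
      simp only [shuffleMul, Pi.add_apply, mul_add, shuffleSum_add])
    (fun c w η => by
      funext a b e β
      simp only [shuffleMul, Pi.smul_apply, Algebra.smul_def, mul_left_comm _ (algebraMap ℝ R c),
        shuffleSum_mul_left])

theorem isProduct_shuffleMul [AddCommGroup E] [Module ℝ E] [AddCommGroup Ω] [Module ℝ Ω] :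
    CourantOps.IsProduct (shuffleMulₗ : MultiFamily R E Ω →ₗ[ℝ] _) where
  zero w η u α := by
    change shuffleMul w η 0 0 u α = _
    rw [shuffleMul, shuffleSum_zero, shuffleSum_zero]
  insE e w η := ins_shuffleMul e w η
  insO α w η := insF_shuffleMul α w η

end ShuffleSums

/-! ### The product of the statement as a shuffle sum -/

section Product

variable {EM : Type*} [NormedAddCommGroup EM] [NormedSpace ℝ EM] [FiniteDimensional ℝ EM]
  {H : Type*} [TopologicalSpace H] {I : ModelWithCorners ℝ EM H}
  {M : Type*} [TopologicalSpace M] [ChartedSpace H M] [IsManifold I ∞ M]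
  {F : Type*} [NormedAddCommGroup F] [NormedSpace ℝ F] [FiniteDimensional ℝ F]
  {V : M → Type*} [TopologicalSpace (TotalSpace F V)]
  [∀ x, AddCommGroup (V x)] [∀ x, Module ℝ (V x)] [∀ x, TopologicalSpace (V x)]
  [FiberBundle F V] [VectorBundle ℝ F V]

theorem convMul_eq_shuffleMul (w η : Cochain I F V) : convMul w η = shuffleMul w η := by
  funext a b e α
  exact (shuffleMul_apply w η a b e α).symm

end Product

/-! ### Calculus of vector fields and one-forms on the manifold -/

section Calculus

variable {EM : Type*} [NormedAddCommGroup EM] [NormedSpace ℝ EM] [FiniteDimensional ℝ EM]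
  {H : Type*} [TopologicalSpace H] {I : ModelWithCorners ℝ EM H}
  {M : Type*} [TopologicalSpace M] [ChartedSpace H M] [IsManifold I ∞ M]
  {F : Type*} [NormedAddCommGroup F] [NormedSpace ℝ F] [FiniteDimensional ℝ F]
  {V : M → Type*} [TopologicalSpace (TotalSpace F V)]
  [∀ x, AddCommGroup (V x)] [∀ x, Module ℝ (V x)] [∀ x, TopologicalSpace (V x)]
  [FiberBundle F V] [VectorBundle ℝ F V]

/-- Multiply a local extension of v by a bump function at x. This underlies all later passages from
identities of sections to identities at a point. -/
theorem exists_sec_apply_eq [T2Space M] [ContMDiffVectorBundle ∞ F V I] (x : M) (v : V x) :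
    ∃ s : Sec I F V, s x = v := by
  obtain ⟨u, hu, hs⟩ := FiberBundle.exists_contMDiffOn_extend (k := ∞) I F v
  obtain ⟨o, hou, ho, hxo⟩ := mem_nhds_iff.1 hu
  obtain ⟨f, hf, -⟩ := (SmoothBumpFunction.nhds_basis_support (I := I) (ho.mem_nhds hxo)).mem_iff.1
    (ho.mem_nhds hxo)
  have h := ContMDiffOn.smul_section_of_tsupport (f.contMDiff.contMDiffOn (s := o)) ho hf
    (hs.mono hou)
  refine ⟨⟨_, h⟩, ?_⟩
  simp

/-- Test functions are linear functionals of the chart, cut off by a bump function equal to 1 near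
x; the derivative of the chart is invertible. -/
theorem eq_zero_of_mvfderiv_eq_zero [T2Space M] (x : M) (v : TangentSpace I x)
    (h : ∀ f : Fn I M, mvfderiv I f x v = 0) : v = 0 := by
  obtain ⟨χ, -⟩ := (SmoothBumpFunction.nhds_basis_tsupport (I := I) x).ex_mem
  have hinv := isInvertible_mfderiv_extChartAt (I := I) (mem_extChartAt_source (I := I) x)
  have hφ : mfderiv I 𝓘(ℝ, EM) (extChartAt I x) x v = 0 := by
    rw [← Module.forall_dual_apply_eq_zero_iff ℝ]
    intro l
    let l' : EM →L[ℝ] ℝ := LinearMap.toContinuousLinearMap l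
    let g : M → ℝ := fun y => χ y • l' (extChartAt I x y)
    have hg : ContMDiff I 𝓘(ℝ, ℝ) ∞ g := χ.contMDiff_smul
      (l'.contMDiff.comp_contMDiffOn contMDiffOn_extChartAt)
    have h1 := h ⟨g, hg⟩
    have h2 : g =ᶠ[nhds x] fun y => l' (extChartAt I x y) := by
      filter_upwards [χ.eventuallyEq_one] with y hy
      simp [g, hy]
    have h3 : mfderiv I 𝓘(ℝ, ℝ) g x = mfderiv I 𝓘(ℝ, ℝ) (l' ∘ extChartAt I x) x :=
      h2.mfderiv_eq
    have h4 := mfderiv_comp (I := I) (I' := 𝓘(ℝ, EM)) (I'' := 𝓘(ℝ, ℝ)) x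
      l'.mdifferentiableAt (mdifferentiableAt_extChartAt (I := I) (mem_chart_source H x))
    have h5 : mfderiv I 𝓘(ℝ, ℝ) g x v = 0 := h1
    rw [h3, h4] at h5
    rw [ContinuousLinearMap.mfderiv_eq] at h5
    exact h5
  obtain ⟨e, he⟩ := hinv
  rw [← he] at hφ
  exact e.map_eq_zero_iff.1 hφ

theorem Form.ext_pairing [T2Space M] {α β : Form I M}
    (h : ∀ Y : VField I M, pairing α Y = pairing β Y) : α = β := by
  refine ContMDiffSection.ext fun x => ?_
  ext v
  obtain ⟨Y, rfl⟩ := exists_sec_apply_eq (I := I) (F := EM)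
    (V := fun x : M => TangentSpace I x) x v
  exact congrArg (fun f : Fn I M => f x) (h Y)

theorem VField.ext_lie [T2Space M] {X Y : VField I M} (h : ∀ f : Fn I M, lie X f = lie Y f) :
    X = Y := by
  refine ContMDiffSection.ext fun x => ?_
  rw [← sub_eq_zero]
  refine eq_zero_of_mvfderiv_eq_zero x _ fun f => ?_
  rw [map_sub, sub_eq_zero]
  exact congrArg (fun f : Fn I M => f x) (h f)

theorem mdifferentiableAt_fn (f : Fn I M) (x : M) : MDifferentiableAt I 𝓘(ℝ, ℝ) f x :=
  f.contMDiff.mdifferentiable (by simp) x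

theorem dFn_mul (f g : Fn I M) : dFn (f * g) = fsmul f (dFn g) + fsmul g (dFn f) := by
  refine ContMDiffSection.ext fun x => ?_
  exact mvfderiv_mul (mdifferentiableAt_fn f x) (mdifferentiableAt_fn g x)

theorem lie_mul (X : VField I M) (f g : Fn I M) :
    lie X (f * g) = lie X f * g + f * lie X g := by
  ext x
  have h := mvfderiv_mul (mdifferentiableAt_fn f x) (mdifferentiableAt_fn g x)
  have h' := congrArg (fun l : TangentSpace I x →L[ℝ] ℝ => l (X x)) h
  refine Eq.trans (b := _) h' ?_
  change f x * mvfderiv I g x (X x) + g x * mvfderiv I f x (X x) =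
    mvfderiv I f x (X x) * g x + f x * mvfderiv I g x (X x)
  ring

theorem pairing_add_left (α β : Form I M) (X : VField I M) :
    pairing (α + β) X = pairing α X + pairing β X := rfl

theorem pairing_smul_left (c : ℝ) (α : Form I M) (X : VField I M) :
    pairing (c • α) X = c • pairing α X := rfl

theorem pairing_sub_left (α β : Form I M) (X : VField I M) :
    pairing (α - β) X = pairing α X - pairing β X := rfl

theorem pairing_fsmul_left (f : Fn I M) (α : Form I M) (X : VField I M) :
    pairing (fsmul f α) X = f * pairing α X := rfl

theorem pairing_zero_left (X : VField I M) : pairing (0 : Form I M) X = 0 := rfl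

theorem pairing_add_right (α : Form I M) (X Y : VField I M) :
    pairing α (X + Y) = pairing α X + pairing α Y := by
  ext x; exact map_add (α x) _ _

theorem pairing_sub_right (α : Form I M) (X Y : VField I M) :
    pairing α (X - Y) = pairing α X - pairing α Y := by
  ext x; exact map_sub (α x) _ _

theorem pairing_smul_right (c : ℝ) (α : Form I M) (X : VField I M) :
    pairing α (c • X) = c • pairing α X := by
  ext x; exact map_smul (α x) _ _

theorem pairing_fsmul_right (f : Fn I M) (α : Form I M) (X : VField I M) :
    pairing α (fsmul f X) = f * pairing α X := by
  ext x; exact map_smul (α x) _ _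

theorem pairing_zero_right (α : Form I M) : pairing α (0 : VField I M) = 0 := by
  ext x; exact map_zero (α x)

theorem lie_add_left (X Y : VField I M) (f : Fn I M) : lie (X + Y) f = lie X f + lie Y f :=
  pairing_add_right _ _ _

theorem lie_sub_left (X Y : VField I M) (f : Fn I M) : lie (X - Y) f = lie X f - lie Y f :=
  pairing_sub_right _ _ _

theorem lie_smul_left (c : ℝ) (X : VField I M) (f : Fn I M) : lie (c • X) f = c • lie X f :=
  pairing_smul_right _ _ _

theorem lie_fsmul_left (f : Fn I M) (X : VField I M) (g : Fn I M) :
    lie (fsmul f X) g = f * lie X g :=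
  pairing_fsmul_right _ _ _

theorem lie_zero_left (f : Fn I M) : lie (0 : VField I M) f = 0 :=
  pairing_zero_right _

theorem lie_sub (X : VField I M) (f g : Fn I M) : lie X (f - g) = lie X f - lie X g := by
  rw [sub_eq_add_neg, CourantAlgebroid.lie_add, ← neg_one_smul ℝ g, CourantAlgebroid.lie_smul,
    neg_one_smul, ← sub_eq_add_neg]

theorem dFn_add [T2Space M] (f g : Fn I M) : dFn (f + g) = dFn f + dFn g :=
  Form.ext_pairing fun Y => CourantAlgebroid.lie_add Y f g

theorem dFn_smul [T2Space M] (c : ℝ) (f : Fn I M) : dFn (c • f) = c • dFn f :=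
  Form.ext_pairing fun Y => CourantAlgebroid.lie_smul Y c f

/-- The Lie bracket of smooth vector fields. -/
def vbracket (X Y : VField I M) : VField I M :=
  ⟨fun x => mlieBracket I X Y x, fun x => by
    have : CompleteSpace EM := FiniteDimensional.complete ℝ EM
    have : IsManifold I (((⊤ : ℕ∞) : WithTop ℕ∞) + 1) M := ‹IsManifold I ∞ M›
    have : IsManifold I (minSmoothness ℝ 2) M := by
      simp only [minSmoothness_of_isRCLikeNormedField]; infer_instance
    exact ContMDiffAt.mlieBracket_vectorField (m := ⊤) (n := ⊤) (X.contMDiff x) (Y.contMDiff x)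
      (by simp)⟩

theorem vbracket_fsmul_right (X Y : VField I M) (f : Fn I M) :
    vbracket X (fsmul f Y) = fsmul (lie X f) Y + fsmul f (vbracket X Y) := by
  have : CompleteSpace EM := FiniteDimensional.complete ℝ EM
  have : IsManifold I 2 M := inferInstance
  refine ContMDiffSection.ext fun x => ?_
  exact mlieBracket_smul_right (mdifferentiableAt_fn f x) Y.mdifferentiableAt

theorem vbracket_add_right (X Y Z : VField I M) :
    vbracket X (Y + Z) = vbracket X Y + vbracket X Z := by
  have : CompleteSpace EM := FiniteDimensional.complete ℝ EM
  have : IsManifold I 2 M := inferInstance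
  refine ContMDiffSection.ext fun x => ?_
  exact mlieBracket_add_right Y.mdifferentiableAt Z.mdifferentiableAt

theorem vbracket_jacobi (X Y Z : VField I M) : vbracket X (vbracket Y Z) =
    vbracket (vbracket X Y) Z + vbracket Y (vbracket X Z) := by
  have : CompleteSpace EM := FiniteDimensional.complete ℝ EM
  have : IsManifold I (minSmoothness ℝ 3) M := by
    simp only [minSmoothness_of_isRCLikeNormedField]; infer_instance
  have h2 : minSmoothness ℝ 2 ≤ (∞ : WithTop ℕ∞) := by
    simp only [minSmoothness_of_isRCLikeNormedField]
    exact ENat.LEInfty.out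
  refine ContMDiffSection.ext fun x => ?_
  exact leibniz_identity_mlieBracket_apply ((X.contMDiff x).of_le h2) ((Y.contMDiff x).of_le h2)
    ((Z.contMDiff x).of_le h2)

/-- Expanding the Jacobi identity for X, Y, fZ by the Leibniz rule in the last argument cancels
everything except the multiples of Z, whose coefficients are the two sides. -/
theorem lie_vbracket [T2Space M] (X Y : VField I M) (f : Fn I M) :
    lie (vbracket X Y) f = lie X (lie Y f) - lie Y (lie X f) := by
  have key : ∀ Z : VField I M, fsmul (lie (vbracket X Y) f) Z =
      fsmul (lie X (lie Y f) - lie Y (lie X f)) Z := by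
    intro Z
    have h := vbracket_jacobi X Y (fsmul f Z)
    simp only [vbracket_fsmul_right, vbracket_add_right, vbracket_jacobi X Y Z] at h
    refine ContMDiffSection.ext fun x => ?_
    have h' := congrArg (fun s : VField I M => s x) h
    simp only [ContMDiffSection.coe_add, Pi.add_apply, fsmul, ContMDiffSection.coeFn_mk] at h' ⊢
    change lie (vbracket X Y) f x • Z x = (lie X (lie Y f) x - lie Y (lie X f) x) • Z x
    rw [sub_smul, eq_sub_iff_add_eq, ← sub_eq_zero]
    rw [← sub_eq_zero] at h'
    rw [← neg_eq_zero, ← h', smul_add]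
    abel
  ext x
  -- Comparing coefficients of Z needs a nonzero vector at x; in dimension zero both sides vanish.
  rcases subsingleton_or_nontrivial (TangentSpace I x) with h | h
  · change mvfderiv I f x _ = mvfderiv I (lie Y f) x _ - mvfderiv I (lie X f) x _
    rw [Subsingleton.elim (vbracket X Y x) 0, Subsingleton.elim (X x) 0,
      Subsingleton.elim (Y x) 0]
    simp
  · obtain ⟨v, hv⟩ := exists_ne (0 : TangentSpace I x)
    obtain ⟨Z, rfl⟩ := exists_sec_apply_eq (I := I) (F := EM)
      (V := fun x : M => TangentSpace I x) x v
    have h' := congrArg (fun s : VField I M => s x) (key Z)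
    exact smul_left_injective ℝ hv h'

theorem pairing_iD (X Y : VField I M) (α : Form I M) : pairing (iD X α) Y =
    lie X (pairing α Y) - lie Y (pairing α X) - pairing α (vbracket X Y) := by
  ext x
  exact iD_apply X Y α x

/-- The Lie derivative of a one-form. -/
def lieForm (X : VField I M) (α : Form I M) : Form I M := iD X α + dFn (pairing α X)

theorem pairing_lieForm (X Y : VField I M) (α : Form I M) : pairing (lieForm X α) Y =
    lie X (pairing α Y) - pairing α (vbracket X Y) := by
  rw [lieForm, pairing_add_left, pairing_iD]
  change _ + lie Y (pairing α X) = _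
  abel

theorem iD_dFn [T2Space M] (X : VField I M) (f : Fn I M) : iD X (dFn f) = 0 := by
  refine Form.ext_pairing fun Y => ?_
  rw [pairing_iD, pairing_zero_left]
  change lie X (lie Y f) - lie Y (lie X f) - lie (vbracket X Y) f = 0
  rw [lie_vbracket, sub_self]

theorem lieForm_dFn [T2Space M] (X : VField I M) (f : Fn I M) :
    lieForm X (dFn f) = dFn (lie X f) := by
  rw [lieForm, iD_dFn, zero_add]
  rfl

theorem lieForm_vbracket [T2Space M] (X Y : VField I M) (α : Form I M) :
    lieForm (vbracket X Y) α = lieForm X (lieForm Y α) - lieForm Y (lieForm X α) := by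
  refine Form.ext_pairing fun Z => ?_
  rw [pairing_sub_left]
  simp only [pairing_lieForm, lie_vbracket, vbracket_jacobi X Y Z, pairing_add_right, lie_sub]
  abel

theorem iD_vbracket [T2Space M] (X Y : VField I M) (α : Form I M) :
    iD (vbracket X Y) α = lieForm X (iD Y α) - iD Y (lieForm X α) := by
  refine Form.ext_pairing fun Z => ?_
  rw [pairing_sub_left]
  simp only [pairing_lieForm, pairing_iD, lie_vbracket, vbracket_jacobi X Y Z, pairing_add_right,
    lie_sub]
  abel

theorem vbracket_add_left [T2Space M] (X Y Z : VField I M) :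
    vbracket (X + Y) Z = vbracket X Z + vbracket Y Z := by
  refine VField.ext_lie fun f => ?_
  simp only [lie_vbracket, lie_add_left, CourantAlgebroid.lie_add]
  abel

theorem vbracket_smul_left [T2Space M] (c : ℝ) (X Z : VField I M) :
    vbracket (c • X) Z = c • vbracket X Z := by
  refine VField.ext_lie fun f => ?_
  simp only [lie_vbracket, lie_smul_left, CourantAlgebroid.lie_smul, smul_sub]

theorem vbracket_fsmul_left [T2Space M] (f : Fn I M) (X Z : VField I M) :
    vbracket (fsmul f X) Z = fsmul f (vbracket X Z) - fsmul (lie Z f) X := by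
  refine VField.ext_lie fun g => ?_
  simp only [lie_vbracket, lie_sub_left, lie_fsmul_left, lie_mul, mul_sub]
  abel

theorem iD_add_left [T2Space M] (X Y : VField I M) (α : Form I M) :
    iD (X + Y) α = iD X α + iD Y α := by
  refine Form.ext_pairing fun Z => ?_
  rw [pairing_add_left]
  simp only [pairing_iD, pairing_add_right, lie_add_left, CourantAlgebroid.lie_add,
    vbracket_add_left]
  abel

theorem iD_smul_left [T2Space M] (c : ℝ) (X : VField I M) (α : Form I M) :
    iD (c • X) α = c • iD X α := by
  refine Form.ext_pairing fun Z => ?_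
  rw [pairing_smul_left]
  simp only [pairing_iD, pairing_smul_right, lie_smul_left, CourantAlgebroid.lie_smul,
    vbracket_smul_left, smul_sub]

theorem iD_add_right [T2Space M] (X : VField I M) (α β : Form I M) :
    iD X (α + β) = iD X α + iD X β := by
  refine Form.ext_pairing fun Z => ?_
  rw [pairing_add_left]
  simp only [pairing_iD, pairing_add_left, CourantAlgebroid.lie_add]
  abel

theorem iD_smul_right [T2Space M] (c : ℝ) (X : VField I M) (α : Form I M) :
    iD X (c • α) = c • iD X α := by
  refine Form.ext_pairing fun Z => ?_
  rw [pairing_smul_left]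
  simp only [pairing_iD, pairing_smul_left, CourantAlgebroid.lie_smul, smul_sub]

theorem iD_zero_left [T2Space M] (α : Form I M) : iD (0 : VField I M) α = 0 := by
  have := iD_smul_left 0 (0 : VField I M) α
  rw [zero_smul] at this
  exact this.trans (zero_smul ℝ (iD (0 : VField I M) α))

theorem iD_fsmul_left [T2Space M] (f : Fn I M) (X : VField I M) (α : Form I M) :
    iD (fsmul f X) α = fsmul f (iD X α) := by
  refine Form.ext_pairing fun Z => ?_
  rw [pairing_fsmul_left]
  simp only [pairing_iD, pairing_fsmul_right, lie_fsmul_left, lie_mul, vbracket_fsmul_left,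
    pairing_sub_right, mul_sub]
  ring

/-- The correction to f i_X dα is function-linear in α, so `iD X` has order one; linearity in X, by
contrast, is exact (`iD_fsmul_left`). -/
theorem iD_fsmul_right [T2Space M] (f : Fn I M) (X : VField I M) (α : Form I M) :
    iD X (fsmul f α) = fsmul f (iD X α) + (fsmul (lie X f) α - fsmul (pairing α X) (dFn f)) := by
  refine Form.ext_pairing fun Z => ?_
  rw [pairing_add_left, pairing_sub_left]
  simp only [pairing_iD, pairing_fsmul_left, lie_mul, mul_sub]
  change _ = _ + (_ - _ * lie Z f)
  ring

end Calculus

/-! ### Consequences of the Courant algebroid axioms -/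

section CourantIdentities

variable {EM : Type*} [NormedAddCommGroup EM] [NormedSpace ℝ EM] [FiniteDimensional ℝ EM]
  {H : Type*} [TopologicalSpace H] {I : ModelWithCorners ℝ EM H}
  {M : Type*} [TopologicalSpace M] [ChartedSpace H M] [IsManifold I ∞ M]
  {F : Type*} [NormedAddCommGroup F] [NormedSpace ℝ F] [FiniteDimensional ℝ F]
  {V : M → Type*} [TopologicalSpace (TotalSpace F V)]
  [∀ x, AddCommGroup (V x)] [∀ x, Module ℝ (V x)] [∀ x, TopologicalSpace (V x)]
  [FiberBundle F V] [VectorBundle ℝ F V]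
  [∀ x, IsTopologicalAddGroup (V x)] [∀ x, ContinuousSMul ℝ (V x)]
  [ContMDiffVectorBundle ∞ F V I]

namespace AnchoredMetricBundle

variable (A : AnchoredMetricBundle I F V)

theorem ip_comm (s t : Sec I F V) : A.ip s t = A.ip t s := by
  ext x; exact A.metric_symm x _ _

theorem ip_add_left (s s' t : Sec I F V) : A.ip (s + s') t = A.ip s t + A.ip s' t := by
  ext x
  exact congrArg (fun l : V x →L[ℝ] ℝ => l (t x)) (map_add (A.metric x) (s x) (s' x))

theorem ip_smul_left (c : ℝ) (s t : Sec I F V) : A.ip (c • s) t = c • A.ip s t := by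
  ext x
  exact congrArg (fun l : V x →L[ℝ] ℝ => l (t x)) (map_smul (A.metric x) c (s x))

theorem ip_fsmul_left (f : Fn I M) (s t : Sec I F V) : A.ip (fsmul f s) t = f * A.ip s t := by
  ext x
  exact congrArg (fun l : V x →L[ℝ] ℝ => l (t x)) (map_smul (A.metric x) (f x) (s x))

theorem ext_ip [T2Space M] {s s' : Sec I F V} (h : ∀ t, A.ip s t = A.ip s' t) : s = s' := by
  refine ContMDiffSection.ext fun x => ?_
  rw [← sub_eq_zero]
  refine A.metric_nondegenerate x _ fun v => ?_
  obtain ⟨t, rfl⟩ := exists_sec_apply_eq (I := I) (F := F) x v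
  rw [map_sub]
  exact sub_eq_zero.2 (congrArg (fun f : Fn I M => f x) (h t))

theorem rho_add (s t : Sec I F V) : A.rho (s + t) = A.rho s + A.rho t :=
  ContMDiffSection.ext fun x => map_add (A.anchor x) _ _

theorem rho_smul (c : ℝ) (s : Sec I F V) : A.rho (c • s) = c • A.rho s :=
  ContMDiffSection.ext fun x => map_smul (A.anchor x) c _

theorem rho_fsmul (f : Fn I M) (s : Sec I F V) : A.rho (fsmul f s) = fsmul f (A.rho s) :=
  ContMDiffSection.ext fun x => map_smul (A.anchor x) (f x) _

theorem rhoStar_add [T2Space M] (α β : Form I M) :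
    A.rhoStar (α + β) = A.rhoStar α + A.rhoStar β :=
  A.ext_ip fun t => by simp only [ip_rhoStar, ip_add_left, pairing_add_left]

theorem rhoStar_smul [T2Space M] (c : ℝ) (α : Form I M) :
    A.rhoStar (c • α) = c • A.rhoStar α :=
  A.ext_ip fun t => by simp only [ip_rhoStar, ip_smul_left, pairing_smul_left]

theorem rhoStar_fsmul [T2Space M] (f : Fn I M) (α : Form I M) :
    A.rhoStar (fsmul f α) = fsmul f (A.rhoStar α) :=
  A.ext_ip fun t => by simp only [ip_rhoStar, ip_fsmul_left, pairing_fsmul_left]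

end AnchoredMetricBundle

/-- Functions that agree after multiplication with all sections agree, unless the bundle has rank
zero. -/
theorem fn_eq_of_fsmul_eq [T2Space M] [Nontrivial F] {f g : Fn I M}
    (h : ∀ s : Sec I F V, fsmul f s = fsmul g s) : f = g := by
  ext x
  have hn : Nontrivial (V x) :=
    (VectorBundle.continuousLinearEquivAt ℝ F V x).toLinearEquiv.symm.injective.nontrivial
  obtain ⟨v, hv⟩ := exists_ne (0 : V x)
  obtain ⟨s, rfl⟩ := exists_sec_apply_eq (I := I) (F := F) x v
  exact smul_left_injective ℝ hv (congrArg (fun s : Sec I F V => s x) (h s))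

theorem sec_eq_zero [Subsingleton F] (s : Sec I F V) : s = 0 := by
  refine ContMDiffSection.ext fun x => ?_
  have : Subsingleton (V x) :=
    (VectorBundle.continuousLinearEquivAt ℝ F V x).injective.subsingleton
  exact Subsingleton.elim _ _

namespace CourantAlgebroid

open AnchoredMetricBundle

variable (C : CourantAlgebroid I F V)

/-- Not an axiom here: compare metric compatibility for (ft, u) and (t, u), and use nondegeneracy.
-/
theorem bracket_fsmul_right [T2Space M] (f : Fn I M) (s t : Sec I F V) :
    C.bracket s (fsmul f t) = fsmul f (C.bracket s t) + fsmul (lie (C.rho s) f) t := by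
  refine C.ext_ip fun u => ?_
  have h := C.lie_ip s (fsmul f t) u
  have h' := C.lie_ip s t u
  rw [ip_fsmul_left, lie_mul, h', ip_fsmul_left] at h
  rw [ip_add_left, ip_fsmul_left, ip_fsmul_left]
  linear_combination -h

theorem dE_mul [T2Space M] (f g : Fn I M) :
    C.dE (f * g) = fsmul f (C.dE g) + fsmul g (C.dE f) := by
  simp only [dE, dFn_mul, rhoStar_add, rhoStar_fsmul]

/-- Follows from the rule in the right argument, since the symmetric part of the bracket is d_E of
the metric and d_E is a derivation. -/
theorem bracket_fsmul_left [T2Space M] (f : Fn I M) (s t : Sec I F V) :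
    C.bracket (fsmul f s) t = fsmul f (C.bracket s t) +
      (fsmul (C.ip s t) (C.dE f) - fsmul (lie (C.rho t) f) s) := by
  have h₁ := C.bracket_add_swap (fsmul f s) t
  have h₂ := C.bracket_add_swap s t
  rw [ip_fsmul_left, dE_mul, ← h₂, bracket_fsmul_right] at h₁
  have h₃ : fsmul f (C.bracket s t + C.bracket t s) =
      fsmul f (C.bracket s t) + fsmul f (C.bracket t s) :=
    ContMDiffSection.ext fun x => smul_add _ _ _
  rw [h₃] at h₁
  rw [eq_sub_iff_add_eq.2 h₁]
  abel

/-- The argument of `lie_vbracket` again, with the Jacobi identity for s, t, fu. In rank zero there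
is no u to compare coefficients of, but all sections vanish. -/
theorem lie_rho_bracket [T2Space M] (s t : Sec I F V) (f : Fn I M) :
    lie (C.rho (C.bracket s t)) f = lie (C.rho s) (lie (C.rho t) f) -
      lie (C.rho t) (lie (C.rho s) f) := by
  rcases subsingleton_or_nontrivial F with hF | hF
  · have h0 : C.rho (0 : Sec I F V) = 0 := ContMDiffSection.ext fun x => map_zero (C.anchor x)
    rw [sec_eq_zero (C.bracket s t), sec_eq_zero s, sec_eq_zero t, h0]
    simp only [lie_zero_left, sub_self]
  · refine fn_eq_of_fsmul_eq (F := F) (V := V) fun u => ?_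
    have h := C.jacobi s t (fsmul f u)
    simp only [bracket_fsmul_right, map_add, C.jacobi s t u] at h
    refine ContMDiffSection.ext fun x => ?_
    have h' := congrArg (fun s : Sec I F V => s x) h
    simp only [ContMDiffSection.coe_add, Pi.add_apply, fsmul, ContMDiffSection.coeFn_mk] at h' ⊢
    change lie (C.rho (C.bracket s t)) f x • u x =
      (lie (C.rho s) (lie (C.rho t) f) x - lie (C.rho t) (lie (C.rho s) f) x) • u x
    rw [sub_smul, eq_sub_iff_add_eq, ← sub_eq_zero]
    rw [← sub_eq_zero] at h'
    rw [← neg_eq_zero, ← h', smul_add]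
    abel

theorem rho_bracket [T2Space M] (s t : Sec I F V) :
    C.rho (C.bracket s t) = vbracket (C.rho s) (C.rho t) :=
  VField.ext_lie fun f => by rw [lie_rho_bracket, lie_vbracket]

/-- Since d_E⟨s,t⟩ = [s,t] + [t,s], its anchor acts by two opposite commutators. Replacing s by fs
yields ⟨s,t⟩ ρ(d_E f)(g) = 0, and ⟨s,t⟩ can be made nonzero at any given point. -/
theorem lie_rho_dE [T2Space M] (f g : Fn I M) : lie (C.rho (C.dE f)) g = 0 := by
  have h0 : C.rho (0 : Sec I F V) = 0 := ContMDiffSection.ext fun x => map_zero (C.anchor x)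
  rcases subsingleton_or_nontrivial F with hF | hF
  · rw [sec_eq_zero (C.dE f), h0, lie_zero_left]
  · have h : ∀ (s t : Sec I F V) (g : Fn I M), lie (C.rho (C.dE (C.ip s t))) g = 0 := by
      intro s t g
      rw [← C.bracket_add_swap, rho_add, lie_add_left, lie_rho_bracket, lie_rho_bracket]
      abel
    ext x
    have hn : Nontrivial (V x) :=
      (VectorBundle.continuousLinearEquivAt ℝ F V x).toLinearEquiv.symm.injective.nontrivial
    obtain ⟨v, hv⟩ := exists_ne (0 : V x)
    obtain ⟨s, rfl⟩ := exists_sec_apply_eq (I := I) (F := F) x v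
    have ht : ∃ w, C.metric x (s x) w ≠ 0 := by
      by_contra! hw
      exact hv (C.metric_nondegenerate x _ hw)
    obtain ⟨w, hw⟩ := ht
    obtain ⟨t, rfl⟩ := exists_sec_apply_eq (I := I) (F := F) x w
    have h₁ := h (fsmul f s) t g
    rw [ip_fsmul_left, dE_mul, rho_add, rho_fsmul, rho_fsmul, lie_add_left, lie_fsmul_left,
      lie_fsmul_left, h, mul_zero, zero_add] at h₁
    have h₂ := congrArg (fun f : Fn I M => f x) h₁
    exact (mul_eq_zero.1 h₂).resolve_left hw

/-- By adjointness ρ(ρ^*α)(f) = ⟨d_E f, ρ^*α⟩ = α(ρ(d_E f)), so the exact case suffices. -/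
theorem rho_rhoStar [T2Space M] (α : Form I M) : C.rho (C.rhoStar α) = 0 := by
  refine VField.ext_lie fun f => ?_
  rw [lie_zero_left, ← ip_dE, ip_comm, ip_rhoStar]
  have h : C.rho (C.dE f) = 0 := VField.ext_lie fun g => by rw [lie_rho_dE, lie_zero_left]
  rw [h, pairing_zero_right]

theorem bracket_rhoStar [T2Space M] (s : Sec I F V) (α : Form I M) :
    C.bracket s (C.rhoStar α) = C.rhoStar (lieForm (C.rho s) α) := by
  refine C.ext_ip fun t => ?_
  have h := C.lie_ip s (C.rhoStar α) t
  rw [ip_rhoStar, ip_rhoStar, rho_bracket] at h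
  rw [ip_rhoStar, pairing_lieForm, h]
  abel

/-- The operations on functions, sections and one-forms of a Courant algebroid. -/
def ops [T2Space M] : CourantOps (Fn I M) (Sec I F V) (Form I M) where
  ip := C.ip
  lieF := LinearMap.mk₂ ℝ (fun s f => lie (C.rho s) f)
    (fun s t f => by rw [rho_add, lie_add_left]) (fun c s f => by rw [rho_smul, lie_smul_left])
    (fun s f g => lie_add _ _ _) (fun c s f => lie_smul _ _ _)
  dF := { toFun := dFn, map_add' := dFn_add, map_smul' := dFn_smul }
  con s α := pairing α (C.rho s)
  iD := LinearMap.mk₂ ℝ (fun s α => CourantDorfman.iD (C.rho s) α)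
    (fun s t f => by rw [rho_add, iD_add_left]) (fun c s f => by rw [rho_smul, iD_smul_left])
    (fun s f g => iD_add_right _ _ _) (fun c s f => iD_smul_right _ _ _)
  lieO := LinearMap.mk₂ ℝ (fun s α => lieForm (C.rho s) α)
    (fun s t f => by
      simp only [lieForm, rho_add, iD_add_left, pairing_add_right, dFn_add]; abel)
    (fun c s f => by
      simp only [lieForm, rho_smul, iD_smul_left, pairing_smul_right, dFn_smul, smul_add])
    (fun s f g => by
      simp only [lieForm, iD_add_right, pairing_add_left, dFn_add]; abel)
    (fun c s f => by
      simp only [lieForm, iD_smul_right, pairing_smul_left, dFn_smul, smul_add])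
  coan := { toFun := C.rhoStar, map_add' := C.rhoStar_add, map_smul' := C.rhoStar_smul }
  br := C.bracket
  ip_comm := C.ip_comm
  ip_coan := C.ip_rhoStar
  lieF_mul s f g := lie_mul _ f g
  lieF_ip := C.lie_ip
  lieF_br := C.lie_rho_bracket
  lieF_coan α f := by
    change lie (C.rho (C.rhoStar α)) f = 0
    rw [rho_rhoStar, lie_zero_left]
  jacobi := C.jacobi
  br_add_swap := C.bracket_add_swap
  br_coan := C.bracket_rhoStar
  lieO_eq _ _ := rfl
  lieO_br s t α := by
    change lieForm (C.rho (C.bracket s t)) α = _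
    rw [rho_bracket, lieForm_vbracket]
    rfl
  iD_br s t α := by
    change CourantDorfman.iD (C.rho (C.bracket s t)) α = _
    rw [rho_bracket, iD_vbracket]
    rfl
  lieO_dF s f := lieForm_dFn _ f
  iD_dF s f := iD_dFn _ f
  iD_coan α β := by
    change CourantDorfman.iD (C.rho (C.rhoStar α)) β = 0
    rw [rho_rhoStar, iD_zero_left]
  con_coan α β := by
    change pairing β (C.rho (C.rhoStar α)) = 0
    rw [rho_rhoStar, pairing_zero_right]

end CourantAlgebroid

end CourantIdentities

/-! ### Recursive versus slotwise relations, and the recursion for the explicit differential -/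

section Algebra

variable {R E Ω : Type*} [CommRing R] [Algebra ℝ R] [AddCommGroup E] [Module ℝ E]
  [AddCommGroup Ω] [Module ℝ Ω]

namespace CourantOps

variable {C : CourantOps R E Ω} {w : MultiFamily R E Ω}

theorem cons_update_tail {X : Type*} {a : ℕ} (u : Fin (a + 1) → X) (i : Fin a) (s : X) :
    Function.update u i.succ s = Fin.cons (u 0) (Function.update (Fin.tail u) i s) := by
  rw [Fin.cons_update, Fin.cons_self_tail]

theorem update_zero_eq_cons {X : Type*} {a : ℕ} (u : Fin (a + 1) → X) (s : X) :
    Function.update u 0 s = Fin.cons s (Fin.tail u) := by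
  conv_lhs => rw [← Fin.cons_self_tail u]
  rw [Fin.update_cons_zero]

/-- `Head` speaks only of the first slots; inserting the preceding arguments brings any other slot
to the front. The next lemmas use the same induction. -/
theorem IsConv.sec_add (hw : C.IsConv w) (a b : ℕ) (u : Fin a → E) (α : Fin b → Ω) (i : Fin a)
    (s t : E) : w a b (Function.update u i (s + t)) α =
      w a b (Function.update u i s) α + w a b (Function.update u i t) α := by
  induction a generalizing w with
  | zero => exact i.elim0
  | succ a ih =>
    rcases Fin.eq_zero_or_eq_succ i with rfl | ⟨i, rfl⟩
    · simp only [update_zero_eq_cons]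
      exact congrFun (congrFun (congrFun (congrFun (hw.head.add s t) a) b) _) _
    · simp only [cons_update_tail]
      exact ih (hw.ins (u 0)) _ _

theorem IsConv.sec_smul (hw : C.IsConv w) (a b : ℕ) (u : Fin a → E) (α : Fin b → Ω) (i : Fin a)
    (c : ℝ) (s : E) : w a b (Function.update u i (c • s)) α =
      c • w a b (Function.update u i s) α := by
  induction a generalizing w with
  | zero => exact i.elim0
  | succ a ih =>
    rcases Fin.eq_zero_or_eq_succ i with rfl | ⟨i, rfl⟩
    · simp only [update_zero_eq_cons]
      exact congrFun (congrFun (congrFun (congrFun (hw.head.smul c s) a) b) _) _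
    · simp only [cons_update_tail]
      exact ih (hw.ins (u 0)) _ _

theorem IsConv.form_add (hw : C.IsConv w) (a b : ℕ) (u : Fin a → E) (α : Fin b → Ω) (i : Fin b)
    (s t : Ω) : w a b u (Function.update α i (s + t)) =
      w a b u (Function.update α i s) + w a b u (Function.update α i t) := by
  induction b generalizing w with
  | zero => exact i.elim0
  | succ b ih =>
    rcases Fin.eq_zero_or_eq_succ i with rfl | ⟨i, rfl⟩
    · simp only [update_zero_eq_cons]
      exact congrFun (congrFun (congrFun (congrFun (hw.head.addF s t) a) b) _) _
    · simp only [cons_update_tail]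
      exact ih (hw.insF (α 0)) _ _

theorem IsConv.form_smul (hw : C.IsConv w) (a b : ℕ) (u : Fin a → E) (α : Fin b → Ω) (i : Fin b)
    (c : ℝ) (s : Ω) : w a b u (Function.update α i (c • s)) =
      c • w a b u (Function.update α i s) := by
  induction b generalizing w with
  | zero => exact i.elim0
  | succ b ih =>
    rcases Fin.eq_zero_or_eq_succ i with rfl | ⟨i, rfl⟩
    · simp only [update_zero_eq_cons]
      exact congrFun (congrFun (congrFun (congrFun (hw.head.smulF c s) a) b) _) _
    · simp only [cons_update_tail]
      exact ih (hw.insF (α 0)) _ _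

theorem IsConv.symm_head (hw : C.IsConv w) {a b : ℕ} (u : Fin a → E) (x y : Ω) (γ : Fin b → Ω) :
    w a (b + 2) u (Fin.cons x (Fin.cons y γ)) = w a (b + 2) u (Fin.cons y (Fin.cons x γ)) :=
  congrFun (congrFun (congrFun (congrFun (hw.head.symm y x) a) b) u) γ

theorem IsConv.insertNth (hw : C.IsConv w) {a b : ℕ} (u : Fin a → E) (μ : Fin (b + 1)) (β : Ω)
    (γ : Fin b → Ω) : w a (b + 1) u (μ.insertNth β γ) = w a (b + 1) u (Fin.cons β γ) := by
  induction b generalizing w with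
  | zero =>
    rw [Fin.fin_one_eq_zero μ, Fin.insertNth_zero']
  | succ b ih =>
    rcases Fin.eq_zero_or_eq_succ μ with rfl | ⟨μ, rfl⟩
    · rw [Fin.insertNth_zero']
    · conv_lhs => rw [← Fin.cons_self_tail γ]
      conv_rhs => rw [← Fin.cons_self_tail γ]
      rw [Fin.insertNth_succ_cons, hw.symm_head]
      exact ih (hw.insF (γ 0)) μ _

theorem IsConv.update_eq_cons (hw : C.IsConv w) {a b : ℕ} (u : Fin a → E) (α : Fin (b + 1) → Ω)
    (μ : Fin (b + 1)) (β : Ω) :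
    w a (b + 1) u (Function.update α μ β) = w a (b + 1) u (Fin.cons β (μ.removeNth α)) := by
  rw [← hw.insertNth u μ, Fin.insertNth_removeNth]

theorem cons_cons_comp_swap {X : Type*} {a : ℕ} (x y : X) (v : Fin a → X) :
    (Fin.cons x (Fin.cons y v) : Fin (a + 2) → X) ∘
      Equiv.swap (Fin.castSucc (0 : Fin (a + 1))) (Fin.succ 0) = Fin.cons y (Fin.cons x v) := by
  funext i
  simp only [Function.comp_apply, Fin.castSucc_zero]
  refine Fin.cases ?_ (fun i => ?_) i
  · rw [Equiv.swap_apply_left]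
    rfl
  · refine Fin.cases ?_ (fun i => ?_) i
    · rw [Equiv.swap_apply_right]
      rfl
    · rw [Equiv.swap_apply_of_ne_of_ne (Fin.succ_ne_zero _)
        (fun h => Fin.succ_ne_zero _ (Fin.succ_injective _ h))]
      rfl

theorem cons_comp_swap_succ {X : Type*} {a : ℕ} (x : X) (v : Fin a → X) (i j : Fin a) :
    (Fin.cons x v : Fin (a + 1) → X) ∘ Equiv.swap i.succ j.succ =
      Fin.cons x (v ∘ Equiv.swap i j) := by
  funext k
  rw [Function.comp_apply]
  refine Fin.cases ?_ (fun k => ?_) k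
  · rw [Equiv.swap_apply_of_ne_of_ne (Fin.succ_ne_zero _).symm (Fin.succ_ne_zero _).symm]
    rfl
  · rw [Function.Injective.swap_apply (Fin.succ_injective _)]
    rfl

theorem cons_cons_tail_tail {X : Type*} {a : ℕ} (u : Fin (a + 2) → X) :
    Fin.cons (u 0) (Fin.cons (u 1) (Fin.tail (Fin.tail u))) = u := by
  conv_rhs => rw [← Fin.cons_self_tail u, ← Fin.cons_self_tail (Fin.tail u)]
  rfl

/-- Adjacent transpositions generate the symmetric group, and insertions reduce each of them to a
swap of the first two one-forms. -/
theorem IsConv.form_symm (hw : C.IsConv w) (a b : ℕ) (u : Fin a → E) (α : Fin b → Ω)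
    (τ : Equiv.Perm (Fin b)) : w a b u (α ∘ τ) = w a b u α := by
  have key : ∀ (b : ℕ) (w : MultiFamily R E Ω), C.IsConv w → ∀ (i : Fin b)
      (α : Fin (b + 1) → Ω),
      w a (b + 1) u (α ∘ Equiv.swap i.castSucc i.succ) = w a (b + 1) u α := by
    intro b
    induction b with
    | zero => exact fun _ _ i => i.elim0
    | succ b ih =>
      intro w hw i α
      rcases Fin.eq_zero_or_eq_succ i with rfl | ⟨i, rfl⟩
      · conv_lhs => rw [← cons_cons_tail_tail α]
        rw [cons_cons_comp_swap, hw.symm_head, cons_cons_tail_tail]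
      · conv_lhs => rw [← Fin.cons_self_tail α]
        rw [← Fin.succ_castSucc, cons_comp_swap_succ]
        refine (ih _ (hw.insF (α 0)) i _).trans ?_
        rw [insF_apply, Fin.cons_self_tail]
  rcases b with _ | b
  · rw [Subsingleton.elim (α ∘ τ) α]
  · have hτ : τ ∈ Submonoid.closure (Set.range fun i : Fin b => Equiv.swap i.castSucc i.succ) := by
      rw [Equiv.Perm.mclosure_swap_castSucc_succ]
      trivial
    induction hτ using Submonoid.closure_induction generalizing α with
    | mem x hx =>
      obtain ⟨i, rfl⟩ := hx
      exact key b w hw i α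
    | one => rfl
    | mul x y _ _ hx hy =>
      have : α ∘ (x * y : Equiv.Perm (Fin (b + 1))) = (α ∘ x) ∘ y := rfl
      rw [this, hy, hx]

theorem IsConv.exchange_zero (hw : C.IsConv w) (a b : ℕ) (u : Fin (a + 2) → E) (α : Fin b → Ω) :
    w (a + 2) b u α + w (a + 2) b (u ∘ Equiv.swap (Fin.castSucc (0 : Fin (a + 1))) (Fin.succ 0)) α =
      -w a (b + 1) (Fin.removeNth 0 (Fin.removeNth (Fin.castSucc 0) u))
        (Fin.cons (C.dF (C.ip (u (Fin.castSucc 0)) (u (Fin.succ 0)))) α) := by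
  have h := congrFun (congrFun (congrFun (congrFun (hw.head.exch (u 0) (u 1)) a) b)
    (Fin.tail (Fin.tail u))) α
  conv_lhs => rw [← cons_cons_tail_tail u]
  rw [cons_cons_comp_swap]
  exact h

theorem IsConv.exchange (hw : C.IsConv w) (a b : ℕ) (u : Fin (a + 2) → E) (α : Fin b → Ω)
    (i : Fin (a + 1)) :
    w (a + 2) b u α + w (a + 2) b (u ∘ Equiv.swap i.castSucc i.succ) α =
      -w a (b + 1) (i.removeNth (i.castSucc.removeNth u))
        (Fin.cons (C.dF (C.ip (u i.castSucc) (u i.succ))) α) := by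
  induction a generalizing w with
  | zero =>
    rw [Fin.fin_one_eq_zero i]
    exact hw.exchange_zero 0 b u α
  | succ a ih =>
    rcases Fin.eq_zero_or_eq_succ i with rfl | ⟨i, rfl⟩
    · exact hw.exchange_zero (a + 1) b u α
    · have h := ih (hw.ins (u 0)) (Fin.tail u) i
      simp only [ins_apply, ← removeNth_succ_cons, ← cons_comp_swap_succ, Fin.succ_castSucc] at h
      rw [Fin.cons_self_tail] at h
      exact h

/-- The relations of the convolution algebra, as conditions on all arguments. -/
structure Exchange (C : CourantOps R E Ω) (w : MultiFamily R E Ω) : Prop where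
  sec_add : ∀ a b (u : Fin a → E) (α : Fin b → Ω) (i : Fin a) (s t : E),
    w a b (Function.update u i (s + t)) α =
      w a b (Function.update u i s) α + w a b (Function.update u i t) α
  sec_smul : ∀ a b (u : Fin a → E) (α : Fin b → Ω) (i : Fin a) (c : ℝ) (s : E),
    w a b (Function.update u i (c • s)) α = c • w a b (Function.update u i s) α
  form_add : ∀ a b (u : Fin a → E) (α : Fin b → Ω) (μ : Fin b) (β γ : Ω),
    w a b u (Function.update α μ (β + γ)) =
      w a b u (Function.update α μ β) + w a b u (Function.update α μ γ)
  form_smul : ∀ a b (u : Fin a → E) (α : Fin b → Ω) (μ : Fin b) (c : ℝ) (β : Ω),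
    w a b u (Function.update α μ (c • β)) = c • w a b u (Function.update α μ β)
  form_symm : ∀ a b (u : Fin a → E) (α : Fin b → Ω) (τ : Equiv.Perm (Fin b)),
    w a b u (α ∘ τ) = w a b u α
  exchange : ∀ a b (u : Fin (a + 2) → E) (α : Fin b → Ω) (i : Fin (a + 1)),
    w (a + 2) b u α + w (a + 2) b (u ∘ Equiv.swap i.castSucc i.succ) α =
      -w a (b + 1) (i.removeNth (i.castSucc.removeNth u))
        (Fin.cons (C.dF (C.ip (u i.castSucc) (u i.succ))) α)

theorem Exchange.ins (h : C.Exchange w) (e : E) : C.Exchange (ins e w) where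
  sec_add a b u α i s t := by
    simp only [ins_apply, Fin.cons_update, h.sec_add]
  sec_smul a b u α i c s := by
    simp only [ins_apply, Fin.cons_update, h.sec_smul]
  form_add a b u := h.form_add _ _ _
  form_smul a b u := h.form_smul _ _ _
  form_symm a b u := h.form_symm _ _ _
  exchange a b u α i := by
    simp only [ins_apply, ← removeNth_succ_cons, ← cons_comp_swap_succ, Fin.succ_castSucc]
    exact h.exchange (a + 1) b (Fin.cons e u) α i.succ

theorem Exchange.insF (h : C.Exchange w) (β : Ω) : C.Exchange (insF β w) where
  sec_add a b u α := h.sec_add _ _ _ _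
  sec_smul a b u α := h.sec_smul _ _ _ _
  form_add a b u α i s t := by
    simp only [insF_apply, Fin.cons_update, h.form_add]
  form_smul a b u α i c s := by
    simp only [insF_apply, Fin.cons_update, h.form_smul]
  form_symm a b u α τ := by
    have hτ : (Fin.cons β (α ∘ τ) : Fin (b + 1) → Ω) = Fin.cons β α ∘ permCons τ := by
      funext i
      refine Fin.cases ?_ (fun i => ?_) i
      · rw [Function.comp_apply, permCons_zero]
        rfl
      · rw [Function.comp_apply, permCons_succ]
        rfl
    rw [insF_apply, hτ, h.form_symm]
    rfl
  exchange a b u α i := by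
    refine (h.exchange a (b + 1) u (Fin.cons β α) i).trans ?_
    -- The exact form of the relation for `w` stands before β, that for `insF β w` behind it.
    rw [insF_apply, neg_inj, ← cons_cons_comp_swap, h.form_symm]

theorem Exchange.head (h : C.Exchange w) : C.Head w where
  add s t := by
    funext a b u α
    have := h.sec_add (a + 1) b (Fin.cons 0 u) α 0 s t
    simp only [Fin.update_cons_zero] at this
    exact this
  smul c s := by
    funext a b u α
    have := h.sec_smul (a + 1) b (Fin.cons 0 u) α 0 c s
    simp only [Fin.update_cons_zero] at this
    exact this
  addF s t := by
    funext a b u α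
    have := h.form_add a (b + 1) u (Fin.cons 0 α) 0 s t
    simp only [Fin.update_cons_zero] at this
    exact this
  smulF c s := by
    funext a b u α
    have := h.form_smul a (b + 1) u (Fin.cons 0 α) 0 c s
    simp only [Fin.update_cons_zero] at this
    exact this
  symm β γ := by
    funext a b u α
    change w a (b + 2) u (Fin.cons γ (Fin.cons β α)) = w a (b + 2) u (Fin.cons β (Fin.cons γ α))
    rw [← cons_cons_comp_swap, h.form_symm]
  exch e e' := by
    funext a b u α
    have := h.exchange a b (Fin.cons e (Fin.cons e' u)) α 0
    rw [cons_cons_comp_swap] at this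
    exact this

/-- Bridge between the definition of 𝒜 by conditions on all slots and the recursive form on which
the operator calculus runs. -/
theorem isConv_iff_exchange : C.IsConv w ↔ C.Exchange w := by
  constructor
  · intro h
    exact ⟨h.sec_add, h.sec_smul, h.form_add, h.form_smul, h.form_symm, h.exchange⟩
  · intro h n
    induction n generalizing w with
    | zero => trivial
    | succ n ih => exact ⟨h.head, fun e => ih (h.ins e), fun α => ih (h.insF α)⟩

variable (C) in
/-- The terms of the differential with the coanchor. -/
def coanchorTerm (w : MultiFamily R E Ω) : MultiFamily R E Ω
  | _, 0, _, _ => 0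
  | a, b + 1, u, α =>
    ∑ μ : Fin (b + 1), w (a + 1) b (Fin.cons (C.coan (α μ)) u) (μ.removeNth α)

variable (C) in
/-- The terms of the differential with the anchor. -/
def anchorTerm (w : MultiFamily R E Ω) : MultiFamily R E Ω
  | 0, _, _, _ => 0
  | a + 1, b, u, α =>
    ∑ i : Fin (a + 1), (-1) ^ (i : ℕ) * (C.lieF (u i) (w a b (i.removeNth u) α) -
      ∑ μ : Fin b, w a b (i.removeNth u) (Function.update α μ (C.iD (u i) (α μ))))

variable (C) in
/-- The terms of the differential with the bracket. -/
def bracketTerm (w : MultiFamily R E Ω) : MultiFamily R E Ω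
  | 0, _, _, _ => 0
  | a + 1, b, u, α =>
    ∑ i : Fin (a + 1), ∑ j ∈ Finset.Ioi i, (-1) ^ ((i : ℕ) + 1) *
      w a b (i.removeNth (Function.update u j (C.br (u i) (u j)))) α

theorem insF_coanchorTerm (α : Ω) (w : MultiFamily R E Ω) :
    insF α (C.coanchorTerm w) = ins (C.coan α) w + C.coanchorTerm (insF α w) := by
  funext a b u β
  rw [insF_apply, coanchorTerm, Fin.sum_univ_succ]
  rcases b with _ | b
  · simp [coanchorTerm, ins_apply]
  · simp only [Fin.cons_zero, Fin.cons_succ, Fin.removeNth_zero, Fin.tail_cons,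
      removeNth_succ_cons, Pi.add_apply, ins_apply, coanchorTerm, insF_apply]

theorem insF_anchorTerm (α : Ω) (w : MultiFamily R E Ω) :
    insF α (C.anchorTerm w) = C.anchorTerm (insF α w) + C.kap α w := by
  funext a b u β
  rcases a with _ | a
  · simp [insF_apply, anchorTerm, kap_zero]
  · simp only [insF_apply, anchorTerm, kap_succ, Pi.add_apply, Fin.sum_univ_succ (n := b),
      Fin.cons_zero, Fin.cons_succ, Fin.update_cons_zero, Fin.cons_update, ← Finset.sum_neg_distrib,
      ← Finset.sum_add_distrib]
    exact Finset.sum_congr rfl fun i _ => by ring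

theorem insF_bracketTerm (α : Ω) (w : MultiFamily R E Ω) :
    insF α (C.bracketTerm w) = C.bracketTerm (insF α w) := by
  funext a b u β
  rcases a with _ | a <;> rfl

/-- Moving e past ρ^*(α_μ) costs d⟨ρ^*(α_μ), e⟩ = d(α_μ(ρ(e))), the exact part of the Lie derivative
of α_μ that the anchor term lacks. -/
theorem ins_coanchorTerm (e : E) (hw : C.IsConv w) (a b : ℕ) (u : Fin a → E) (α : Fin b → Ω) :
    ins e (C.coanchorTerm w) a b u α = -C.coanchorTerm (ins e w) a b u α -
      ∑ μ, w a b u (Function.update α μ (C.dF (C.con e (α μ)))) := by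
  rcases b with _ | b
  · simp [coanchorTerm, ins_apply]
  · simp only [coanchorTerm, ins_apply, ← Finset.sum_neg_distrib, ← Finset.sum_sub_distrib,
      hw.update_eq_cons]
    refine Finset.sum_congr rfl fun μ _ => ?_
    have h := congrFun (congrFun (congrFun (congrFun (hw.head.exch' (C.coan (α μ)) e) a) b) u)
      (μ.removeNth α)
    rw [C.ip_coan] at h
    exact h

theorem ins_anchorTerm (e : E) (w : MultiFamily R E Ω) (a b : ℕ) (u : Fin a → E)
    (α : Fin b → Ω) : ins e (C.anchorTerm w) a b u α = C.lieF e (w a b u α) -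
      ∑ μ, w a b u (Function.update α μ (C.iD e (α μ))) - C.anchorTerm (ins e w) a b u α := by
  rcases a with _ | a
  · simp [anchorTerm, ins_apply]
  · simp only [ins_apply, anchorTerm, Fin.sum_univ_succ (n := a + 1), Fin.cons_zero, Fin.cons_succ,
      Fin.removeNth_zero, Fin.tail_cons, removeNth_succ_cons, Fin.val_zero, pow_zero, one_mul,
      Fin.val_succ, pow_succ, mul_neg, mul_one, neg_mul, Finset.sum_neg_distrib, sub_eq_add_neg]

theorem ins_bracketTerm (e : E) (w : MultiFamily R E Ω) (a b : ℕ) (u : Fin a → E)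
    (α : Fin b → Ω) : ins e (C.bracketTerm w) a b u α =
      -∑ i, w a b (Function.update u i (C.br e (u i))) α - C.bracketTerm (ins e w) a b u α := by
  rcases a with _ | a
  · simp [bracketTerm, ins_apply]
  · simp only [ins_apply, bracketTerm, Fin.sum_univ_succ (n := a + 1), Fin.cons_zero, Fin.cons_succ,
      Fin.val_zero, Fin.val_succ, pow_succ, mul_neg, mul_one, neg_mul, Finset.sum_neg_distrib,
      sub_eq_add_neg, pow_zero, one_mul, Fin.Ioi_zero_eq_map, Finset.sum_map, Fin.Ioi_succ,
      Fin.coe_succEmb, ← Fin.cons_update, removeNth_succ_cons, Fin.removeNth_zero, Fin.tail_cons]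

/-- The corrections from the coanchor, anchor and bracket terms add up to L_e by `lieO_eq`. On the
one-form side, ρ^* and κ_α come from the coanchor and anchor terms, and the bracket term contributes
nothing. -/
theorem isDifferential_of_eq {d : MultiFamily R E Ω →ₗ[ℝ] MultiFamily R E Ω}
    (hd : ∀ w, d w = C.coanchorTerm w + C.anchorTerm w + C.bracketTerm w) :
    C.IsDifferential d where
  zero w := by
    rw [hd]
    funext u α
    simp [coanchorTerm, anchorTerm, bracketTerm]
  insE e w hw := by
    simp only [hd, map_add]
    funext a b u α
    simp only [Pi.add_apply, Pi.sub_apply, ins_coanchorTerm e hw, ins_anchorTerm, ins_bracketTerm,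
      lieD_apply, C.lieO_eq, hw.form_add, Finset.sum_add_distrib]
    abel
  insO α w hw := by
    simp only [hd, map_add, insF_coanchorTerm, insF_anchorTerm, insF_bracketTerm]
    abel

end CourantOps
end Algebra

/-! ### Transfer to the cochains of a Courant algebroid -/

section Differential

variable {EM : Type*} [NormedAddCommGroup EM] [NormedSpace ℝ EM] [FiniteDimensional ℝ EM]
  {H : Type*} [TopologicalSpace H] {I : ModelWithCorners ℝ EM H}
  {M : Type*} [TopologicalSpace M] [ChartedSpace H M] [IsManifold I ∞ M]
  {F : Type*} [NormedAddCommGroup F] [NormedSpace ℝ F] [FiniteDimensional ℝ F]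
  {V : M → Type*} [TopologicalSpace (TotalSpace F V)]
  [∀ x, AddCommGroup (V x)] [∀ x, Module ℝ (V x)] [∀ x, TopologicalSpace (V x)]
  [FiberBundle F V] [VectorBundle ℝ F V]
  [∀ x, IsTopologicalAddGroup (V x)] [∀ x, ContinuousSMul ℝ (V x)]

/-- On the support a + 2b = p the numbers a and p have the same parity; this turns `par` into the
sign (-1)^p of the Leibniz rule. -/
theorem par_eq_smul {p : ℕ} {w : Cochain I F V} (hw : ∀ a b, a + 2 * b ≠ p → w a b = 0) :
    par w = (-1 : ℝ) ^ p • w := by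
  funext a b e α
  by_cases h : a + 2 * b = p
  · subst h
    rw [par_apply, Pi.smul_apply, Pi.smul_apply, Pi.smul_apply, Pi.smul_apply, pow_add, pow_mul]
    rcases Nat.even_or_odd a with ha | ha <;> simp [ha.neg_one_pow]
  · simp [par_apply, hw a b h]

theorem convMul_degree {p q : ℕ} {w η : Cochain I F V} (hw : ∀ a b, a + 2 * b ≠ p → w a b = 0)
    (hη : ∀ a b, a + 2 * b ≠ q → η a b = 0) (a b : ℕ) (h : a + 2 * b ≠ p + q) :
    convMul w η a b = 0 := by
  funext e α
  refine Finset.sum_eq_zero fun i _ => Finset.sum_eq_zero fun j _ =>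
    Finset.sum_eq_zero fun σ _ => Finset.sum_eq_zero fun τ _ => ?_
  by_cases h1 : (i : ℕ) + 2 * j = p
  · have hi := i.is_le
    have hj := j.is_le
    rw [hη (a - i) (b - j) (by omega)]
    simp
  · rw [hw i j h1]
    simp

namespace CourantAlgebroid

variable [ContMDiffVectorBundle ∞ F V I] {C : CourantAlgebroid I F V}

theorem d_degree {p : ℕ} {w : Cochain I F V} (hw : ∀ a b, a + 2 * b ≠ p → w a b = 0)
    (a b : ℕ) (h : a + 2 * b ≠ p + 1) : C.d w a b = 0 := by
  funext e α
  have hlie : ∀ X : VField I M, lie X 0 = 0 := fun X => by simpa using lie_smul X 0 0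
  have h1 : C.dCoanchor w a b e α = 0 := by
    rcases b with _ | b
    · rfl
    · exact Finset.sum_eq_zero fun μ _ => by rw [hw (a + 1) b (by omega)]; rfl
  have h2 : C.dAnchor w a b e α = 0 ∧ C.dBracket w a b e α = 0 := by
    rcases a with _ | a
    · exact ⟨rfl, rfl⟩
    · have h0 := hw a b (by omega)
      simp [dAnchor, dBracket, h0, hlie]
  change C.dCoanchor w a b e α + C.dAnchor w a b e α + C.dBracket w a b e α = 0
  rw [h1, h2.1, h2.2, add_zero, add_zero]

variable [T2Space M]

theorem d_eq_terms (w : Cochain I F V) :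
    C.d w = C.ops.coanchorTerm w + C.ops.anchorTerm w + C.ops.bracketTerm w := by
  have h1 : C.dCoanchor w = C.ops.coanchorTerm w := by
    funext a b e α
    rcases b with _ | b <;> rfl
  have h2 : C.dAnchor w = C.ops.anchorTerm w := by
    funext a b e α
    rcases a with _ | a <;> rfl
  have h3 : C.dBracket w = C.ops.bracketTerm w := by
    funext a b e α
    rcases a with _ | a <;> rfl
  change C.dCoanchor w + C.dAnchor w + C.dBracket w = _
  rw [h1, h2, h3]

theorem isDifferential_d : C.ops.IsDifferential C.d :=
  CourantOps.isDifferential_of_eq d_eq_terms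

theorem IsConvolution.isConv {p : ℕ} {w : Cochain I F V} (hw : C.IsConvolution p w) :
    C.ops.IsConv w :=
  CourantOps.isConv_iff_exchange.2 ⟨hw.sec_add, hw.sec_smul, hw.form_add, hw.form_smul,
    hw.form_symm, hw.exchange⟩

theorem isConvolution_of_isConv {p : ℕ} {w : Cochain I F V} (hw : C.ops.IsConv w)
    (hd : ∀ a b, a + 2 * b ≠ p → w a b = 0) : C.IsConvolution p w :=
  ⟨hd, hw.sec_add, hw.sec_smul, hw.form_add, hw.form_smul, hw.form_symm, hw.exchange⟩

theorem IsConvolution.d {p : ℕ} {w : Cochain I F V} (hw : C.IsConvolution p w) :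
    C.IsConvolution (p + 1) (C.d w) :=
  isConvolution_of_isConv (isDifferential_d.isConv hw.isConv) (d_degree hw.degree)

theorem IsConvolution.d_d {p : ℕ} {w : Cochain I F V} (hw : C.IsConvolution p w) :
    C.d (C.d w) = 0 :=
  isDifferential_d.comp_self hw.isConv

theorem IsConvolution.convMul {p q : ℕ} {w η : Cochain I F V} (hw : C.IsConvolution p w)
    (hη : C.IsConvolution q η) : C.IsConvolution (p + q) (convMul w η) :=
  isConvolution_of_isConv (by
    rw [convMul_eq_shuffleMul]
    exact isProduct_shuffleMul.isConv hw.isConv hη.isConv) (convMul_degree hw.degree hη.degree)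

theorem IsConvolution.d_convMul {p q : ℕ} {w η : Cochain I F V} (hw : C.IsConvolution p w)
    (hη : C.IsConvolution q η) :
    C.d (CourantDorfman.convMul w η) = CourantDorfman.convMul (C.d w) η +
      (-1 : ℝ) ^ p • CourantDorfman.convMul w (C.d η) := by
  have h := isProduct_shuffleMul.d_mul isDifferential_d hw.isConv hη.isConv
  rw [par_eq_smul hw.degree, map_smul] at h
  simp only [convMul_eq_shuffleMul]
  exact h

/-- On exact one-forms i_{ρ(e)}d(df) = 0, so the corrections in the anchor term drop out. -/
theorem d_eq_standardD {p : ℕ} {w : Cochain I F V} (hw : C.IsConvolution p w) (a b : ℕ)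
    (e : Fin a → Sec I F V) (f : Fin b → Fn I M) :
    C.d w a b e (fun μ => dFn (f μ)) = C.standardD w a b e f := by
  have h1 : ∀ X : VField I M, ∀ a (e : Fin a → Sec I F V) (μ : Fin b), w a b e
      (Function.update (fun μ => dFn (f μ)) μ (iD X (dFn (f μ)))) = 0 := fun X a e μ => by
    -- Additivity at 0 + 0 shows that `w` vanishes when a one-form is zero.
    have h := hw.form_add a b e (fun μ => dFn (f μ)) μ 0 0
    rw [add_zero] at h
    rw [iD_dFn, left_eq_add.1 h]
  have h2 : ∀ (s : Sec I F V) (g : Fn I M), lie (C.rho s) g = C.ip s (C.dE g) := fun s g => by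
    rw [C.ip_comm]
    exact (C.ip_rhoStar _ _).symm
  change C.dCoanchor w a b e _ + C.dAnchor w a b e _ + C.dBracket w a b e _ = _
  rw [add_assoc]
  congr 1
  · rcases b with _ | b <;> rfl
  · rcases a with _ | a
    · exact add_zero _
    · simp only [dAnchor, h1, Finset.sum_const_zero, sub_zero, h2]
      rfl

end CourantAlgebroid

end Differential

/-! ### Orders of composites of differential operators and of products -/

section DiffOp

variable {EM : Type*} [NormedAddCommGroup EM] [NormedSpace ℝ EM] [FiniteDimensional ℝ EM]
  {H : Type*} [TopologicalSpace H] {I : ModelWithCorners ℝ EM H}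
  {M : Type*} [TopologicalSpace M] [ChartedSpace H M] [IsManifold I ∞ M]
  {F : Type*} [NormedAddCommGroup F] [NormedSpace ℝ F] [FiniteDimensional ℝ F]
  {V : M → Type*} [TopologicalSpace (TotalSpace F V)]
  [∀ x, AddCommGroup (V x)] [∀ x, Module ℝ (V x)] [∀ x, TopologicalSpace (V x)]
  [FiberBundle F V] [VectorBundle ℝ F V]
  [∀ x, IsTopologicalAddGroup (V x)] [∀ x, ContinuousSMul ℝ (V x)]
  {F' : Type*} [NormedAddCommGroup F'] [NormedSpace ℝ F'] [FiniteDimensional ℝ F']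
  {V' : M → Type*} [TopologicalSpace (TotalSpace F' V')]
  [∀ x, AddCommGroup (V' x)] [∀ x, Module ℝ (V' x)] [∀ x, TopologicalSpace (V' x)]
  [FiberBundle F' V'] [VectorBundle ℝ F' V']
  [∀ x, IsTopologicalAddGroup (V' x)] [∀ x, ContinuousSMul ℝ (V' x)]

theorem fsmul_add [ContMDiffVectorBundle ∞ F V I] (f : Fn I M) (s t : Sec I F V) :
    fsmul f (s + t) = fsmul f s + fsmul f t := by
  ext x
  simp only [fsmul, ContMDiffSection.coe_add, Pi.add_apply, ContMDiffSection.coeFn_mk, smul_add]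

theorem fsmul_sub [ContMDiffVectorBundle ∞ F V I] (f : Fn I M) (s t : Sec I F V) :
    fsmul f (s - t) = fsmul f s - fsmul f t := by
  ext x
  simp only [fsmul, ContMDiffSection.coe_sub, Pi.sub_apply, ContMDiffSection.coeFn_mk, smul_sub]

theorem fsmul_fsmul (f g : Fn I M) (s : Sec I F V) : fsmul f (fsmul g s) = fsmul (f * g) s := by
  ext x
  simp only [fsmul, ContMDiffSection.coeFn_mk, ContMDiffMap.coe_mul, Pi.mul_apply, mul_smul]

namespace IsDiffOp

variable {D D' : Sec I F V → Fn I M} {k : ℕ}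

theorem mul_left (g : Fn I M) : ∀ {k} {D : Sec I F V → Fn I M}, IsDiffOp k D →
    IsDiffOp k (fun s => g * D s)
  | 0, _, h => fun f s => by simp only [h f s]; ring
  | k + 1, _, h => fun f => by
    convert! (h f).mul_left g using 2
    ring

theorem mul_right (g : Fn I M) (h : IsDiffOp k D) : IsDiffOp k (fun s => D s * g) := by
  simpa only [mul_comm] using h.mul_left g

theorem neg (h : IsDiffOp k D) : IsDiffOp k (fun s => -D s) := by
  simpa only [neg_one_mul] using h.mul_left (-1)

theorem sub (h : IsDiffOp k D) (h' : IsDiffOp k D') : IsDiffOp k (fun s => D s - D' s) := by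
  simpa only [sub_eq_add_neg] using h.add h'.neg

theorem sum {ι : Type*} (u : Finset ι) {D : ι → Sec I F V → Fn I M}
    (h : ∀ i ∈ u, IsDiffOp k (D i)) : IsDiffOp k (fun s => ∑ i ∈ u, D i s) := by
  classical
  induction u using Finset.induction_on with
  | empty => exact IsDiffOp.zero k
  | insert i u hi ih =>
    simp only [Finset.sum_insert hi]
    exact (h i (Finset.mem_insert_self i u)).add
      (ih fun j hj => h j (Finset.mem_insert_of_mem hj))

theorem comp_linear {T : Sec I F' V' → Sec I F V} (hT : ∀ f s, T (fsmul f s) = fsmul f (T s)) :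
    ∀ {k} {D : Sec I F V → Fn I M}, IsDiffOp k D → IsDiffOp k (fun s => D (T s))
  | 0, _, h => fun f s => by simp only [hT, h f]
  | k + 1, _, h => fun f => by
    simp only [hT]
    exact comp_linear hT (h f)

/-- Symbols of additive operators are additive, which lets inductions on the order pass from an
operator to its symbols. -/
theorem add_symbol [ContMDiffVectorBundle ∞ F V I] (hD : ∀ s t, D (s + t) = D s + D t)
    (f : Fn I M) (s t : Sec I F V) : D (fsmul f (s + t)) - f * D (s + t) =
      (D (fsmul f s) - f * D s) + (D (fsmul f t) - f * D t) := by
  rw [fsmul_add, hD, hD]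
  ring

/-- Composition with a first order operator between sections increases the order by one. -/
theorem comp [ContMDiffVectorBundle ∞ F V I] {T : Sec I F' V' → Sec I F V}
    {σ : Fn I M → Sec I F' V' → Sec I F V}
    (hT : ∀ f s, T (fsmul f s) = fsmul f (T s) + σ f s)
    (hσ : ∀ f g s, σ f (fsmul g s) = fsmul g (σ f s)) (hD : ∀ s t, D (s + t) = D s + D t)
    (h : IsDiffOp k D) : IsDiffOp (k + 1) (fun s => D (T s)) := by
  induction k generalizing D with
  | zero =>
    intro f
    simp only [hT, hD, h f, add_sub_cancel_left]
    exact h.comp_linear (hσ f)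
  | succ k ih =>
    intro f
    -- The symbol of D ∘ T at f is the symbol of D at f composed with T, plus D ∘ σ_f.
    convert! (ih (add_symbol hD f) (h f)).add (h.comp_linear (hσ f)) using 2
    simp only [hT, hD]
    ring

theorem lie (X : VField I M) (h : IsDiffOp k D) :
    IsDiffOp (k + 1) (fun s => CourantDorfman.lie X (D s)) := by
  induction k generalizing D with
  | zero =>
    intro f
    simp only [h f, lie_mul, add_sub_cancel_right]
    exact h.mul_left _
  | succ k ih =>
    intro f
    convert! (ih (h f)).add (h.mul_left (CourantDorfman.lie X f)) using 2
    rw [lie_sub, lie_mul]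
    ring

/-- The commutator of an operator with two derivations that have the same symbol. -/
theorem lie_sub_comp [ContMDiffVectorBundle ∞ F V I] (X : VField I M)
    {T : Sec I F V → Sec I F V}
    (hT : ∀ f s, T (fsmul f s) = fsmul f (T s) + fsmul (CourantDorfman.lie X f) s)
    (hD : ∀ s t, D (s + t) = D s + D t) (h : IsDiffOp k D) :
    IsDiffOp k (fun s => CourantDorfman.lie X (D s) - D (T s)) := by
  induction k generalizing D with
  | zero =>
    intro f s
    simp only [hT, hD, h f, h (CourantDorfman.lie X f), lie_mul]
    ring
  | succ k ih =>
    intro f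
    -- The symbol at f is the same commutator for the symbol D_f of D, minus the symbol of D at
    -- X(f).
    convert! (ih (add_symbol hD f) (h f)).sub (h (CourantDorfman.lie X f)) using 2
    simp only [lie_sub, lie_mul, hT, hD]
    ring

end IsDiffOp

variable (I F V) in
/-- The family has order at most `l` in the last section, and order at most `m ≥ l` in the other
sections and in the one-forms. -/
structure HasOrder (m l : ℕ) (w : Cochain I F V) : Prop where
  le : l ≤ m
  form : ∀ a b (e : Fin a → Sec I F V) (α : Fin b → Form I M) (μ : Fin b),
    IsDiffOp m (fun β : Form I M => w a b e (Function.update α μ β))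
  sec : ∀ a b (e : Fin a → Sec I F V) (α : Fin b → Form I M) (i : Fin a),
    IsDiffOp (if (i : ℕ) + 1 = a then l else m)
      (fun s : Sec I F V => w a b (Function.update e i s) α)

namespace HasOrder

variable {m l : ℕ} {w η : Cochain I F V}

theorem mono {m' l' : ℕ} (hm : m ≤ m') (hl : l ≤ l') (h' : l' ≤ m') (h : HasOrder I F V m l w) :
    HasOrder I F V m' l' w :=
  ⟨h', fun a b e α μ => (h.form a b e α μ).mono hm,
    fun a b e α i => (h.sec a b e α i).mono (by split_ifs <;> assumption)⟩

theorem sec_le (h : HasOrder I F V m l w) (a b : ℕ) (e : Fin a → Sec I F V)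
    (α : Fin b → Form I M) (i : Fin a) :
    IsDiffOp m (fun s : Sec I F V => w a b (Function.update e i s) α) :=
  (h.sec a b e α i).mono (by have := h.le; split_ifs <;> omega)

theorem sec_zero (h : HasOrder I F V m l w) (a b : ℕ) (e : Fin a → Sec I F V)
    (α : Fin b → Form I M) : IsDiffOp m (fun s : Sec I F V => w (a + 1) b (Fin.cons s e) α) := by
  simpa only [Fin.update_cons_zero] using h.sec_le (a + 1) b (Fin.cons 0 e) α 0

theorem form_zero (h : HasOrder I F V m l w) (a b : ℕ) (e : Fin a → Sec I F V)
    (α : Fin b → Form I M) : IsDiffOp m (fun β : Form I M => w a (b + 1) e (Fin.cons β α)) := by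
  simpa only [Fin.update_cons_zero] using h.form a (b + 1) e (Fin.cons 0 α) 0

theorem ins (h : HasOrder I F V m l w) (s : Sec I F V) : HasOrder I F V m l (ins s w) where
  le := h.le
  form a b e := h.form (a + 1) b (Fin.cons s e)
  sec a b e α i := by
    simpa only [ins_apply, Fin.cons_update, Fin.val_succ, add_left_inj] using
      h.sec (a + 1) b (Fin.cons s e) α i.succ

theorem insF (h : HasOrder I F V m l w) (β : Form I M) : HasOrder I F V m l (insF β w) where
  le := h.le
  form a b e α μ := by
    simpa only [insF_apply, Fin.cons_update] using h.form a (b + 1) e (Fin.cons β α) μ.succ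
  sec a b e α := h.sec a (b + 1) e (Fin.cons β α)

theorem par (h : HasOrder I F V m l w) : HasOrder I F V m l (par w) where
  le := h.le
  form a b e α μ := (h.form a b e α μ).mul_left _
  sec a b e α i := (h.sec a b e α i).mul_left _

/-- The insertion rules bring the chosen argument to the front, where it enters only one factor of
each summand; the other factor is a coefficient. -/
theorem shuffleMul (hw : HasOrder I F V m m w) (hη : HasOrder I F V m m η) :
    HasOrder I F V m m (shuffleMul w η) where
  le := le_rfl
  form a b e α μ := by
    induction b generalizing w η with
    | zero => exact μ.elim0
    | succ b ih =>
      have h : ∀ γ β, CourantDorfman.shuffleMul w η a (b + 1) e (Fin.cons β γ) = _ :=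
        fun γ β => congrFun (congrFun (congrFun (congrFun
          (isProduct_shuffleMul.insO β w η) a) b) e) γ
      rcases Fin.eq_zero_or_eq_succ μ with rfl | ⟨μ, rfl⟩
      · simp only [CourantOps.update_zero_eq_cons, h]
        refine IsDiffOp.add ?_ ?_
        · simp only [shuffleMulₗ, LinearMap.mk₂_apply, shuffleMul_apply]
          exact IsDiffOp.sum _ fun i _ => IsDiffOp.sum _ fun j _ => IsDiffOp.sum _ fun σ _ =>
            IsDiffOp.sum _ fun τ _ => ((hw.form_zero _ _ _ _).mul_right _).mul_left _
        · simp only [shuffleMulₗ, LinearMap.mk₂_apply, shuffleMul_apply]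
          exact IsDiffOp.sum _ fun i _ => IsDiffOp.sum _ fun j _ => IsDiffOp.sum _ fun σ _ =>
            IsDiffOp.sum _ fun τ _ => ((hη.form_zero _ _ _ _).mul_left _).mul_left _
      · simp only [CourantOps.cons_update_tail, h]
        exact (ih (hw.insF _) hη _ _).add (ih hw (hη.insF _) _ _)
  sec a b e α i := by
    rw [ite_self]
    induction a generalizing w η with
    | zero => exact i.elim0
    | succ a ih =>
      have h : ∀ γ s, CourantDorfman.shuffleMul w η (a + 1) b (Fin.cons s γ) α = _ :=
        fun γ s => congrFun (congrFun (congrFun (congrFun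
          (isProduct_shuffleMul.insE s w η) a) b) γ) α
      rcases Fin.eq_zero_or_eq_succ i with rfl | ⟨i, rfl⟩
      · simp only [CourantOps.update_zero_eq_cons, h]
        refine IsDiffOp.add ?_ ?_
        · simp only [shuffleMulₗ, LinearMap.mk₂_apply, shuffleMul_apply]
          exact IsDiffOp.sum _ fun i _ => IsDiffOp.sum _ fun j _ => IsDiffOp.sum _ fun σ _ =>
            IsDiffOp.sum _ fun τ _ => ((hw.sec_zero _ _ _ _).mul_right _).mul_left _
        · simp only [shuffleMulₗ, LinearMap.mk₂_apply, shuffleMul_apply]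
          exact IsDiffOp.sum _ fun i _ => IsDiffOp.sum _ fun j _ => IsDiffOp.sum _ fun σ _ =>
            IsDiffOp.sum _ fun τ _ => ((hη.sec_zero _ _ _ _).mul_left _).mul_left _
      · simp only [CourantOps.cons_update_tail, h]
        exact (ih (hw.ins _) hη _ _).add (ih hw.par (hη.ins _) _ _)

end HasOrder

end DiffOp

/-! ### The differential raises the order by one -/

section DifferentialOrder

variable {EM : Type*} [NormedAddCommGroup EM] [NormedSpace ℝ EM] [FiniteDimensional ℝ EM]
  {H : Type*} [TopologicalSpace H] {I : ModelWithCorners ℝ EM H}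
  {M : Type*} [TopologicalSpace M] [ChartedSpace H M] [IsManifold I ∞ M] [T2Space M]
  {F : Type*} [NormedAddCommGroup F] [NormedSpace ℝ F] [FiniteDimensional ℝ F]
  {V : M → Type*} [TopologicalSpace (TotalSpace F V)]
  [∀ x, AddCommGroup (V x)] [∀ x, Module ℝ (V x)] [∀ x, TopologicalSpace (V x)]
  [FiberBundle F V] [VectorBundle ℝ F V]
  [∀ x, IsTopologicalAddGroup (V x)] [∀ x, ContinuousSMul ℝ (V x)]
  [ContMDiffVectorBundle ∞ F V I] {C : CourantAlgebroid I F V}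

namespace IsDiffOp

variable {D : Sec I F V → Fn I M} {k : ℕ}

theorem comp_bracket_left (t : Sec I F V) (hD : ∀ s s', D (s + s') = D s + D s')
    (h : IsDiffOp k D) : IsDiffOp (k + 1) (fun s => D (C.bracket s t)) :=
  h.comp (fun f s => C.bracket_fsmul_left f s t) (fun f g s => by
    simp only [AnchoredMetricBundle.ip_fsmul_left, fsmul_sub, fsmul_fsmul, mul_comm]) hD

theorem comp_bracket_right (t : Sec I F V) (hD : ∀ s s', D (s + s') = D s + D s')
    (h : IsDiffOp k D) : IsDiffOp (k + 1) (fun s => D (C.bracket t s)) :=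
  h.comp (fun f s => C.bracket_fsmul_right f t s) (fun f g s => by
    simp only [fsmul_fsmul, mul_comm]) hD

theorem comp_iD {D : Form I M → Fn I M} (X : VField I M) (hD : ∀ s s', D (s + s') = D s + D s')
    (h : IsDiffOp k D) : IsDiffOp (k + 1) (fun β => D (iD X β)) :=
  h.comp (fun f s => iD_fsmul_right f X s) (fun f g s => by
    simp only [pairing_fsmul_left, fsmul_sub, fsmul_fsmul, mul_comm]) hD

end IsDiffOp

namespace HasOrder

variable {m l : ℕ} {w η : Cochain I F V}

theorem add (hw : HasOrder I F V m l w) (hη : HasOrder I F V m l η) :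
    HasOrder I F V m l (w + η) :=
  ⟨hw.le, fun a b e α μ => (hw.form a b e α μ).add (hη.form a b e α μ),
    fun a b e α i => (hw.sec a b e α i).add (hη.sec a b e α i)⟩

/-- No increase of order: ρ^* is function-linear, and ρ^*(α_μ) is put in front, so the last section
stays last. -/
theorem coanchorTerm (hw : HasOrder I F V m l w) :
    HasOrder I F V m l (C.ops.coanchorTerm w) where
  le := hw.le
  form a b e α μ := by
    induction b generalizing w with
    | zero => exact μ.elim0
    | succ b ih =>
      have h : ∀ β γ, C.ops.coanchorTerm w a (b + 1) e (Fin.cons β γ) = _ := fun β γ =>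
        congrFun (congrFun (congrFun (congrFun (CourantOps.insF_coanchorTerm β w) a) b) e) γ
      rcases Fin.eq_zero_or_eq_succ μ with rfl | ⟨μ, rfl⟩
      · simp only [CourantOps.update_zero_eq_cons, h]
        refine IsDiffOp.add ((hw.sec_zero a b e (Fin.tail α)).comp_linear C.rhoStar_fsmul) ?_
        rcases b with _ | b
        · exact IsDiffOp.zero m
        · exact IsDiffOp.sum _ fun ν _ => hw.form_zero _ _ _ _
      · simp only [CourantOps.cons_update_tail, h]
        exact ((hw.ins _).form _ _ _ _ μ).add (ih (hw.insF _) _ μ)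
  sec a b e α i := by
    rcases b with _ | b
    · exact IsDiffOp.zero _
    · exact IsDiffOp.sum _ fun ν _ => (hw.ins _).sec _ _ _ _ i

/-- Only the summand whose slot ν is the varied one sees i_X d applied to the variable. -/
theorem form_iD (hw : HasOrder I F V m l w) (hc : C.ops.IsConv w) (X : VField I M) (a b : ℕ)
    (e : Fin a → Sec I F V) (α : Fin b → Form I M) (μ : Fin b) :
    IsDiffOp (m + 1) (fun β : Form I M => ∑ ν, w a b e (Function.update (Function.update α μ β) ν
      (iD X (Function.update α μ β ν)))) := by
  refine IsDiffOp.sum _ fun ν _ => ?_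
  by_cases h : ν = μ
  · subst h
    simp only [Function.update_self, Function.update_idem]
    exact (hw.form a b e α ν).comp_iD X (hc.form_add a b e α ν)
  · simp only [Function.update_of_ne h, Function.update_comm (Ne.symm h)]
    exact (hw.form _ _ _ _ _).succ

/-- The last section has order l + 1 where it remains an argument differentiated along another
vector field. Where it is omitted it enters through ρ alone, with order 0 in the derivative and at
most m through the one-form slots. This explains the maximum. -/
theorem anchorTerm (hw : HasOrder I F V m l w) (hc : C.ops.IsConv w) :
    HasOrder I F V (m + 1) (max (l + 1) m) (C.ops.anchorTerm w) where
  le := by have := hw.le; omega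
  form a b e α μ := by
    rcases a with _ | a
    · exact IsDiffOp.zero _
    · exact IsDiffOp.sum _ fun i _ =>
        (((hw.form _ _ _ _ _).lie _).sub (hw.form_iD hc (C.rho (e i)) _ _ _ α μ)).mul_left _
  sec a b e α i := by
    induction a generalizing w with
    | zero => exact i.elim0
    | succ a ih =>
      have h : ∀ s u, C.ops.anchorTerm w (a + 1) b (Fin.cons s u) α = _ := fun s u =>
        CourantOps.ins_anchorTerm s w a b u α
      rcases Fin.eq_zero_or_eq_succ i with rfl | ⟨i, rfl⟩
      · simp only [CourantOps.update_zero_eq_cons, h]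
        refine (IsDiffOp.sub ?_ ?_).sub ?_
        · refine IsDiffOp.mono (Nat.zero_le _) fun f s => ?_
          change lie (C.rho (fsmul f s)) _ = f * lie (C.rho s) _
          rw [C.rho_fsmul, lie_fsmul_left]
        · refine IsDiffOp.mono (k := m) (by split_ifs <;> omega)
            (IsDiffOp.sum _ fun μ _ => ?_)
          exact (hw.form _ _ _ α μ).comp_linear (T := fun s => iD (C.rho s) (α μ))
            fun f s => by rw [C.rho_fsmul, iD_fsmul_left]
        -- The remaining terms exist only if another section follows; then the first section is not
        -- the last and order m + 1 is allowed.
        · rcases a with _ | a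
          · exact IsDiffOp.zero _
          · rw [if_neg (by simp)]
            exact IsDiffOp.sum _ fun i _ => (((hw.sec_zero _ _ _ _).lie _).sub
              (IsDiffOp.sum _ fun μ _ => (hw.sec_zero _ _ _ _).succ)).mul_left _
      · simp only [CourantOps.cons_update_tail, h]
        refine (IsDiffOp.sub ?_ ?_).sub ?_
        · refine IsDiffOp.mono ?_ ((hw.sec _ _ _ _ i).lie (C.rho (e 0)))
          simp only [Fin.val_succ, add_left_inj]
          split_ifs <;> omega
        · refine IsDiffOp.mono ?_ (IsDiffOp.sum _ fun μ _ => (hw.sec _ _ _ _ i))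
          simp only [Fin.val_succ, add_left_inj]
          split_ifs <;> omega
        · simpa only [Fin.val_succ, add_left_inj] using
            ih (hw.ins (e 0)) (hc.ins (e 0)) (Fin.tail e) i

/-- A left entry of a bracket always has a later partner, so the last section is only ever a right
entry, in the last slot, which gives l + 1. A left entry may land in any slot, which gives m + 1. -/
theorem bracketTerm (hw : HasOrder I F V m l w) (hc : C.ops.IsConv w) :
    HasOrder I F V (m + 1) (max (l + 1) m) (C.ops.bracketTerm w) where
  le := by have := hw.le; omega
  form a b e α μ := by
    rcases a with _ | a
    · exact IsDiffOp.zero _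
    · exact IsDiffOp.sum _ fun i _ => IsDiffOp.sum _ fun j _ =>
        (hw.form _ _ _ _ _).succ.mul_left _
  sec a b e α i := by
    induction a generalizing w with
    | zero => exact i.elim0
    | succ a ih =>
      have h : ∀ s u, C.ops.bracketTerm w (a + 1) b (Fin.cons s u) α = _ := fun s u =>
        CourantOps.ins_bracketTerm s w a b u α
      rcases Fin.eq_zero_or_eq_succ i with rfl | ⟨i, rfl⟩
      · simp only [CourantOps.update_zero_eq_cons, h]
        rcases a with _ | a
        · simp only [Finset.univ_eq_empty, Finset.sum_empty, neg_zero, zero_sub]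
          exact (IsDiffOp.zero _).neg
        · rw [if_neg (by simp)]
          refine (IsDiffOp.sum _ fun j _ => ?_).neg.sub ?_
          · exact (hw.sec_le _ _ _ _ j).comp_bracket_left _ (hc.sec_add _ _ _ _ j)
          · exact IsDiffOp.sum _ fun i _ => IsDiffOp.sum _ fun j _ =>
              (hw.sec_zero _ _ _ _).succ.mul_left _
      · simp only [CourantOps.cons_update_tail, h]
        refine (IsDiffOp.sum _ fun j _ => ?_).neg.sub ?_
        · by_cases hj : j = i
          · subst hj
            simp only [Function.update_self, Function.update_idem]
            refine IsDiffOp.mono ?_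
              ((hw.sec _ _ _ _ j).comp_bracket_right _ (hc.sec_add _ _ _ _ j))
            simp only [Fin.val_succ, add_left_inj]
            split_ifs <;> omega
          · simp only [Function.update_of_ne hj, Function.update_comm (Ne.symm hj)]
            refine IsDiffOp.mono ?_ (hw.sec _ _ _ _ i)
            simp only [Fin.val_succ, add_left_inj]
            split_ifs <;> omega
        · simpa only [Fin.val_succ, add_left_inj] using
            ih (hw.ins (e 0)) (hc.ins (e 0)) (Fin.tail e) i

theorem d (hw : HasOrder I F V m l w) (hc : C.ops.IsConv w) :
    HasOrder I F V (m + 1) (max (l + 1) m) (C.d w) := by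
  rw [CourantAlgebroid.d_eq_terms]
  have := hw.le
  exact ((hw.coanchorTerm.mono (by omega) (by omega) (by omega)).add (hw.anchorTerm hc)).add
    (hw.bracketTerm hc)

end HasOrder

namespace CourantAlgebroid

variable {p q m : ℕ} {w η : Cochain I F V}

theorem IsDiffCochain.hasOrder (h : C.IsDiffCochain p m w) : HasOrder I F V m m w :=
  ⟨le_rfl, h.form_order, fun a b e α i => (h.sec_order a b e α i).mono (by split_ifs <;> omega)⟩

theorem IsDiffCochain.hasOrder_pred (h : C.IsDiffCochain p m w) (hp : p ≠ 1) :
    HasOrder I F V m (m - 1) w :=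
  ⟨by omega, h.form_order, fun a b e α i => by
    have := h.sec_order a b e α i
    simpa only [hp, ne_eq, not_false_eq_true, and_true] using this⟩

/-- Displays the commutator that saves the order in degree one, where the general bound for the last
section would be m + 1 instead of m. -/
theorem d_two_zero_apply (w : Cochain I F V) (e : Fin 2 → Sec I F V) (α : Fin 0 → Form I M)
    (s : Sec I F V) : C.d w 2 0 (Function.update e 1 s) α =
      lie (C.rho (e 0)) (w 1 0 (fun _ => s) α) - w 1 0 (fun _ => C.bracket (e 0) s) α -
        lie (C.rho s) (w 1 0 (fun _ => e 0) α) := by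
  have h0 : Fin.removeNth 0 (Function.update e 1 s) = fun _ : Fin 1 => s := by
    funext i
    fin_cases i
    rfl
  have h1 : Fin.removeNth 1 (Function.update e 1 s) = fun _ : Fin 1 => e 0 := by
    funext i
    fin_cases i
    rfl
  have h2 : Fin.removeNth 0 (Function.update (Function.update e 1 s) 1 (C.bracket (e 0) s)) =
      fun _ : Fin 1 => C.bracket (e 0) s := by
    funext i
    fin_cases i
    rfl
  have hI : Finset.Ioi (0 : Fin 2) = {1} := rfl
  have hI' : Finset.Ioi (1 : Fin 2) = ∅ := rfl
  have hd (u : Fin 2 → Sec I F V) : C.d w 2 0 u α =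
    0 + C.dAnchor w 2 0 u α + C.dBracket w 2 0 u α := rfl
  have hA (u : Fin 2 → Sec I F V) : C.dAnchor w 2 0 u α = _ := Fin.sum_univ_two _
  have hB (u : Fin 2 → Sec I F V) : C.dBracket w 2 0 u α = _ := Fin.sum_univ_two _
  rw [hd, hA, hB]
  simp only [Finset.univ_eq_empty, Finset.sum_empty, hI, hI', Finset.sum_singleton, h0, h1,
    Function.update_self, Function.update_of_ne (zero_ne_one' (Fin 2)), h2, Fin.val_zero,
    Fin.val_one]
  ring

/-- For p ≠ 1 the bound l = m - 1 on the last section becomes max(l + 1, m) = m. For p = 1 only l =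
m is available, and the last section in bidegree (2,0) needs the commutator estimate. -/
theorem IsDiffCochain.d (hm : 1 ≤ m) (h : C.IsDiffCochain p m w) :
    C.IsDiffCochain (p + 1) (m + 1) (C.d w) where
  toIsConvolution := h.toIsConvolution.d
  form_order := (h.hasOrder.d h.isConv).form
  sec_order a b e α i := by
    by_cases hp : p = 1
    · subst hp
      by_cases hi : (i : ℕ) + 1 = a
      · rw [if_pos ⟨hi, by omega⟩, Nat.add_sub_cancel]
        by_cases hab : a = 2 ∧ b = 0
        · obtain ⟨rfl, rfl⟩ := hab
          obtain rfl : i = 1 := Fin.ext (by simpa using hi)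
          simp only [d_two_zero_apply]
          have hu : ∀ s, (fun _ : Fin 1 => s) = Function.update (fun _ => e 0) 0 s := fun s => by
            funext j
            fin_cases j
            rfl
          -- The term ρ(s)(w(e₀)) is function-linear in s; the other two form the commutator of `w`
          -- with ρ(e₀) and [e₀, ·], both with symbol ρ(e₀)(f).
          refine IsDiffOp.sub ?_ (IsDiffOp.mono (Nat.zero_le m) fun f s => ?_)
          · refine IsDiffOp.lie_sub_comp (D := fun s => w 1 0 (fun _ => s) α)
              (T := fun s => C.bracket (e 0) s) (C.rho (e 0))
              (fun f s => C.bracket_fsmul_right f (e 0) s) (fun s t => ?_) ?_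
            · have := h.sec_add 1 0 (fun _ => e 0) α 0 s t
              rwa [← hu, ← hu, ← hu] at this
            · simpa only [← hu] using h.hasOrder.sec_le 1 0 (fun _ => e 0) α 0
          · rw [C.rho_fsmul, lie_fsmul_left]
        · by_cases h2 : a + 2 * b = 2
          · obtain rfl : a = 0 := by omega
            exact i.elim0
          · simp only [h.toIsConvolution.d.degree a b h2]
            exact IsDiffOp.zero m
      · rw [if_neg (fun hh => hi hh.1)]
        exact (h.hasOrder.d h.isConv).sec_le a b e α i
    -- Here 1 ≤ m enters: it gives (m - 1) + 1 = m.
    · refine (((h.hasOrder_pred hp).d h.isConv).sec a b e α i).mono ?_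
      split_ifs <;> omega

/-- Order m holds in every argument. Passing to m + 1 makes this the bound (m + 1) - 1 required of
the last section, and is harmless in the union over all m. -/
theorem IsDiffCochain.convMul (hw : C.IsDiffCochain p m w) (hη : C.IsDiffCochain q m η) :
    C.IsDiffCochain (p + q) (m + 1) (convMul w η) where
  toIsConvolution := hw.toIsConvolution.convMul hη.toIsConvolution
  form_order a b e α μ := by
    rw [convMul_eq_shuffleMul]
    exact ((hw.hasOrder.shuffleMul hη.hasOrder).form a b e α μ).succ
  sec_order a b e α i := by
    rw [convMul_eq_shuffleMul]
    exact ((hw.hasOrder.shuffleMul hη.hasOrder).sec_le a b e α i).mono (by split_ifs <;> omega)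

end CourantAlgebroid

end DifferentialOrder

/-! ### Homology of a complex in terms of chosen cocycles and quotients -/

section Cohomology

open CategoryTheory

universe u

/-- Z models the kernel of g and Q its quotient by the image of f. Abstract models are allowed
because `cocycles` is a subspace of all cochains, not of the middle term of the complex. -/
theorem nonempty_homology_iso (S : ShortComplex (ModuleCat.{u} ℝ)) {Z Q : Type u} [AddCommGroup Z]
    [Module ℝ Z] [AddCommGroup Q] [Module ℝ Q] (j : Z →ₗ[ℝ] S.X₂) (hj : Function.Injective j)
    (hZ : ∀ x, S.g.hom x = 0 ↔ ∃ z, j z = x) (φ : Z →ₗ[ℝ] Q) (hφ : Function.Surjective φ)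
    (hker : ∀ z, φ z = 0 ↔ ∃ y, S.f.hom y = j z) :
    Nonempty (S.homology ≅ ModuleCat.of ℝ Q) := by
  let e : Z ≃ₗ[ℝ] LinearMap.ker S.g.hom :=
    LinearEquiv.ofBijective (LinearMap.codRestrict _ j fun z => (hZ (j z)).2 ⟨z, rfl⟩)
      ⟨fun x y h => hj (congrArg Subtype.val h), fun x => by
        obtain ⟨z, hz⟩ := (hZ x.1).1 x.2
        exact ⟨z, Subtype.ext hz⟩⟩
  have he : ∀ x, j (e.symm x) = x := fun x => congrArg Subtype.val (e.apply_symm_apply x)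
  have h : LinearMap.range S.moduleCatToCycles = LinearMap.ker (φ ∘ₗ e.symm.toLinearMap) := by
    ext x
    rw [LinearMap.mem_ker, LinearMap.comp_apply, hker, LinearMap.mem_range]
    refine exists_congr fun y => Subtype.ext_iff.trans ?_
    exact (he x).symm ▸ Iff.rfl
  exact ⟨S.moduleCatHomologyIso ≪≫ LinearEquiv.toModuleIso ((Submodule.quotEquivOfEq _ _ h) ≪≫ₗ
    (φ ∘ₗ e.symm.toLinearMap).quotKerEquivOfSurjective (hφ.comp e.symm.surjective))⟩

variable (X : ℕ → Type u) [∀ p, AddCommGroup (X p)] [∀ p, Module ℝ (X p)]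
  (δ : ∀ p, X p →ₗ[ℝ] X (p + 1)) (hδ : ∀ p, δ (p + 1) ∘ₗ δ p = 0)
  {Z Q : Type u} [AddCommGroup Z] [Module ℝ Z] [AddCommGroup Q] [Module ℝ Q]

theorem cochainComplexOf_d (p : ℕ) :
    (cochainComplexOf X δ hδ).d p (p + 1) = ModuleCat.ofHom (δ p) :=
  CochainComplex.of_d (fun p => ModuleCat.of ℝ (X p)) (fun p => ModuleCat.ofHom (δ p)) _

/-- In degree zero the incoming map of the complex is zero, so nothing is divided out and φ must be
bijective. -/
theorem nonempty_homology_zero_iso (j : Z →ₗ[ℝ] X 0) (hj : Function.Injective j)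
    (hZ : ∀ x, δ 0 x = 0 ↔ ∃ z, j z = x) (φ : Z →ₗ[ℝ] Q) (hφ : Function.Bijective φ) :
    Nonempty ((cochainComplexOf X δ hδ).homology 0 ≅ ModuleCat.of ℝ Q) := by
  set K := cochainComplexOf X δ hδ
  have hg : (K.sc' 0 0 1).g = ModuleCat.ofHom (δ 0) := cochainComplexOf_d X δ hδ 0
  have hf : (K.sc' 0 0 1).f = 0 := K.shape 0 0 (by simp)
  obtain ⟨i⟩ := nonempty_homology_iso (K.sc' 0 0 1) j hj (fun x => by rw [hg]; exact hZ x) φ hφ.2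
    fun z => by
      rw [map_eq_zero_iff φ hφ.1, hf]
      constructor
      · rintro rfl
        exact ⟨0, (map_zero j).symm⟩
      · rintro ⟨y, hy⟩
        exact hj (hy.symm.trans (map_zero j).symm)
  exact ⟨K.homologyIsoSc' 0 0 1 (by simp) (by simp) ≪≫ i⟩

theorem nonempty_homology_succ_iso (p : ℕ) (j : Z →ₗ[ℝ] X (p + 1)) (hj : Function.Injective j)
    (hZ : ∀ x, δ (p + 1) x = 0 ↔ ∃ z, j z = x) (φ : Z →ₗ[ℝ] Q) (hφ : Function.Surjective φ)
    (hker : ∀ z, φ z = 0 ↔ ∃ y, δ p y = j z) :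
    Nonempty ((cochainComplexOf X δ hδ).homology (p + 1) ≅ ModuleCat.of ℝ Q) := by
  set K := cochainComplexOf X δ hδ
  have hg : (K.sc' p (p + 1) (p + 2)).g = ModuleCat.ofHom (δ (p + 1)) :=
    cochainComplexOf_d X δ hδ (p + 1)
  have hf : (K.sc' p (p + 1) (p + 2)).f = ModuleCat.ofHom (δ p) := cochainComplexOf_d X δ hδ p
  obtain ⟨i⟩ := nonempty_homology_iso (K.sc' p (p + 1) (p + 2)) j hj
    (fun x => by rw [hg]; exact hZ x) φ hφ fun z => by rw [hf]; exact hker z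
  exact ⟨K.homologyIsoSc' p (p + 1) (p + 2) (by simp) (by simp) ≪≫ i⟩

end Cohomology

/-! ### The complex 𝔇 and its cohomology -/

section Complex

variable {EM : Type*} [NormedAddCommGroup EM] [NormedSpace ℝ EM] [FiniteDimensional ℝ EM]
  {H : Type*} [TopologicalSpace H] {I : ModelWithCorners ℝ EM H}
  {M : Type*} [TopologicalSpace M] [ChartedSpace H M] [IsManifold I ∞ M] [T2Space M]
  {F : Type*} [NormedAddCommGroup F] [NormedSpace ℝ F] [FiniteDimensional ℝ F]
  {V : M → Type*} [TopologicalSpace (TotalSpace F V)]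
  [∀ x, AddCommGroup (V x)] [∀ x, Module ℝ (V x)] [∀ x, TopologicalSpace (V x)]
  [FiberBundle F V] [VectorBundle ℝ F V]
  [∀ x, IsTopologicalAddGroup (V x)] [∀ x, ContinuousSMul ℝ (V x)]
  [ContMDiffVectorBundle ∞ F V I] (C : CourantAlgebroid I F V)

namespace CourantAlgebroid

variable {C} {p q : ℕ} {w η : Cochain I F V}

theorem isConvolution_of_mem (h : w ∈ C.diffAlgebra p) : C.IsConvolution p w := by
  obtain ⟨m, _, hw⟩ := h
  exact hw.toIsConvolution

theorem d_mem_diffAlgebra (h : w ∈ C.diffAlgebra p) : C.d w ∈ C.diffAlgebra (p + 1) := by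
  obtain ⟨m, hm, hw⟩ := h
  exact ⟨m + 1, by omega, IsDiffCochain.d hm hw⟩

theorem convMul_mem_diffAlgebra (hw : w ∈ C.diffAlgebra p) (hη : η ∈ C.diffAlgebra q) :
    convMul w η ∈ C.diffAlgebra (p + q) := by
  obtain ⟨m, hm, hw⟩ := hw
  obtain ⟨n, hn, hη⟩ := hη
  exact ⟨max m n + 1, by omega, IsDiffCochain.convMul
    (IsDiffCochain.mono (le_max_left m n) hw) (IsDiffCochain.mono (le_max_right m n) hη)⟩

variable (C) in
/-- The differential on the homogeneous parts of the algebra. -/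
def dRestrict (p : ℕ) : C.diffAlgebra p →ₗ[ℝ] C.diffAlgebra (p + 1) :=
  C.d.restrict fun _ => d_mem_diffAlgebra

theorem dRestrict_comp (p : ℕ) : C.dRestrict (p + 1) ∘ₗ C.dRestrict p = 0 :=
  LinearMap.ext fun w => Subtype.ext (isConvolution_of_mem w.2).d_d

theorem dRestrict_eq_zero (p : ℕ) (x : C.diffAlgebra p) : C.dRestrict p x = 0 ↔
    ∃ z, Submodule.inclusion (inf_le_left : C.cocycles p ≤ C.diffAlgebra p) z = x := by
  constructor
  · exact fun h => ⟨⟨x.1, x.2, congrArg Subtype.val h⟩, rfl⟩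
  · rintro ⟨z, rfl⟩
    exact Subtype.ext z.2.2

theorem mkQ_coboundaries_eq_zero (p : ℕ) (z : C.cocycles p) :
    ((C.coboundaries p).submoduleOf (C.cocycles p)).mkQ z = 0 ↔
      (z : Cochain I F V) ∈ C.coboundaries p :=
  Submodule.Quotient.mk_eq_zero _

theorem nonempty_homology_iso_cohomology (p : ℕ) : Nonempty
    ((cochainComplexOf (fun p => C.diffAlgebra p) C.dRestrict dRestrict_comp).homology p ≅
      ModuleCat.of ℝ (C.Cohomology p)) := by
  rcases p with _ | p
  · refine nonempty_homology_zero_iso (fun p => C.diffAlgebra p) C.dRestrict dRestrict_comp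
      (Submodule.inclusion inf_le_left) (Submodule.inclusion_injective _) (dRestrict_eq_zero 0)
      (Submodule.mkQ _) ⟨(injective_iff_map_eq_zero _).2 fun z hz => ?_,
        Submodule.mkQ_surjective _⟩
    exact Subtype.ext ((Submodule.mem_bot ℝ).1 ((mkQ_coboundaries_eq_zero 0 z).1 hz))
  · refine nonempty_homology_succ_iso (fun p => C.diffAlgebra p) C.dRestrict dRestrict_comp p
      (Submodule.inclusion inf_le_left) (Submodule.inclusion_injective _)
      (dRestrict_eq_zero (p + 1)) (Submodule.mkQ _) (Submodule.mkQ_surjective _) fun z => ?_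
    refine (mkQ_coboundaries_eq_zero (p + 1) z).trans ?_
    constructor
    · rintro ⟨y, hy, h⟩
      exact ⟨⟨y, hy⟩, Subtype.ext h⟩
    · rintro ⟨y, h⟩
      exact ⟨y, y.2, congrArg Subtype.val h⟩

end CourantAlgebroid

end Complex
end
end CourantDorfman

open CourantDorfman
theorem mainTheorem7 {n : ℕ} {M : Type*} [TopologicalSpace M] [T2Space M]
    [SecondCountableTopology M] [ChartedSpace (EuclideanSpace ℝ (Fin n)) M] [IsManifold (𝓡 n) ∞ M]
    {F : Type*} [NormedAddCommGroup F] [NormedSpace ℝ F] [FiniteDimensional ℝ F]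
    {V : M → Type*} [TopologicalSpace (TotalSpace F V)]
    [∀ x, AddCommGroup (V x)] [∀ x, Module ℝ (V x)] [∀ x, TopologicalSpace (V x)]
    [∀ x, IsTopologicalAddGroup (V x)] [∀ x, ContinuousSMul ℝ (V x)]
    [FiberBundle F V] [VectorBundle ℝ F V] [ContMDiffVectorBundle ∞ F V (𝓡 n)]
    (C : CourantAlgebroid (𝓡 n) F V) :
    -- `d` maps `𝔇^p_{m, m-1}` to `𝔇^{p+1}_{m+1, m}`
    (∀ p m : ℕ, 1 ≤ m → ∀ w ∈ C.diffCochains p m, C.d w ∈ C.diffCochains (p + 1) (m + 1)) ∧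
    -- on exact one-forms `d` is given by the formula of the standard differential
    (∀ p, ∀ w ∈ C.diffAlgebra p, ∀ (a b : ℕ) (e : Fin a → Sec (𝓡 n) F V)
      (f : Fin b → Fn (𝓡 n) M), C.d w a b e (fun μ => dFn (f μ)) = C.standardD w a b e f) ∧
    -- `𝔇` is closed under the product, and `d` is a derivation of degree `+1`
    (∀ p q, ∀ w ∈ C.diffAlgebra p, ∀ η ∈ C.diffAlgebra q,
      convMul w η ∈ C.diffAlgebra (p + q) ∧
      C.d (convMul w η) = convMul (C.d w) η + (-1 : ℝ) ^ p • convMul w (C.d η)) ∧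
    -- `d` squares to zero
    (∀ p, ∀ w ∈ C.diffAlgebra p, C.d (C.d w) = 0) ∧
    -- `(𝔇, d)` is a cochain complex with cohomology `ℌ^p`
    ∃ δ : ∀ p, C.diffAlgebra p →ₗ[ℝ] C.diffAlgebra (p + 1),
      (∀ p (w : C.diffAlgebra p), (δ p w : Cochain (𝓡 n) F V) = C.d w) ∧
      ∃ hδ : ∀ p, δ (p + 1) ∘ₗ δ p = 0, ∀ p, Nonempty
        ((cochainComplexOf (fun p => C.diffAlgebra p) δ hδ).homology p ≅
          ModuleCat.of ℝ (C.Cohomology p)) :=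
  ⟨fun _ _ hm _ hw => CourantAlgebroid.IsDiffCochain.d hm hw,
    fun _ _ hw => CourantAlgebroid.d_eq_standardD (CourantAlgebroid.isConvolution_of_mem hw),
    fun _ _ _ hw _ hη => ⟨CourantAlgebroid.convMul_mem_diffAlgebra hw hη,
      (CourantAlgebroid.isConvolution_of_mem hw).d_convMul
        (CourantAlgebroid.isConvolution_of_mem hη)⟩,
    fun _ _ hw => (CourantAlgebroid.isConvolution_of_mem hw).d_d,
    C.dRestrict, fun _ _ => rfl, CourantAlgebroid.dRestrict_comp,
    CourantAlgebroid.nonempty_homology_iso_cohomology⟩
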